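/- Let $\mathfrak g$ be one of the split Lie algebras $\mathfrak{so}(2c+1)$ ($c\ge1$), $\mathfrak{sp}(2c)$ ($c\ge1$), $\mathfrak{so}(2c)$ ($c\ge 2$) in its standard matrix representation $\{X : {}^tXJ+JX=0\}$, where $J$ has entries $\pm1$ on the skew diagonal and $0$ elsewhere ($J$ symmetric in the orthogonal cases; in the symplectic case the entries above the middle are $1$ and those below are $-1$). Put $N=2c$. Let $r\in\mathbb Q$, and write $r=\ell/n$ in lowest terms ($n\ge1$). Call $r$ *admissible* if $n\mid N$ (symplectic and odd orthogonal cases), respectively $n\mid c$ (even orthogonal case); then put $g=N/n$. For a non-archimedean local field $F$ with residue field $\mathbb F_q$ and normalized absolute value, extended to $\bar F$, an element $X\in\mathfrak g(F)$ is *restricted of slope $r$* if it is regular semisimple, lies in a tamely ramified Cartan subalgebra $\mathfrak t$, $|\alpha(X)|=q^{-r}$ for every absolute root $\alpha$ of $\mathfrak g$ relative to $\mathfrak t$, $|\lambda|=q^{-r}$ for each nonzero eigenvalue $\lambda$ of $X$, and the eigenvalue $0$ has multiplicity at most $1$. Let $\mathfrak g(r)$ be the set of these elements. Two elements of $\mathfrak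 g(r)$ are *stably conjugate* if they are conjugate under $G(\bar F)$, where $G=\mathrm{SO}$ or $\mathrm{Sp}$ is the group of matrices of determinant $1$ that preserve $J$. They are *equivalent* if their eigenvalues can be indexed so that $|\lambda_i(X')-\lambda_i(X)|<q^{-r}$ for all $i$ and, in the even orthogonal case, moreover $|\mathrm{pfaff}(JX)-\mathrm{pfaff}(JX')|<q^{-cr}$. For admissible $r$, let the $r$-reduced algebra $\mathfrak g^{[r]}$ be $\mathfrak{so}(g+1)$, $\mathfrak{sp}(g)$, $\mathfrak{so}(g)$ respectively (with form $j$ of the same kind as $J$) if $n$ is odd, and $\mathfrak{gl}(g)$ if $n$ is even. Let $S_{\mathfrak g,r}$ be the affine variety, given by the following equations over $\mathbb Z[1/M]$: its points are the monic polynomials $R$ of degree $g$ with invertible discriminant and invertible constant term, which are even polynomials if $n$ is odd, together with, in the even orthogonal case, an element $v$ such that $v^2=(-1)^cR(0)$. **Theorem.** For every $\mathfrak g$ and $r$ there is a positive integer $M$, divisible by $(2c)!$, with the following properties. (1) Let $r$ be admissible. For every field $k$ in which $M\neq0$, $S_{\mathfrak g,r}(k)$ is the set of stable conjugacy classes (conjugacy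 over $\bar k$ under $\mathrm{Sp}$, $\mathrm{SO}$ or $\mathrm{GL}$) of regular semisimple elements $x\in\mathfrak g^{[r]}(k)$, with $\det x\ne0$ required if $\mathfrak g$ is even orthogonal or $n$ is even, together with, if $\mathfrak g$ is even orthogonal and $n$ is even, an element $v\in k$ such that $v^2=\det x$. Here $R$ is the characteristic polynomial of $x$ divided by the highest power of $\lambda$ that divides it, and $v=\mathrm{pfaff}(jx)$ if $\mathfrak g$ is even orthogonal and $n$ is odd. (2) Let $F$ be a non-archimedean local field whose residual characteristic is prime to $M$, with a uniformizer $\varpi$. If $r$ is not admissible, then $\mathfrak g(r)$ is empty. If $r$ is admissible, then equivalence is an equivalence relation on $\mathfrak g(r)$, stably conjugate elements are equivalent, and there is a bijection $\mu$ from the set of equivalence classes of stable conjugacy classes in $\mathfrak g(r)$ onto $S_{\mathfrak g,r}(\mathbb F_q)$, given as follows. If $P=\lambda^N+\alpha_1\lambda^{N-1}+\cdots+\alpha_N$ is the characteristic polynomial of $X$ divided by the highest power of $\lambda$ that divides it, then $\mu(X)$ has the polynomial $R=\lambda^g+a_1\lambda^{g-1}+\cdots+a_g$, where $a_j$ is the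 angular component of $\alpha_{nj}$ if $\mathrm{ord}(\alpha_{nj})=\ell j$ and $0$ otherwise, and in the even orthogonal case $v$ is the angular component of $\mathrm{pfaff}(JX)$. -/

import Mathlib

open Polynomial
open scoped NormedField Valued Matrix

attribute [local instance] LieRing.ofAssociativeRing

noncomputable section

namespace ClassicalSlope

/-! ### Split classical Lie algebras in their standard representation -/

/-- The three families: `so(2c+1)`, `sp(2c)`, `so(2c)`. -/
inductive ClassicalType
  | oddOrthogonal
  | symplectic
  | evenOrthogonal

/-- Dimension of the standard representation in rank `c`. -/
def ClassicalType.dim : ClassicalType → ℕ → ℕ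
  | .oddOrthogonal, c => 2 * c + 1
  | .symplectic, c => 2 * c
  | .evenOrthogonal, c => 2 * c

/-- The least rank considered; `so(2)` is excluded. -/
def ClassicalType.minRank : ClassicalType → ℕ
  | .oddOrthogonal => 1
  | .symplectic => 1
  | .evenOrthogonal => 2

/-- The matrix with the signs `ε` along the skew diagonal and zeros elsewhere. -/
def skewDiag {d : ℕ} (ε : Fin d → ℤˣ) (R : Type*) [CommRing R] : Matrix (Fin d) (Fin d) R :=
  Matrix.of fun i j => if j = i.rev then (((ε i : ℤˣ) : ℤ) : R) else 0

/-- The sign patterns used for the defining form `J = skewDiag ε R`.  In the symplectic case the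
entries above the middle are `1` and those below are `-1`; in the orthogonal cases `J` is an
arbitrary symmetric matrix with `±1` along the skew diagonal. -/
def ClassicalType.IsFormSign (T : ClassicalType) {d : ℕ} (ε : Fin d → ℤˣ) : Prop :=
  match T with
  | .symplectic => ∀ i, ε i = if i < i.rev then 1 else -1
  | .oddOrthogonal => ∀ i, ε i.rev = ε i
  | .evenOrthogonal => ∀ i, ε i.rev = ε i

/-- A Lie algebra of `d × d` matrices, over any ring: either `gl(d)`, or the algebra defined by
`ᵗX J + J X = 0` with `J` the skew-diagonal matrix with signs `ε`. -/
inductive MatAlg (d : ℕ)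
  | gl : MatAlg d
  | form (ε : Fin d → ℤˣ) : MatAlg d

/-- The Lie algebra of points over `R`. -/
def MatAlg.lie {d : ℕ} (A : MatAlg d) (R : Type*) [CommRing R] :
    LieSubalgebra R (Matrix (Fin d) (Fin d) R) :=
  match A with
  | .gl => ⊤
  | .form ε => skewAdjointMatricesLieSubalgebra (skewDiag ε R)

/-- The (absolute) rank of the reductive Lie algebra. -/
def MatAlg.rank {d : ℕ} : MatAlg d → ℕ
  | .gl => d
  | .form _ => d / 2

/-- The corresponding connected group: `GL(d)`, or the matrices of determinant one that preserve
the form (`Sp` or `SO`). -/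
def MatAlg.group {d : ℕ} (A : MatAlg d) (R : Type*) [CommRing R] : Subgroup (GL (Fin d) R) :=
  match A with
  | .gl => ⊤
  | .form ε =>
    { carrier := {h | (h.1)ᵀ * skewDiag ε R * h.1 = skewDiag ε R ∧ h.1.det = 1}
      one_mem' := by simp
      mul_mem' := by
        rintro a b ⟨ha, ha'⟩ ⟨hb, hb'⟩
        refine ⟨?_, by simp [ha', hb']⟩
        calc ((a * b).1)ᵀ * skewDiag ε R * (a * b).1
            = (b.1)ᵀ * ((a.1)ᵀ * skewDiag ε R * a.1) * b.1 := by
              simp [Matrix.transpose_mul, Matrix.mul_assoc]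
          _ = skewDiag ε R := by rw [ha, hb]
      inv_mem' := by
        rintro a ⟨ha, ha'⟩
        have h1 : a.1 * (a⁻¹).1 = 1 := by simp
        have h2 : ((a⁻¹).1)ᵀ * (a.1)ᵀ = 1 := by
          rw [← Matrix.transpose_mul, h1, Matrix.transpose_one]
        refine ⟨?_, ?_⟩
        · calc ((a⁻¹).1)ᵀ * skewDiag ε R * (a⁻¹).1
              = ((a⁻¹).1)ᵀ * ((a.1)ᵀ * skewDiag ε R * a.1) * (a⁻¹).1 := by rw [ha]
            _ = (((a⁻¹).1)ᵀ * (a.1)ᵀ) * skewDiag ε R * (a.1 * (a⁻¹).1) := by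
              simp only [Matrix.mul_assoc]
            _ = skewDiag ε R := by rw [h1, h2]; simp
        · have h3 := congrArg Matrix.det h1
          rwa [Matrix.det_mul, ha', one_mul, Matrix.det_one] at h3 }

section Field

variable {d : ℕ} (A : MatAlg d) {K : Type*} [Field K]

/-- A matrix over `K`, viewed over the algebraic closure of `K`. -/
def geom (X : Matrix (Fin d) (Fin d) K) : Matrix (Fin d) (Fin d) (AlgebraicClosure K) :=
  X.map (algebraMap K (AlgebraicClosure K))

/-- The centralizer of `X` in the Lie algebra over the algebraic closure. -/
def MatAlg.centralizer (X : Matrix (Fin d) (Fin d) K) :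
    Submodule (AlgebraicClosure K) (Matrix (Fin d) (Fin d) (AlgebraicClosure K)) :=
  (A.lie (AlgebraicClosure K)).toSubmodule ⊓
    LinearMap.ker (LinearMap.mulLeft (AlgebraicClosure K) (geom X) -
      LinearMap.mulRight (AlgebraicClosure K) (geom X))

/-- Regular semisimple: diagonalizable over the algebraic closure, with centralizer of minimal
dimension, the rank. -/
def MatAlg.IsRegularSemisimple (X : Matrix (Fin d) (Fin d) K) : Prop :=
  Module.End.IsSemisimple (Matrix.toLin' (geom X)) ∧
    Module.finrank (AlgebraicClosure K) (A.centralizer X) = A.rank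

/-- Stable conjugacy: conjugacy by a point of the group over the algebraic closure. -/
def MatAlg.StablyConj (X X' : Matrix (Fin d) (Fin d) K) : Prop :=
  ∃ h ∈ A.group (AlgebraicClosure K), h.1 * geom X * (h⁻¹).1 = geom X'

theorem MatAlg.stablyConj_equivalence : Equivalence (A.StablyConj (K := K)) where
  refl X := ⟨1, one_mem _, by simp⟩
  symm := by
    rintro X X' ⟨h, hh, e⟩
    refine ⟨h⁻¹, inv_mem hh, ?_⟩
    have h1 : (h⁻¹).1 * h.1 = 1 := by simp
    calc (h⁻¹).1 * geom X' * ((h⁻¹)⁻¹).1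
        = ((h⁻¹).1 * h.1) * geom X * ((h⁻¹).1 * h.1) := by
          rw [← e, inv_inv]; simp only [Matrix.mul_assoc]
      _ = geom X := by rw [h1]; simp
  trans := by
    rintro X X' X'' ⟨h, hh, e⟩ ⟨k, hk, e'⟩
    refine ⟨k * h, mul_mem hk hh, ?_⟩
    rw [← e', ← e, mul_inv_rev, Units.val_mul, Units.val_mul]
    simp only [Matrix.mul_assoc]

/-- The multiset of eigenvalues in the standard representation. -/
def eigenvalues (X : Matrix (Fin d) (Fin d) K) : Multiset (AlgebraicClosure K) :=
  (geom X).charpoly.roots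

/-- Pfaffian of a skew-symmetric matrix of even size `d`, over a field in which `d!` is
invertible. -/
def pfaffian (Y : Matrix (Fin d) (Fin d) K) : K :=
  ((2 ^ (d / 2) * (d / 2).factorial : ℕ) : K)⁻¹ *
    ∑ σ : Equiv.Perm (Fin d), ((Equiv.Perm.sign σ : ℤ) : K) *
      ∏ i : Fin (d / 2), Y (σ ⟨2 * i, by omega⟩) (σ ⟨2 * i + 1, by omega⟩)

/-- `α` is an absolute root of the Lie algebra relative to the Cartan subalgebra `t`: a root of
`𝔤 ⊗ K̄` relative to `t ⊗ K̄`, given by its restriction to `t`. -/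
def MatAlg.IsAbsoluteRoot (t : LieSubalgebra K (A.lie K)) (α : t →ₗ[K] AlgebraicClosure K) :
    Prop :=
  α ≠ 0 ∧ ∃ Y ∈ A.lie (AlgebraicClosure K), Y ≠ 0 ∧
    ∀ H : t, geom (H : A.lie K).1 * Y - Y * geom (H : A.lie K).1 = α H • Y

end Field

/-- The nonzero part `f / λ^m` of a polynomial, `m` being the multiplicity of the root `0`. -/
def nonzeroPart {K : Type*} [Field K] (f : K[X]) : K[X] :=
  f /ₘ X ^ f.rootMultiplicity 0

/-! ### Local fields -/

section LocalField

variable {F : Type*} [NontriviallyNormedField F] [IsUltrametricDist F]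

/-- The absolute value on the algebraic closure of `F` that extends that of `F`. -/
def absVal (x : AlgebraicClosure F) : ℝ := spectralNorm F (AlgebraicClosure F) x

variable (F) in
/-- The number `q` of elements of the residue field. -/
def resCard : ℕ := Nat.card 𝓀[F]

variable (F) in
/-- The real number `q ^ (-s)`. -/
def qPow (s : ℚ) : ℝ := (resCard F : ℝ) ^ (-(s : ℝ))

/-- The value group of an extension `E` of `F` (the set on the right is already a subgroup). -/
def valueGroup (E : IntermediateField F (AlgebraicClosure F)) : Subgroup ℝˣ :=
  Subgroup.closure {u | ∃ x ∈ E, absVal x = u}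

/-- The ramification index of `E / F`. -/
def ramIndex (E : IntermediateField F (AlgebraicClosure F)) : ℕ :=
  (valueGroup (⊥ : IntermediateField F (AlgebraicClosure F))).relIndex (valueGroup E)

/-- A Cartan subalgebra is tamely ramified if it splits over a finite extension of `F` whose
ramification index is prime to the residual characteristic.  It splits over `E` if and only if
all eigenvalues of all of its elements lie in `E`. -/
def IsTamelyRamified {d : ℕ} {A : MatAlg d} (t : LieSubalgebra F (A.lie F)) : Prop :=
  ∃ E : IntermediateField F (AlgebraicClosure F), FiniteDimensional F E ∧
    Nat.Coprime (ramIndex E) (ringChar 𝓀[F]) ∧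
    ∀ Y ∈ t, ∀ a ∈ eigenvalues (Y : A.lie F).1, a ∈ E

/-- The restricted elements of slope `r`. -/
structure IsRestricted {d : ℕ} (A : MatAlg d) (r : ℚ) (X : A.lie F) : Prop where
  regular : A.IsRegularSemisimple X.1
  cartan : ∃ t : LieSubalgebra F (A.lie F), t.IsCartanSubalgebra ∧ IsTamelyRamified t ∧
    ∃ hX : X ∈ t, ∀ α : t →ₗ[F] AlgebraicClosure F, A.IsAbsoluteRoot t α →
      absVal (α ⟨X, hX⟩) = qPow F r
  eigenvalue : ∀ a ∈ eigenvalues X.1, a ≠ 0 → absVal a = qPow F r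
  multiplicity : (geom X.1).charpoly.rootMultiplicity 0 ≤ 1

variable (F) in
/-- The set `𝔤(r)` of restricted elements of slope `r`. -/
abbrev Restricted {d : ℕ} (A : MatAlg d) (r : ℚ) : Type _ :=
  {X : A.lie F // IsRestricted A r X}

/-- The matrix of a restricted element. -/
abbrev Restricted.mat {d : ℕ} {A : MatAlg d} {r : ℚ} (X : Restricted F A r) :
    Matrix (Fin d) (Fin d) F := X.1.1

variable (F) in
/-- Stable conjugacy on `𝔤(r)`. -/
def stableSetoid {d : ℕ} (A : MatAlg d) (r : ℚ) : Setoid (Restricted F A r) where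
  r X X' := A.StablyConj X.mat X'.mat
  iseqv :=
    ⟨fun X => A.stablyConj_equivalence.refl X.mat, fun h => A.stablyConj_equivalence.symm h,
      fun h h' => A.stablyConj_equivalence.trans h h'⟩

variable (F) in
/-- The stable conjugacy classes of restricted elements of slope `r`. -/
abbrev StableClass {d : ℕ} (A : MatAlg d) (r : ℚ) : Type _ := Quotient (stableSetoid F A r)

/-- The Pfaffian condition for equivalence, imposed only in the even orthogonal case. -/
def ClassicalType.PfaffianClose (T : ClassicalType) (c : ℕ) (r : ℚ) {d : ℕ} (ε : Fin d → ℤˣ)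
    (X X' : Matrix (Fin d) (Fin d) F) : Prop :=
  match T with
  | .evenOrthogonal =>
    ‖pfaffian (skewDiag ε F * X) - pfaffian (skewDiag ε F * X')‖ < qPow F (c * r)
  | .oddOrthogonal => True
  | .symplectic => True

/-- Equivalence of restricted elements of slope `r`: the eigenvalues can be indexed so that
corresponding ones differ by less than `q ^ (-r)`, and, in the even orthogonal case, the
Pfaffians differ by less than `q ^ (-cr)`. -/
def AreEquivalent (T : ClassicalType) (c : ℕ) (r : ℚ) {d : ℕ} (ε : Fin d → ℤˣ)
    (X X' : Restricted F (MatAlg.form ε) r) : Prop :=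
  (∃ l l' : Fin d → AlgebraicClosure F,
      eigenvalues X.mat = Finset.univ.val.map l ∧
      eigenvalues X'.mat = Finset.univ.val.map l' ∧
      ∀ i, absVal (l' i - l i) < qPow F r) ∧
    T.PfaffianClose c r ε X.mat X'.mat

variable (F) in
/-- Equivalence of stable conjugacy classes. -/
def ClassesEquivalent (T : ClassicalType) (c : ℕ) (r : ℚ) {d : ℕ} (ε : Fin d → ℤˣ)
    (x x' : StableClass F (MatAlg.form ε) r) : Prop :=
  ∃ X X' : Restricted F (MatAlg.form ε) r,
    Quotient.mk _ X = x ∧ Quotient.mk _ X' = x' ∧ AreEquivalent T c r ε X X'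

/-- The residue map, extended by zero outside the ring of integers. -/
def res (x : F) : 𝓀[F] :=
  open Classical in
  if h : x ∈ 𝒪[F] then IsLocalRing.residue 𝒪[F] ⟨x, h⟩ else 0

/-- The normalized valuation (with the value `0` at `0`). -/
def ord (ϖ : 𝒪[F]) (x : F) : ℤ :=
  open Classical in
  if h : ∃ i : ℤ, ‖x‖ = ‖(ϖ : F)‖ ^ i then h.choose else 0

/-- The angular component. -/
def ac (ϖ : 𝒪[F]) (x : F) : 𝓀[F] := res (x / (ϖ : F) ^ ord ϖ x)

/-- `ac x` if the valuation of `x` is `i`, and `0` otherwise. -/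
def resAt (ϖ : 𝒪[F]) (i : ℤ) (x : F) : 𝓀[F] :=
  open Classical in
  if ‖x‖ = ‖(ϖ : F)‖ ^ i then ac ϖ x else 0

/-- The `r`-reduction `λ^g + a₁ λ^(g-1) + ⋯ + a_g` of a monic polynomial
`P = λ^N + α₁ λ^(N-1) + ⋯ + α_N`.  Here `r = ℓ / n` in lowest terms, `g = N / n`, and `a_j` is
the residue of `α_(nj) / ϖ^(ℓj)`. -/
def rReduction (ϖ : 𝒪[F]) (r : ℚ) (P : F[X]) : 𝓀[F][X] :=
  X ^ (P.natDegree / r.den) +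
    ∑ j ∈ Finset.Icc 1 (P.natDegree / r.den),
      C (resAt ϖ (r.num * j) (P.coeff (P.natDegree - r.den * j))) *
        X ^ (P.natDegree / r.den - j)

/-- The Pfaffian invariant of a restricted element: `ac (pfaff (J X))` in the even orthogonal
case, and the dummy value `0` otherwise. -/
def ClassicalType.pfaffianInvariant (T : ClassicalType) (ϖ : 𝒪[F]) {d : ℕ} (ε : Fin d → ℤˣ)
    (X : Matrix (Fin d) (Fin d) F) : 𝓀[F] :=
  match T with
  | .evenOrthogonal => ac ϖ (pfaffian (skewDiag ε F * X))
  | .oddOrthogonal => 0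
  | .symplectic => 0

end LocalField

/-! ### The parameter space

Throughout `N = 2c`, `r = L / N = ℓ / n` with `ℓ / n` in lowest terms, and `g = gcd (L, N) = N / n`.
-/

/-- The slopes that occur: `N r`, respectively `c r` in the even orthogonal case, is an integer. -/
def ClassicalType.Admissible (T : ClassicalType) (c : ℕ) (r : ℚ) : Prop :=
  match T with
  | .evenOrthogonal => r.den ∣ c
  | .oddOrthogonal => r.den ∣ 2 * c
  | .symplectic => r.den ∣ 2 * c

/-- The degree `g = N / n`. -/
def redDegree (c : ℕ) (r : ℚ) : ℕ := 2 * c / r.den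

/-- Coordinates on the parameter space: the coefficients `a j` of `λ^(g-1-j)`, the Pfaffian
coordinate `v`, and the inverse `w` of a discriminant. -/
inductive ParamVar (g : ℕ)
  | a (j : Fin g) : ParamVar g
  | v : ParamVar g
  | w : ParamVar g

/-- The generic monic polynomial of degree `g`. -/
def genericPoly (g : ℕ) (B : Type*) [CommRing B] : (MvPolynomial (ParamVar g) B)[X] :=
  X ^ g + ∑ j : Fin g, C (MvPolynomial.X (ParamVar.a j)) * X ^ (g - 1 - (j : ℕ))

/-- The equation of the Pfaffian coordinate: `v ^ 2 = (-1) ^ c R(0)` in the even orthogonal case.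
In the other cases there is no such coordinate, that is, `v = 0`. -/
def ClassicalType.pfaffianEquation (T : ClassicalType) (c g : ℕ) (B : Type*) [CommRing B] :
    MvPolynomial (ParamVar g) B :=
  match T with
  | .evenOrthogonal => MvPolynomial.X .v ^ 2 - (-1) ^ c * (genericPoly g B).coeff 0
  | .oddOrthogonal => MvPolynomial.X .v
  | .symplectic => MvPolynomial.X .v

/-- The equations of the parameter space: the polynomial `R` is even if `n` is odd; the Pfaffian
equation; the discriminant and the constant term of `R` are invertible. -/
def ClassicalType.paramIdeal (T : ClassicalType) (c : ℕ) (r : ℚ) (B : Type*) [CommRing B] :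
    Ideal (MvPolynomial (ParamVar (redDegree c r)) B) :=
  Ideal.span
    ({f | Odd r.den ∧ ∃ j : Fin (redDegree c r), Odd ((j : ℕ) + 1) ∧
          f = MvPolynomial.X (ParamVar.a j)} ∪
      {T.pfaffianEquation c (redDegree c r) B,
        MvPolynomial.X .w *
          ((genericPoly (redDegree c r) B).resultant (genericPoly (redDegree c r) B).derivative
              (redDegree c r) (redDegree c r - 1) *
            (genericPoly (redDegree c r) B).coeff 0) - 1})

/-- The coordinate ring of the affine variety `S_{𝔤,r}` over the base ring `B`. -/
abbrev ClassicalType.ParamRing (T : ClassicalType) (c : ℕ) (r : ℚ) (B : Type*) [CommRing B] :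
    Type _ :=
  MvPolynomial (ParamVar (redDegree c r)) B ⧸ T.paramIdeal c r B

/-- The `k`-points of the affine variety `S_{𝔤,r}` over `ℤ[1/M]`. -/
abbrev ClassicalType.ParamPoint (T : ClassicalType) (c : ℕ) (r : ℚ) (M : ℕ) (k : Type*)
    [CommRing k] : Type _ :=
  T.ParamRing c r (Localization.Away (M : ℤ)) →+* k

section Points

variable {T : ClassicalType} {c : ℕ} {r : ℚ} {M : ℕ} {k : Type*} [CommRing k]

/-- The polynomial `R` of a point of the parameter space. -/
def paramPoly (s : T.ParamPoint c r M k) : k[X] :=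
  (genericPoly (redDegree c r) (Localization.Away (M : ℤ))).map
    (s.comp (Ideal.Quotient.mk (T.paramIdeal c r (Localization.Away (M : ℤ)))))

/-- The Pfaffian coordinate of a point of the parameter space. -/
def paramPfaffian (s : T.ParamPoint c r M k) : k :=
  s (Ideal.Quotient.mk (T.paramIdeal c r (Localization.Away (M : ℤ))) (MvPolynomial.X .v))

end Points

/-! ### The `r`-reduced algebra -/

/-- Size of the matrices of the `r`-reduced algebra. -/
def ClassicalType.redDim (T : ClassicalType) (c : ℕ) (r : ℚ) : ℕ :=
  match T with
  | .oddOrthogonal => if Odd r.den then redDegree c r + 1 else redDegree c r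
  | .symplectic => redDegree c r
  | .evenOrthogonal => redDegree c r

/-- The `r`-reduced algebra `𝔤^[r]`: for odd `n` it is of the same type as `𝔤`, that is `so(g+1)`,
`sp(g)`, `so(g)` (defined by the signs `η`); for even `n` it is `gl(g)`. -/
def ClassicalType.redAlg (T : ClassicalType) (c : ℕ) (r : ℚ) (η : Fin (T.redDim c r) → ℤˣ) :
    MatAlg (T.redDim c r) :=
  if Odd r.den then .form η else .gl

/-- The determinant is required to be nonzero if `𝔤` is even orthogonal or if `n` is even. -/
def ClassicalType.DetCondition (T : ClassicalType) (c : ℕ) (r : ℚ) {k : Type*} [Field k]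
    (x : Matrix (Fin (T.redDim c r)) (Fin (T.redDim c r)) k) : Prop :=
  match T with
  | .evenOrthogonal => x.det ≠ 0
  | .oddOrthogonal => Even r.den → x.det ≠ 0
  | .symplectic => Even r.den → x.det ≠ 0

/-- The additional datum `v`.  In the even orthogonal case it is `pfaff (j x)` if `n` is odd and
a square root of `det x` if `n` is even; in the other cases there is no datum, that is, `v = 0`. -/
def ClassicalType.PfaffianDatum (T : ClassicalType) (c : ℕ) (r : ℚ) {k : Type*} [Field k]
    (η : Fin (T.redDim c r) → ℤˣ) (x : Matrix (Fin (T.redDim c r)) (Fin (T.redDim c r)) k)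
    (v : k) : Prop :=
  match T with
  | .evenOrthogonal => if Odd r.den then v = pfaffian (skewDiag η k * x) else v ^ 2 = x.det
  | .oddOrthogonal => v = 0
  | .symplectic => v = 0

/-- Regular semisimple elements `x` of the `r`-reduced algebra over `k` (with nonzero determinant
where this is required), together with the datum `v` in the even orthogonal case. -/
structure RedElement (T : ClassicalType) (c : ℕ) (r : ℚ) (η : Fin (T.redDim c r) → ℤˣ)
    (k : Type*) [Field k] where
  x : Matrix (Fin (T.redDim c r)) (Fin (T.redDim c r)) k
  v : k
  mem : x ∈ (T.redAlg c r η).lie k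
  regular : (T.redAlg c r η).IsRegularSemisimple x
  det_ne_zero : T.DetCondition c r x
  datum : T.PfaffianDatum c r η x v

end ClassicalSlope

end

open ClassicalSlope

noncomputable section

namespace ClassicalSlope

/-! ### Pfaffians -/

/-! Everything is reduced to a polynomial and a Pfaffian.

Part (1) rests on a classification over an arbitrary field in which enough integers are invertible.
An element with separable characteristic polynomial is determined up to stable conjugacy by this
polynomial and, in the even orthogonal case, by `pfaff (J X)`, a square root of `(-1)^m det X`. For
eigenvectors are orthogonal unless their eigenvalues are opposite, so that over the closure an
eigenbasis can be rescaled to an isometry (`exists_isometric_eigenmatrix`); the sign of its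
determinant is then settled case by case (`stablyConj_form`). Conversely every polynomial of the
right parity, with such a square root in the even orthogonal case, occurs in the split algebra
(`exists_mem_lie_form`). On `K[λ] / (p)` multiplication by `λ` is skew-adjoint for the form `ψ(x
ȳ)`, where the bar is `λ ↦ -λ` and `ψ` takes a coefficient of the reduced representative; explicit
isotropic vectors show that this form is split. Regular semisimple means separable characteristic
polynomial, by a count of the dimension of the centralizer, except that in `so(2m)` a double
eigenvalue `0` is also regular and has to be excluded by hand.

For part (2) choose `y₀` in the closure of `F` with `y₀ ^ n = ϖ ^ ℓ`. The roots of the Lie algebra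
are differences of eigenvalues, so an element is restricted if and only if its characteristic
polynomial is separable and all nonzero eigenvalues, and all differences of two of them, have
absolute value `|y₀|` (`hasSlopeRoots_of_isRestricted`, `isRestricted_of_hasSlopeRoots`). Tameness
is automatic, because the degree of the splitting field divides `d!`.

The residues of the quotients of the nonzero eigenvalues by `y₀` are the roots of `R(λ ^ n)`, where
`R` is the reduction of `P` (`prod_res_eq_rReduction`): the coefficients of `P` in degrees
prohibited by the value group cannot be extremal. Hence the slope condition says that `R` is
separable with `R(0) ≠ 0`, and equivalence says that the reductions, and the angular components of
the Pfaffians, coincide (`areEquivalent_iff`). Admissibility holds because `P(0)` and the Pfaffian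
lie in `F` and have absolute values `q ^ (-Nr)` and `q ^ (-cr)`. Surjectivity needs no Hensel
argument: the coefficients of `R` are lifted to a polynomial `Q`, `P = Q(λ ^ n)` is taken, and in
the even orthogonal case the constant term is defined as a signed square, so that the Pfaffian
equation holds exactly (`exists_restricted`). -/

/-- The sum that defines the Pfaffian, for matrices indexed by pairs. -/
def pfaffianSum {ι K : Type*} [Fintype ι] [DecidableEq ι] [Field K]
    (Y : Matrix (ι × Bool) (ι × Bool) K) : K :=
  ∑ σ : Equiv.Perm (ι × Bool), ((Equiv.Perm.sign σ : ℤ) : K) *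
    ∏ i : ι, Y (σ (i, false)) (σ (i, true))

section PfaffianSum

variable {ι K : Type*} [Fintype ι] [DecidableEq ι] [Field K]

set_option linter.unusedSectionVars false

theorem prod_pair_bool (f : ι × Bool → K) : ∏ x, f x = ∏ i, f (i, false) * f (i, true) := by
  rw [Fintype.prod_prod_type]
  exact Finset.prod_congr rfl fun i _ => by rw [Fintype.prod_bool, mul_comm]

theorem sum_sign_prod (A : Matrix (ι × Bool) (ι × Bool) K) (p : ι × Bool → ι × Bool) :
    ∑ σ : Equiv.Perm (ι × Bool), ((Equiv.Perm.sign σ : ℤ) : K) * ∏ x, A (p x) (σ x) =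
      (A.submatrix p id).det := by
  rw [← Matrix.det_transpose, Matrix.det_apply']
  rfl

/-- Expanding the product over the pairs gives a sum over all maps `p` of the index set to itself.
Summation over `σ` turns the `A`-factor into the determinant of the rows `p` of `A`, so that only
permutations `p` survive, with `sign p * det A`. Skew-symmetry of `B` plays no role. -/
theorem pfaffianSum_transpose_mul_mul (A B : Matrix (ι × Bool) (ι × Bool) K) :
    pfaffianSum (Aᵀ * B * A) = A.det * pfaffianSum B := by
  have key : ∀ σ : Equiv.Perm (ι × Bool),
      ∏ i : ι, (Aᵀ * B * A) (σ (i, false)) (σ (i, true)) =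
        ∑ p : ι × Bool → ι × Bool,
          (∏ i, B (p (i, false)) (p (i, true))) * ∏ x, A (p x) (σ x) := by
    intro σ
    have h1 : ∀ i : ι, (Aᵀ * B * A) (σ (i, false)) (σ (i, true)) =
        ∑ q : (ι × Bool) × (ι × Bool),
          B q.1 q.2 * (A q.1 (σ (i, false)) * A q.2 (σ (i, true))) := by
      intro i
      rw [Fintype.sum_prod_type_right]
      simp only [Matrix.mul_apply, Matrix.transpose_apply, Finset.sum_mul]
      refine Finset.sum_congr rfl fun y _ => Finset.sum_congr rfl fun z _ => by ring
    simp only [h1]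
    rw [Finset.prod_univ_sum, Fintype.piFinset_univ]
    -- Choosing a pair of indices for every `i` is the same as choosing one index for every element
    -- of `ι × Bool`.
    let e : (ι → (ι × Bool) × (ι × Bool)) ≃ (ι × Bool → ι × Bool) :=
      { toFun := fun q x => if x.2 then (q x.1).2 else (q x.1).1
        invFun := fun p i => (p (i, false), p (i, true))
        left_inv := fun q => by ext i <;> simp
        right_inv := fun p => by
          funext ⟨i, b⟩
          cases b <;> simp }
    refine Fintype.sum_equiv e _ _ fun q => ?_
    rw [prod_pair_bool, ← Finset.prod_mul_distrib]
    simp [e]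
  unfold pfaffianSum
  simp only [key, Finset.mul_sum]
  rw [Finset.sum_comm]
  have h2 : ∀ p : ι × Bool → ι × Bool,
      ∑ σ : Equiv.Perm (ι × Bool), ((Equiv.Perm.sign σ : ℤ) : K) *
        ((∏ i, B (p (i, false)) (p (i, true))) * ∏ x, A (p x) (σ x)) =
      (∏ i, B (p (i, false)) (p (i, true))) * (A.submatrix p id).det := by
    intro p
    rw [← sum_sign_prod, Finset.mul_sum]
    exact Finset.sum_congr rfl fun σ _ => by ring
  simp only [h2]
  symm
  -- A map that is not injective repeats a row and contributes zero; the remaining maps are the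
  -- permutations.
  refine Finset.sum_bij_ne_zero (fun σ _ _ => (σ : ι × Bool → ι × Bool)) (fun _ _ _ => by simp)
    (fun _ _ _ _ _ _ h => DFunLike.coe_injective h) ?_ ?_
  · intro p _ hp
    have hinj : Function.Injective p := by
      by_contra hni
      simp only [Function.Injective, not_forall] at hni
      obtain ⟨x, y, hxy, hne⟩ := hni
      apply hp
      rw [Matrix.det_zero_of_row_eq hne (by ext z; simp [hxy]), mul_zero]
    have hb := Finite.injective_iff_bijective.mp hinj
    refine ⟨Equiv.ofBijective p hb, Finset.mem_univ _, ?_, rfl⟩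
    intro h0
    apply hp
    have h3 : (A.submatrix p id).det = _ := Matrix.det_permute (Equiv.ofBijective p hb) A
    rw [h3]
    calc _ = A.det * (((Equiv.Perm.sign (Equiv.ofBijective p hb) : ℤ) : K) *
          ∏ i, B (p (i, false)) (p (i, true))) := by ring
      _ = 0 := h0
  · intro σ _ _
    rw [Matrix.det_permute]
    ring

theorem pfaffianSum_submatrix_perm (Y : Matrix (ι × Bool) (ι × Bool) K)
    (τ : Equiv.Perm (ι × Bool)) :
    pfaffianSum (Y.submatrix τ τ) = ((Equiv.Perm.sign τ : ℤ) : K) * pfaffianSum Y := by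
  unfold pfaffianSum
  rw [Finset.mul_sum]
  refine Fintype.sum_equiv (Equiv.mulLeft τ) _ _ fun σ => ?_
  have h1 : ((Equiv.Perm.sign τ : ℤ) : K) * ((Equiv.Perm.sign τ : ℤ) : K) = 1 := by
    rw [← Int.cast_mul, ← Units.val_mul, Int.units_mul_self]; simp
  simp only [Equiv.coe_mulLeft, Equiv.Perm.sign_mul, Units.val_mul, Int.cast_mul,
    Matrix.submatrix_apply, Equiv.Perm.mul_apply]
  rw [← mul_assoc, ← mul_assoc, h1, one_mul]

/-- The permutation of `ι × Bool` that permutes the pairs and the members of each pair. -/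
def pairPerm (π : Equiv.Perm ι) (s : ι → Equiv.Perm Bool) : Equiv.Perm (ι × Bool) :=
  Equiv.prodCongrLeft (fun _ : Bool => π) * Equiv.prodCongrRight s

theorem pairPerm_apply (π : Equiv.Perm ι) (s : ι → Equiv.Perm Bool) (i : ι) (b : Bool) :
    pairPerm π s (i, b) = (π i, s i b) := rfl

/-- The permutation `π` of the pairs acts once on each of the two copies of `ι`, so its sign occurs
squared. -/
theorem sign_pairPerm (π : Equiv.Perm ι) (s : ι → Equiv.Perm Bool) :
    Equiv.Perm.sign (pairPerm π s) = ∏ i, Equiv.Perm.sign (s i) := by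
  rw [pairPerm, Equiv.Perm.sign_mul, Equiv.Perm.sign_prodCongrLeft,
    Equiv.Perm.sign_prodCongrRight]
  simp

/-- If `σ` sends pairs to pairs, two different pairs cannot have the same image: a pair has only two
members. -/
theorem injective_fst_of_pairs {σ : Equiv.Perm (ι × Bool)}
    (h : ∀ i, (σ (i, false)).1 = (σ (i, true)).1 ∧ (σ (i, false)).2 ≠ (σ (i, true)).2) :
    Function.Injective fun i => (σ (i, false)).1 := by
  intro a b hab
  simp only at hab
  by_cases h1 : (σ (a, false)).2 = (σ (b, false)).2
  · simpa using σ.injective (Prod.ext hab h1)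
  · have h2 : (σ (a, false)).2 = (σ (b, true)).2 := by
      have := (h b).2
      revert h1 this
      generalize (σ (a, false)).2 = u
      generalize (σ (b, false)).2 = w
      generalize (σ (b, true)).2 = z
      cases u <;> cases w <;> cases z <;> simp
    simpa using σ.injective (Prod.ext (hab.trans (h b).1) h2)

/-- Only the `2^m m!` permutations that respect the pairing can contribute. All of them contribute
the same product, since flipping a pair changes both the sign of the permutation and the sign of the
entry. -/
theorem pfaffianSum_of_pairs (Z : Matrix (ι × Bool) (ι × Bool) K) (y : ι → K)
    (h0 : ∀ a b, Z a b ≠ 0 → a.1 = b.1 ∧ a.2 ≠ b.2) (h1 : ∀ i, Z (i, false) (i, true) = y i)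
    (h2 : ∀ i, Z (i, true) (i, false) = - y i) :
    pfaffianSum Z = ((2 ^ Fintype.card ι * (Fintype.card ι).factorial : ℕ) : K) * ∏ i, y i := by
  have hterm : ∀ (π : Equiv.Perm ι) (s : ι → Equiv.Perm Bool),
      ((Equiv.Perm.sign (pairPerm π s) : ℤ) : K) *
        ∏ i : ι, Z (pairPerm π s (i, false)) (pairPerm π s (i, true)) = ∏ i, y i := by
    intro π s
    rw [sign_pairPerm, ← Equiv.prod_comp π y]
    push_cast
    rw [← Finset.prod_mul_distrib]
    refine Finset.prod_congr rfl fun i _ => ?_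
    rw [pairPerm_apply, pairPerm_apply]
    have hs : s i = 1 ∨ s i = Equiv.swap false true := by
      generalize s i = t
      revert t; decide
    rcases hs with hs | hs
    · simp [hs, h1]
    · simp [hs, h2]
  have hsum : pfaffianSum Z = ∑ _x : Equiv.Perm ι × (ι → Equiv.Perm Bool), ∏ i, y i := by
    symm
    unfold pfaffianSum
    -- If some `y j` vanishes, every term vanishes: a permutation that respects the pairing maps
    -- some pair onto the pair `j`. Otherwise the nonzero terms correspond exactly to the
    -- permutations `pairPerm π s`.
    by_cases hy : ∏ i, y i = 0
    · rw [hy, Finset.sum_const_zero]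
      symm
      refine Finset.sum_eq_zero fun σ _ => ?_
      by_contra hne
      have hp := Finset.prod_ne_zero_iff.mp (right_ne_zero_of_mul hne)
      obtain ⟨j, _, hj⟩ := Finset.prod_eq_zero_iff.mp hy
      have hf := injective_fst_of_pairs fun i => h0 _ _ (hp i (Finset.mem_univ i))
      obtain ⟨i, hi⟩ := (Finite.injective_iff_surjective.mp hf) j
      have hi' := h0 _ _ (hp i (Finset.mem_univ i))
      apply hp i (Finset.mem_univ i)
      simp only at hi
      rw [show σ (i, true) = (j, (σ (i, true)).2) from Prod.ext (by rw [← hi'.1, hi]) rfl,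
        show σ (i, false) = (j, (σ (i, false)).2) from Prod.ext hi rfl]
      have := hi'.2
      cases h3 : (σ (i, false)).2 <;> cases h4 : (σ (i, true)).2 <;> simp_all
    · refine Finset.sum_bij_ne_zero (fun x _ _ => pairPerm x.1 x.2) (fun _ _ _ => Finset.mem_univ _)
        ?_ ?_ ?_
      · rintro ⟨π, s⟩ _ _ ⟨π', s'⟩ _ _ h
        have hx : ∀ i b, (π i, s i b) = (π' i, s' i b) := fun i b => by
          rw [← pairPerm_apply, ← pairPerm_apply]; exact DFunLike.congr_fun h (i, b)
        simp only [Prod.mk.injEq] at hx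
        ext1
        · ext i; exact (hx i true).1
        · funext i; ext1 b; exact (hx i b).2
      · intro σ _ hne
        have hp := Finset.prod_ne_zero_iff.mp (right_ne_zero_of_mul hne)
        have hpair := fun i => h0 _ _ (hp i (Finset.mem_univ i))
        have hf := injective_fst_of_pairs hpair
        refine ⟨(Equiv.ofBijective _ (Finite.injective_iff_bijective.mp hf),
          fun i => if (σ (i, false)).2 then Equiv.swap false true else 1), Finset.mem_univ _, hy, ?_⟩
        ext1 ⟨i, b⟩
        rw [pairPerm_apply]
        obtain ⟨hi1, hi2⟩ := hpair i
        cases b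
        · refine Prod.ext rfl ?_
          change (if (σ (i, false)).2 then Equiv.swap false true else 1) false = (σ (i, false)).2
          generalize (σ (i, false)).2 = u
          cases u <;> simp
        · refine Prod.ext hi1 ?_
          change (if (σ (i, false)).2 then Equiv.swap false true else 1) true = (σ (i, true)).2
          revert hi2
          generalize (σ (i, false)).2 = u
          generalize (σ (i, true)).2 = w
          cases u <;> cases w <;> simp
      · rintro ⟨π, s⟩ _ _
        exact (hterm π s).symm
  rw [hsum, Finset.sum_const, Finset.card_univ, nsmul_eq_mul, Fintype.card_prod,
    Fintype.card_perm, Fintype.card_fun, Fintype.card_perm, Fintype.card_bool]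
  push_cast
  ring

/-- After reordering, `Z` is block diagonal with blocks `(0, y; -y, 0)` of determinant `y ^ 2`. -/
theorem det_of_pairs (Z : Matrix (ι × Bool) (ι × Bool) K) (y : ι → K)
    (h0 : ∀ a b, Z a b ≠ 0 → a.1 = b.1 ∧ a.2 ≠ b.2) (h1 : ∀ i, Z (i, false) (i, true) = y i)
    (h2 : ∀ i, Z (i, true) (i, false) = - y i) : Z.det = (∏ i, y i) ^ 2 := by
  have h : Z.submatrix (Equiv.prodComm Bool ι) (Equiv.prodComm Bool ι) =
      Matrix.blockDiagonal fun i => Matrix.of fun b b' : Bool => Z (i, b) (i, b') := by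
    ext ⟨b, i⟩ ⟨b', j⟩
    simp only [Matrix.submatrix_apply, Equiv.prodComm_apply, Prod.swap_prod_mk,
      Matrix.blockDiagonal_apply, Matrix.of_apply]
    split_ifs with hij
    · rw [hij]
    · by_contra hne
      exact hij (h0 _ _ hne).1
  rw [← Matrix.det_submatrix_equiv_self (Equiv.prodComm Bool ι), h, Matrix.det_blockDiagonal,
    ← Finset.prod_pow]
  refine Finset.prod_congr rfl fun i _ => ?_
  have hz : ∀ b, Z (i, b) (i, b) = 0 := fun b => by
    by_contra hne; exact (h0 _ _ hne).2 rfl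
  rw [← Matrix.det_submatrix_equiv_self finTwoEquiv, Matrix.det_fin_two]
  simp [finTwoEquiv, hz, h1, h2, sq]

end PfaffianSum

section Pfaffian

variable {m : ℕ} {K : Type*} [Field K]

/-- Consecutive indices as pairs. -/
def consecutivePairs (m : ℕ) : Fin m × Bool ≃ Fin (2 * m) where
  toFun x := ⟨2 * x.1 + x.2.toNat, by have := x.1.2; have := x.2.toNat_le; omega⟩
  invFun i := (⟨i / 2, by omega⟩, decide (i.1 % 2 = 1))
  left_inv := by
    rintro ⟨i, b⟩
    cases b <;> simp <;> ext <;> simp <;> omega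
  right_inv i := by
    ext
    rcases Nat.mod_two_eq_zero_or_one i.1 with h | h <;> simp [h] <;> omega

/-- Opposite indices as pairs. -/
def oppositePairs (m : ℕ) : Fin m × Bool ≃ Fin (2 * m) where
  toFun x := if x.2 then Fin.rev ⟨x.1, by have := x.1.2; omega⟩ else ⟨x.1, by have := x.1.2; omega⟩
  invFun i := if h : i.1 < m then (⟨i, h⟩, false) else (⟨i.rev, by rw [Fin.val_rev]; omega⟩, true)
  left_inv := by
    rintro ⟨i, b⟩
    have := i.2
    cases b
    · simp
    · simp only [if_true, Fin.val_rev]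
      rw [dif_neg (by omega)]
      ext <;> simp
      omega
  right_inv i := by
    by_cases h : i.1 < m
    · simp [h]
    · simp only [h, dite_false, if_true]
      exact Fin.rev_rev i

theorem pfaffian_eq_pfaffianSum (Y : Matrix (Fin (2 * m)) (Fin (2 * m)) K) :
    pfaffian Y = ((2 ^ m * m.factorial : ℕ) : K)⁻¹ *
      pfaffianSum (Y.submatrix (consecutivePairs m) (consecutivePairs m)) := by
  have hm : 2 * m / 2 = m := by omega
  unfold pfaffian pfaffianSum
  congr 1
  · rw [hm]
  refine Fintype.sum_equiv (consecutivePairs m).symm.permCongr _ _ fun σ => ?_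
  congr 1
  · simp
  · refine Fintype.prod_equiv (finCongr hm) _ _ fun i => ?_
    simp only [Matrix.submatrix_apply, Equiv.permCongr_apply, Equiv.symm_symm,
      Equiv.apply_symm_apply]
    congr 2

theorem pfaffian_transpose_mul_mul (A B : Matrix (Fin (2 * m)) (Fin (2 * m)) K) :
    pfaffian (Aᵀ * B * A) = A.det * pfaffian B := by
  rw [pfaffian_eq_pfaffianSum, pfaffian_eq_pfaffianSum,
    ← Matrix.det_submatrix_equiv_self (consecutivePairs m) A]
  have : (Aᵀ * B * A).submatrix (consecutivePairs m) (consecutivePairs m) =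
      (A.submatrix (consecutivePairs m) (consecutivePairs m))ᵀ *
        B.submatrix (consecutivePairs m) (consecutivePairs m) *
        A.submatrix (consecutivePairs m) (consecutivePairs m) := by
    rw [Matrix.transpose_submatrix, Matrix.submatrix_mul_equiv, Matrix.submatrix_mul_equiv]
  rw [this, pfaffianSum_transpose_mul_mul]
  ring

theorem oppositePairs_true (i : Fin m) :
    oppositePairs m (i, true) = (oppositePairs m (i, false)).rev := rfl

theorem pairs_of_skewDiagonal {Z : Matrix (Fin (2 * m)) (Fin (2 * m)) K}
    (h0 : ∀ i j, Z i j ≠ 0 → j = i.rev) (a b : Fin m × Bool)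
    (hne : (Z.submatrix (oppositePairs m) (oppositePairs m)) a b ≠ 0) :
    a.1 = b.1 ∧ a.2 ≠ b.2 := by
  obtain ⟨i, a⟩ := a
  obtain ⟨j, b⟩ := b
  have h := h0 _ _ hne
  have h' : (j, b) = (i, !a) := by
    apply (oppositePairs m).injective
    rw [h]
    cases a
    · exact (oppositePairs_true i).symm
    · rw [oppositePairs_true, Fin.rev_rev]; rfl
  simp only [Prod.mk.injEq] at h'
  exact ⟨h'.1.symm, by rw [h'.2]; cases a <;> simp⟩

theorem det_of_skewDiagonal (Z : Matrix (Fin (2 * m)) (Fin (2 * m)) K)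
    (h0 : ∀ i j, Z i j ≠ 0 → j = i.rev) (h1 : ∀ i, Z i.rev i = - Z i i.rev) :
    Z.det = (∏ i, Z (oppositePairs m (i, false)) (oppositePairs m (i, true))) ^ 2 := by
  have h := det_of_pairs (Z.submatrix (oppositePairs m) (oppositePairs m))
    (fun i => Z (oppositePairs m (i, false)) (oppositePairs m (i, true)))
    (pairs_of_skewDiagonal h0) (fun i => rfl)
    (fun i => by rw [Matrix.submatrix_apply, oppositePairs_true, h1])
  rwa [Matrix.det_submatrix_equiv_self] at h

/-- The square of the Pfaffian of a skew-symmetric matrix supported on the skew diagonal. -/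
theorem pfaffian_sq_of_skewDiagonal (hK : ((2 ^ m * m.factorial : ℕ) : K) ≠ 0)
    (Z : Matrix (Fin (2 * m)) (Fin (2 * m)) K) (h0 : ∀ i j, Z i j ≠ 0 → j = i.rev)
    (h1 : ∀ i, Z i.rev i = - Z i i.rev) : pfaffian Z ^ 2 = Z.det := by
  let e := oppositePairs m
  have hsum := pfaffianSum_of_pairs (Z.submatrix e e) (fun i => Z (e (i, false)) (e (i, true)))
    (pairs_of_skewDiagonal h0) (fun i => rfl)
    (fun i => by rw [Matrix.submatrix_apply, oppositePairs_true, h1])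
  -- The Pfaffian is defined with consecutive pairs, but `Z` lives on opposite pairs. The change of
  -- pairing costs a sign, which disappears in the square.
  have hperm : Z.submatrix (consecutivePairs m) (consecutivePairs m) =
      (Z.submatrix e e).submatrix ((consecutivePairs m).trans e.symm)
        ((consecutivePairs m).trans e.symm) := by
    ext a b; simp
  rw [pfaffian_eq_pfaffianSum, hperm, pfaffianSum_submatrix_perm, hsum,
    det_of_skewDiagonal Z h0 h1, Fintype.card_fin]
  have hs : ∀ u : ℤˣ, (((u : ℤ) : K)) ^ 2 = 1 := fun u => by
    rcases Int.units_eq_one_or u with h | h <;> simp [h]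
  rw [mul_pow, mul_pow, hs, mul_pow, inv_pow, one_mul, inv_mul_cancel_left₀ (pow_ne_zero 2 hK)]

end Pfaffian

/-! ### Eigenbases -/

section Eigenbasis

set_option linter.unusedSectionVars false

variable {n K : Type*} [Fintype n] [DecidableEq n] [Field K]

theorem exists_eigenmatrix_of_basis (X : Matrix n n K) (b : Module.Basis n K (n → K)) (t : n → K)
    (h : ∀ i, X *ᵥ b i = t i • b i) : ∃ P : GL n K, X * P.1 = P.1 * Matrix.diagonal t := by
  let A : Matrix n n K := (Pi.basisFun K n).toMatrix b
  have hA : IsUnit A := by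
    let := (Pi.basisFun K n).invertibleToMatrix b
    exact isUnit_of_invertible A
  refine ⟨hA.unit, ?_⟩
  have hcol : ∀ i j, A i j = b j i := fun i j => by simp [A, Module.Basis.toMatrix_apply]
  ext i j
  rw [IsUnit.unit_spec, Matrix.mul_diagonal, hcol, Matrix.mul_apply]
  have := congrFun (h j) i
  simp only [Matrix.mulVec, dotProduct, Pi.smul_apply, smul_eq_mul] at this
  simp only [hcol, this, mul_comm]

theorem charpoly_eq_prod_of_eigenmatrix {X : Matrix n n K} {t : n → K} {P : GL n K}
    (h : X * P.1 = P.1 * Matrix.diagonal t) : X.charpoly = ∏ i, (Polynomial.X - C (t i)) := by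
  rw [← Matrix.charpoly_diagonal, ← Matrix.charpoly_units_conj P (Matrix.diagonal t), ← h]
  simp [Matrix.mul_assoc]

theorem roots_prod_X_sub_C_univ (t : n → K) :
    (∏ i, (Polynomial.X - C (t i))).roots = Finset.univ.val.map t := by
  rw [Polynomial.roots_prod _ _ (Finset.prod_ne_zero_iff.mpr fun i _ => X_sub_C_ne_zero _)]
  simp

/-- Equal multiplicities mean that the fibres of `t` and `u` over each value have the same size; `σ`
matches them fibre by fibre. -/
theorem exists_perm_of_map_eq {K : Type*} {t u : n → K}
    (h : Finset.univ.val.map t = Finset.univ.val.map u) : ∃ σ : Equiv.Perm n, ∀ i, u (σ i) = t i := by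
  classical
  have hc : ∀ a, Nonempty ({i // t i = a} ≃ {i // u i = a}) := fun a => by
    rw [← Fintype.card_eq, Fintype.card_subtype, Fintype.card_subtype]
    have h1 := congrArg (Multiset.count a) h
    simp only [Multiset.count_map, eq_comm (a := a)] at h1
    exact h1
  have e : ∀ a, {i // t i = a} ≃ {i // u i = a} := fun a => (hc a).some
  refine ⟨(Equiv.sigmaFiberEquiv t).symm.trans ((Equiv.sigmaCongrRight e).trans
    (Equiv.sigmaFiberEquiv u)), fun i => ?_⟩
  exact (e (t i) ⟨i, rfl⟩).2

theorem exists_eigenmatrix_of_injective {X : Matrix n n K} {t : n → K} (ht : Function.Injective t)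
    (h : X.charpoly = ∏ i, (Polynomial.X - C (t i))) :
    ∃ P : GL n K, X * P.1 = P.1 * Matrix.diagonal t := by
  have hev : ∀ i, ∃ v, Module.End.HasEigenvector (Matrix.toLin' X) (t i) v := by
    intro i
    apply Module.End.HasEigenvalue.exists_hasEigenvector
    rw [Module.End.hasEigenvalue_iff_isRoot_charpoly, Matrix.charpoly_toLin', h, IsRoot.def,
      eval_prod]
    exact Finset.prod_eq_zero (Finset.mem_univ i) (by simp)
  choose v hv using hev
  have hli := Module.End.eigenvectors_linearIndependent' (Matrix.toLin' X) t ht v hv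
  rcases isEmpty_or_nonempty n with hn | hn
  · exact ⟨1, by ext i; exact isEmptyElim i⟩
  refine exists_eigenmatrix_of_basis X (basisOfLinearIndependentOfCardEqFinrank hli (by simp)) t ?_
  intro i
  have := (hv i).apply_eq_smul
  simpa using this

/-- The eigenspaces supply an eigenbasis in some order. It is reordered to follow the given `t`,
because later the order has to satisfy `t i.rev = -t i`. -/
theorem exists_eigenmatrix_of_isSemisimple [IsAlgClosed K] {X : Matrix n n K}
    (h : Module.End.IsSemisimple (Matrix.toLin' X)) {t : n → K}
    (ht : X.charpoly.roots = Finset.univ.val.map t) :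
    ∃ P : GL n K, X * P.1 = P.1 * Matrix.diagonal t := by
  classical
  have htop := h.iSup_eigenspace_eq_top
  have hint : DirectSum.IsInternal fun a : K => Module.End.eigenspace (Matrix.toLin' X) a := by
    rw [DirectSum.isInternal_submodule_iff_iSupIndep_and_iSup_eq_top]
    exact ⟨Module.End.eigenspaces_iSupIndep _, htop⟩
  let b0 := hint.collectedBasis fun a => Module.finBasis K (Module.End.eigenspace (Matrix.toLin' X) a)
  have : Fintype (Σ a, Fin (Module.finrank K (Module.End.eigenspace (Matrix.toLin' X) a))) :=
    FiniteDimensional.fintypeBasisIndex b0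
  have hcard := Module.finrank_eq_card_basis b0
  rw [Module.finrank_fintype_fun_eq_card] at hcard
  let e := Fintype.equivOfCardEq hcard
  let b := b0.reindex e.symm
  have hb : ∀ i, X *ᵥ b i = (e i).1 • b i := by
    intro i
    have hm : b0 (e i) ∈ Module.End.eigenspace (Matrix.toLin' X) (e i).1 :=
      hint.collectedBasis_mem _ _
    rw [Module.End.mem_eigenspace_iff] at hm
    simpa [b] using hm
  obtain ⟨P, hP⟩ := exists_eigenmatrix_of_basis X b (fun i => (e i).1) hb
  have hr := charpoly_eq_prod_of_eigenmatrix hP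
  rw [hr, roots_prod_X_sub_C_univ] at ht
  obtain ⟨σ, hσ⟩ := exists_perm_of_map_eq ht
  refine exists_eigenmatrix_of_basis X (b.reindex σ) t fun i => ?_
  have := hb (σ.symm i)
  rw [Module.Basis.reindex_apply, this]
  congr 1
  rw [← hσ]; simp

theorem exists_enumeration {K : Type*} (d : ℕ) (s : Multiset K) (hs : s.card = d) :
    ∃ t : Fin d → K, s = Finset.univ.val.map t := by
  have h : ∀ l : List K, ∃ t : Fin l.length → K, (l : Multiset K) = Finset.univ.val.map t :=
    fun l => ⟨l.get, by rw [Fin.univ_val_map, List.ofFn_get]⟩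
  subst hs
  have := h s.toList
  rwa [Multiset.coe_toList, Multiset.length_toList] at this

theorem map_univ_cons_snoc {K : Type*} {d : ℕ} (a b : K) (t : Fin d → K) :
    Finset.univ.val.map (Fin.cons a (Fin.snoc t b : Fin (d + 1) → K) : Fin (d + 2) → K) =
      a ::ₘ b ::ₘ Finset.univ.val.map t := by
  rw [Fin.univ_val_map, Fin.univ_val_map, List.ofFn_cons, List.ofFn_succ']
  simp only [Fin.snoc_castSucc, Fin.snoc_last, List.concat_eq_append]
  rw [← Multiset.cons_coe, ← Multiset.coe_add, ← Multiset.singleton_add, ← Multiset.singleton_add]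
  congr 1
  rw [add_comm]
  rfl

/-- A nonzero `a` differs from `-a`, so both can be removed from the multiset and placed at the two
ends; the rest follows by induction until only zeros are left. -/
theorem exists_symmetric_enumeration (h2 : (2 : K) ≠ 0) (d : ℕ) (s : Multiset K) (hs : s.card = d)
    (hneg : s.map (fun a => -a) = s) :
    ∃ t : Fin d → K, s = Finset.univ.val.map t ∧ ∀ i, t i.rev = - t i := by
  induction d using Nat.strong_induction_on generalizing s with
  | _ d ih =>
    classical
    by_cases h0 : ∀ a ∈ s, a = 0
    · refine ⟨fun _ => 0, ?_, by simp⟩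
      rw [Multiset.eq_replicate_of_mem h0, hs]
      simp
    · push Not at h0
      obtain ⟨a, ha, ha0⟩ := h0
      have hna : -a ∈ s := by
        rw [← hneg]; exact Multiset.mem_map_of_mem _ ha
      have hne : -a ≠ a := fun h => by
        have : (2 : K) * a = 0 := by linear_combination -h
        simp_all
      obtain ⟨s1, rfl⟩ := Multiset.exists_cons_of_mem ha
      rw [Multiset.mem_cons] at hna
      obtain ⟨s2, rfl⟩ := Multiset.exists_cons_of_mem (hna.resolve_left hne)
      simp only [Multiset.card_cons] at hs
      obtain ⟨d, rfl⟩ : ∃ d', d = d' + 2 := ⟨d - 2, by omega⟩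
      simp only [Multiset.map_cons, neg_neg] at hneg
      rw [Multiset.cons_swap, Multiset.cons_inj_right, Multiset.cons_inj_right] at hneg
      obtain ⟨t, ht, hrev⟩ := ih d (by omega) s2 (by omega) hneg
      refine ⟨Fin.cons a (Fin.snoc t (-a) : Fin (d + 1) → K), ?_, ?_⟩
      · rw [map_univ_cons_snoc, ← ht]
      · intro i
        refine Fin.cases ?_ (fun j => ?_) i
        · rw [Fin.rev_zero, ← Fin.succ_last, Fin.cons_succ, Fin.snoc_last, Fin.cons_zero]
        · rw [Fin.rev_succ, Fin.cons_succ]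
          refine Fin.lastCases ?_ (fun k => ?_) j
          · rw [Fin.rev_last, Fin.castSucc_zero, Fin.cons_zero, Fin.snoc_last, neg_neg]
          · rw [Fin.rev_castSucc, ← Fin.succ_castSucc, Fin.cons_succ, Fin.snoc_castSucc,
              Fin.snoc_castSucc, hrev]

end Eigenbasis

/-! ### The forms and their Lie algebras -/

section Form

variable {d : ℕ} {ε : Fin d → ℤˣ} {s : ℤˣ} {R : Type*} [CommRing R]

theorem units_cast_mul_self (u : ℤˣ) : ((u : ℤ) : R) * ((u : ℤ) : R) = 1 := by
  rw [← Int.cast_mul, ← Units.val_mul, Int.units_mul_self]; simp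

theorem skewDiag_mul_transpose : skewDiag ε R * (skewDiag ε R)ᵀ = 1 := by
  ext i j
  simp only [Matrix.mul_apply, skewDiag, Matrix.transpose_apply, Matrix.of_apply, ite_mul, zero_mul,
    Finset.sum_ite_eq', Finset.mem_univ, if_true, Matrix.one_apply]
  by_cases h : i = j
  · subst h; simp [units_cast_mul_self]
  · rw [if_neg h, if_neg (fun h' => h (Fin.rev_injective h')), mul_zero]

theorem transpose_mul_skewDiag : (skewDiag ε R)ᵀ * skewDiag ε R = 1 :=
  mul_eq_one_comm.mp skewDiag_mul_transpose

theorem skewDiag_transpose (hε : ∀ i, ε i.rev = s * ε i) :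
    (skewDiag ε R)ᵀ = ((s : ℤ) : R) • skewDiag ε R := by
  ext i j
  simp only [skewDiag, Matrix.transpose_apply, Matrix.of_apply, Matrix.smul_apply, smul_eq_mul]
  by_cases h : i = j.rev
  · have h' : j = i.rev := by rw [h, Fin.rev_rev]
    rw [if_pos h, if_pos h', h', hε]; simp
  · have h' : j ≠ i.rev := fun h' => h (by rw [h', Fin.rev_rev])
    rw [if_neg h, if_neg h', mul_zero]

theorem mem_form_lie {X : Matrix (Fin d) (Fin d) R} :
    X ∈ (MatAlg.form ε).lie R ↔ Xᵀ * skewDiag ε R = -(skewDiag ε R * X) := by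
  change X ∈ skewAdjointMatricesLieSubalgebra (skewDiag ε R) ↔ _
  rw [mem_skewAdjointMatricesLieSubalgebra, mem_skewAdjointMatricesSubmodule]
  simp [Matrix.IsSkewAdjoint, Matrix.IsAdjointPair]

theorem skewDiag_map {S : Type*} [CommRing S] (f : R →+* S) :
    (skewDiag ε R).map f = skewDiag ε S := by
  ext i j
  simp only [skewDiag, Matrix.map_apply, Matrix.of_apply]
  split_ifs <;> simp

theorem geom_mem_form_lie {K : Type*} [Field K] {X : Matrix (Fin d) (Fin d) K}
    (h : X ∈ (MatAlg.form ε).lie K) : geom X ∈ (MatAlg.form ε).lie (AlgebraicClosure K) := by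
  rw [mem_form_lie] at h ⊢
  have := congrArg (fun M => M.map (algebraMap K (AlgebraicClosure K))) h
  rw [← skewDiag_map (algebraMap K (AlgebraicClosure K))]
  simpa [Matrix.map_mul, geom, Matrix.transpose_map, Matrix.map_neg] using this

theorem mul_skewDiag_mul {X : Matrix (Fin d) (Fin d) R} (h : X ∈ (MatAlg.form ε).lie R) :
    skewDiag ε R * X * (skewDiag ε R)ᵀ = -Xᵀ := by
  rw [mem_form_lie] at h
  rw [← neg_eq_iff_eq_neg.mpr h, Matrix.neg_mul, Matrix.mul_assoc, skewDiag_mul_transpose, Matrix.mul_one]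

/-- The defining equation says that `-ᵗX` is conjugate to `X` by the form. -/
theorem charpoly_neg_of_mem {X : Matrix (Fin d) (Fin d) R}
    (h : X ∈ (MatAlg.form ε).lie R) : (-X).charpoly = X.charpoly := by
  rw [← Matrix.charpoly_transpose (-X), Matrix.transpose_neg, ← mul_skewDiag_mul h,
    Matrix.charpoly_mul_comm, ← Matrix.mul_assoc, transpose_mul_skewDiag, Matrix.one_mul]

theorem charpoly_neg {n : Type*} [Fintype n] [DecidableEq n] (A : Matrix n n R) :
    (-A).charpoly = (-1) ^ Fintype.card n * A.charpoly.comp (-X) := by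
  have h : A.charpoly.comp (-X) = ((Matrix.charmatrix A).map (Polynomial.compRingHom (-X))).det := by
    rw [← RingHom.mapMatrix_apply, ← RingHom.map_det]
    rfl
  have h1 : (Matrix.charmatrix A).map (Polynomial.compRingHom (-X)) = -Matrix.charmatrix (-A) := by
    ext1 i j
    rw [Matrix.map_apply, Matrix.neg_apply]
    by_cases hij : i = j
    · subst hij
      rw [Matrix.charmatrix_apply_eq, Matrix.charmatrix_apply_eq]
      simp
      ring
    · rw [Matrix.charmatrix_apply_ne _ _ _ hij, Matrix.charmatrix_apply_ne _ _ _ hij]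
      simp
  rw [h, h1, Matrix.det_neg, ← mul_assoc, ← mul_pow]
  simp [Matrix.charpoly]

theorem charpoly_coeff_eq_zero {K : Type*} [Field K] (h2 : (2 : K) ≠ 0)
    {X : Matrix (Fin d) (Fin d) K} (h : X ∈ (MatAlg.form ε).lie K) {k : ℕ} (hk : Odd (d + k)) :
    X.charpoly.coeff k = 0 := by
  have h1 := congrArg (fun p => p.coeff k) (charpoly_neg X)
  simp only [charpoly_neg_of_mem h, Fintype.card_fin] at h1
  have h3 : X.charpoly.comp (-Polynomial.X) = X.charpoly.comp (C (-1) * Polynomial.X) := by simp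
  rw [h3, show ((-1 : K[X]) ^ d) = C ((-1) ^ d) by simp, coeff_C_mul, comp_C_mul_X_coeff] at h1
  have h4 : (-1 : K) ^ d * (-1) ^ k = -1 := by rw [← pow_add]; exact hk.neg_one_pow
  have : (2 : K) * X.charpoly.coeff k = 0 := by linear_combination h1 + X.charpoly.coeff k * h4
  simpa [h2] using this

theorem exists_symmetric_roots {K : Type*} [Field K] [IsAlgClosed K] (h2 : (2 : K) ≠ 0)
    {X : Matrix (Fin d) (Fin d) K} (h : X ∈ (MatAlg.form ε).lie K) :
    ∃ t : Fin d → K, X.charpoly.roots = Finset.univ.val.map t ∧ ∀ i, t i.rev = - t i := by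
  have hcard : X.charpoly.roots.card = d := by
    rw [(IsAlgClosed.splits X.charpoly).natDegree_eq_card_roots.symm]; simp
  refine exists_symmetric_enumeration h2 d _ hcard ?_
  have h1 : X.charpoly.comp (-Polynomial.X) = (-1) ^ d * X.charpoly := by
    have := charpoly_neg X
    rw [charpoly_neg_of_mem h, Fintype.card_fin] at this
    rw [this, ← mul_assoc, ← mul_pow]
    simp [this.symm]
  have h3 : (X.charpoly.comp (-Polynomial.X)).roots = X.charpoly.roots := by
    rw [h1, show ((-1 : K[X]) ^ d) = C ((-1) ^ d) by simp, roots_C_mul _ (by simp)]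
  rw [← Polynomial.roots_comp_neg_X, h3]

end Form

/-! ### Centralizers and regular semisimple elements -/

section Centralizer

variable {d : ℕ} {K : Type*} [Field K]

/-- The matrices `S` with `ᵗS = -sS` and `S i j = 0` unless `t i + t j = 0`. -/
def signedCommutant (s : ℤˣ) (t : Fin d → K) : Submodule K (Matrix (Fin d) (Fin d) K) where
  carrier := {S | Sᵀ = -(((s : ℤ) : K) • S) ∧ ∀ i j, S i j * (t i + t j) = 0}
  zero_mem' := by simp
  add_mem' := by
    rintro a b ⟨ha, ha'⟩ ⟨hb, hb'⟩
    refine ⟨by rw [Matrix.transpose_add, ha, hb, smul_add, neg_add], fun i j => ?_⟩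
    rw [Matrix.add_apply, add_mul, ha', hb', add_zero]
  smul_mem' := by
    rintro c a ⟨ha, ha'⟩
    refine ⟨by rw [Matrix.transpose_smul, ha, smul_neg, smul_comm], fun i j => ?_⟩
    rw [Matrix.smul_apply, smul_eq_mul, mul_assoc, ha', mul_zero]

/-- The matrices that commute with a diagonal matrix. -/
def diagonalCommutant (t : Fin d → K) : Submodule K (Matrix (Fin d) (Fin d) K) where
  carrier := {S | ∀ i j, S i j * (t i - t j) = 0}
  zero_mem' := by simp
  add_mem' := by
    intro a b ha hb i j
    rw [Matrix.add_apply, add_mul, ha, hb, add_zero]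
  smul_mem' := by
    intro c a ha i j
    rw [Matrix.smul_apply, smul_eq_mul, mul_assoc, ha, mul_zero]

theorem signedCommutant_apply_swap {s : ℤˣ} {t : Fin d → K} {S : Matrix (Fin d) (Fin d) K}
    (hS : S ∈ signedCommutant s t) (i j : Fin d) : S j i = -(((s : ℤ) : K) * S i j) := by
  have := congrFun (congrFun hS.1 i) j
  simpa using this

/-- The matrices `E_ab - s E_ba`, for the listed positions `(a, b)`, are independent, since no other
listed position or its transpose meets `(a, b)`. For `s = 1` this matrix is zero on the diagonal,
whence `hdiag`; for `s = -1` the diagonal entry is `2`. -/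
theorem card_le_finrank_signedCommutant {ι : Type*} [Fintype ι] (h2 : (2 : K) ≠ 0) (s : ℤˣ)
    (t : Fin d → K) (p : ι → Fin d × Fin d) (hp : Function.Injective p)
    (hswap : ∀ k l, p k = (p l).swap → k = l)
    (hdiag : s = 1 → ∀ k, (p k).1 ≠ (p k).2) (ht : ∀ k, t (p k).1 + t (p k).2 = 0) :
    Fintype.card ι ≤ Module.finrank K (signedCommutant s t) := by
  classical
  let E : Fin d × Fin d → Matrix (Fin d) (Fin d) K := fun a =>
    Matrix.single a.1 a.2 1 - ((s : ℤ) : K) • Matrix.single a.2 a.1 1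
  have hE : ∀ k, E (p k) ∈ signedCommutant s t := by
    intro k
    constructor
    · simp only [E, Matrix.transpose_sub, Matrix.transpose_smul, Matrix.transpose_single, smul_sub,
        smul_smul, units_cast_mul_self, one_smul, neg_sub]
    · intro i j
      simp only [E, Matrix.sub_apply, Matrix.smul_apply, Matrix.single_apply, smul_eq_mul]
      have := ht k
      by_cases h1 : (p k).1 = i ∧ (p k).2 = j
      · rw [← h1.1, ← h1.2, ht, mul_zero]
      · by_cases h3 : (p k).2 = i ∧ (p k).1 = j
        · rw [← h3.1, ← h3.2, add_comm, ht, mul_zero]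
        · rw [if_neg h1, if_neg h3]; ring
  have hne : ∀ k, E (p k) (p k).1 (p k).2 ≠ 0 := by
    intro k
    simp only [E, Matrix.sub_apply, Matrix.smul_apply, Matrix.single_apply, smul_eq_mul, and_self,
      if_true]
    rcases Int.units_eq_one_or s with hs | hs
    · have := hdiag hs k
      rw [if_neg (fun h => this h.2)]; simp
    · rw [hs]
      split_ifs
      · simpa [one_add_one_eq_two] using h2
      · simp
  have hz : ∀ k l, k ≠ l → E (p k) (p l).1 (p l).2 = 0 := by
    intro k l hkl
    simp only [E, Matrix.sub_apply, Matrix.smul_apply, Matrix.single_apply, smul_eq_mul]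
    rw [if_neg (fun h => hkl (hp (Prod.ext h.1 h.2))),
      if_neg (fun h => hkl (hswap k l (Prod.ext h.2 h.1)))]
    ring
  have hli : LinearIndependent K (fun k => (⟨E (p k), hE k⟩ : signedCommutant s t)) := by
    rw [Fintype.linearIndependent_iff]
    intro g hg l
    have h1 := congrArg (fun S : signedCommutant s t => S.1 (p l).1 (p l).2) hg
    simp only [Submodule.coe_sum, Submodule.coe_smul, Matrix.sum_apply, Matrix.smul_apply,
      smul_eq_mul, ZeroMemClass.coe_zero, Matrix.zero_apply] at h1
    rw [Finset.sum_eq_single l (fun k _ hk => by rw [hz k l hk, mul_zero]) (by simp)] at h1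
    exact (mul_eq_zero.mp h1).resolve_right (hne l)
  exact hli.fintype_card_le_finrank

theorem card_le_finrank_diagonalCommutant {ι : Type*} [Fintype ι] (t : Fin d → K)
    (p : ι → Fin d × Fin d) (hp : Function.Injective p) (ht : ∀ k, t (p k).1 = t (p k).2) :
    Fintype.card ι ≤ Module.finrank K (diagonalCommutant t) := by
  classical
  have hE : ∀ k, Matrix.single (p k).1 (p k).2 (1 : K) ∈ diagonalCommutant t := by
    intro k i j
    rw [Matrix.single_apply]
    split_ifs with h
    · rw [← h.1, ← h.2, ht, sub_self, mul_zero]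
    · rw [zero_mul]
  have hli : LinearIndependent K
      (fun k => (⟨Matrix.single (p k).1 (p k).2 (1 : K), hE k⟩ : diagonalCommutant t)) := by
    rw [Fintype.linearIndependent_iff]
    intro g hg l
    have h1 := congrArg (fun S : diagonalCommutant t => S.1 (p l).1 (p l).2) hg
    simp only [Submodule.coe_sum, Submodule.coe_smul, Matrix.sum_apply, Matrix.smul_apply,
      smul_eq_mul, ZeroMemClass.coe_zero, Matrix.zero_apply] at h1
    rw [Finset.sum_eq_single l (fun k _ hk => by
      rw [Matrix.single_apply, if_neg (fun h => hk (hp (Prod.ext h.1 h.2))), mul_zero])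
      (by simp)] at h1
    simpa using h1
  exact hli.fintype_card_le_finrank

/-- The first half of the index set. -/
def lowerIndex (k : Fin (d / 2)) : Fin d := ⟨k, by have := k.2; omega⟩

theorem lowerIndex_injective : Function.Injective (lowerIndex (d := d)) := fun a b h => by
  ext; simpa [lowerIndex] using h

theorem lowerIndex_ne_rev (k l : Fin (d / 2)) : lowerIndex k ≠ (lowerIndex l).rev := fun h => by
  have h1 := congrArg Fin.val h
  rw [Fin.val_rev] at h1
  simp only [lowerIndex] at h1
  omega

theorem exists_lowerIndex (i : Fin d) :
    (∃ k, i = lowerIndex k) ∨ (∃ k, i = (lowerIndex k).rev) ∨ (Odd d ∧ i = i.rev) := by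
  have h := i.2
  rcases lt_trichotomy i.1 (i.rev).1 with h1 | h1 | h1
  · rw [Fin.val_rev] at h1
    exact Or.inl ⟨⟨i, by omega⟩, rfl⟩
  · refine Or.inr (Or.inr ⟨?_, Fin.ext h1⟩)
    rw [Fin.val_rev] at h1
    exact ⟨i, by omega⟩
  · rw [Fin.val_rev] at h1
    refine Or.inr (Or.inl ⟨⟨i.rev, by rw [Fin.val_rev]; omega⟩, ?_⟩)
    rw [show lowerIndex ⟨i.rev, _⟩ = i.rev from rfl, Fin.rev_rev]

theorem eq_rev_of_injective {t : Fin d → K} (ht : Function.Injective t)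
    (hrev : ∀ i, t i.rev = - t i) {i j : Fin d} (h : t i + t j = 0) : j = i.rev :=
  ht (by rw [hrev]; linear_combination h)

/-- Distinct eigenvalues leave only the skew diagonal, where the entries at `i` and `i.rev`
determine each other. A middle entry exists only for odd `d`, thus `s = 1`, and then it equals its
own negative. -/
theorem finrank_signedCommutant_of_injective (h2 : (2 : K) ≠ 0) {s : ℤˣ} (hs : s = -1 → Even d)
    {t : Fin d → K} (ht : Function.Injective t) (hrev : ∀ i, t i.rev = - t i) :
    Module.finrank K (signedCommutant s t) = d / 2 := by
  apply le_antisymm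
  · let f : signedCommutant s t →ₗ[K] (Fin (d / 2) → K) :=
      { toFun := fun S k => S.1 (lowerIndex k) (lowerIndex k).rev
        map_add' := fun _ _ => rfl
        map_smul' := fun _ _ => rfl }
    have hf : Function.Injective f := by
      rw [← LinearMap.ker_eq_bot, LinearMap.ker_eq_bot']
      intro S hS
      have h0 : ∀ k, S.1 (lowerIndex k) (lowerIndex k).rev = 0 := fun k => congrFun hS k
      ext i j
      change S.1 i j = 0
      by_cases hij : t i + t j = 0
      · have hj := eq_rev_of_injective ht hrev hij
        subst hj
        rcases exists_lowerIndex i with ⟨k, rfl⟩ | ⟨k, rfl⟩ | ⟨hd, hi⟩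
        · exact h0 k
        · rw [Fin.rev_rev, signedCommutant_apply_swap S.2, h0]; simp
        · have hs1 : s = 1 := (Int.units_eq_one_or s).resolve_right fun h =>
            (Nat.not_even_iff_odd.mpr hd) (hs h)
          subst hs1
          have := signedCommutant_apply_swap S.2 i i
          rw [← hi]
          have h3 : (2 : K) * S.1 i i = 0 := by
            simp only [Units.val_one, Int.cast_one, one_mul] at this
            linear_combination this
          exact (mul_eq_zero.mp h3).resolve_left h2
      · exact (mul_eq_zero.mp (S.2.2 i j)).resolve_right hij
    simpa using LinearMap.finrank_le_finrank_of_injective hf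
  · have := card_le_finrank_signedCommutant h2 s t
      (fun k : Fin (d / 2) => (lowerIndex k, (lowerIndex k).rev))
      (fun a b h => lowerIndex_injective (congrArg Prod.fst h))
      (fun k l h => absurd (congrArg Prod.fst h) (lowerIndex_ne_rev k l))
      (fun _ k => lowerIndex_ne_rev k k) (fun k => by rw [hrev]; ring)
    simpa using this

theorem lt_finrank_signedCommutant (h2 : (2 : K) ≠ 0) {s : ℤˣ} {t : Fin d → K}
    (hrev : ∀ i, t i.rev = - t i) {a b : Fin d} (hab : t a + t b = 0) (hne : b ≠ a.rev)
    (hdiag : s = 1 → a ≠ b) : d / 2 < Module.finrank K (signedCommutant s t) := by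
  have := card_le_finrank_signedCommutant h2 s t
    (fun o : Option (Fin (d / 2)) => o.elim (a, b) fun k => (lowerIndex k, (lowerIndex k).rev))
    ?_ ?_ ?_ ?_
  · rw [Fintype.card_option, Fintype.card_fin] at this
    exact this
  · rintro (_ | k) (_ | l) h
    · rfl
    · simp only [Option.elim, Prod.mk.injEq] at h
      exact absurd (by rw [h.1, h.2]) hne
    · simp only [Option.elim, Prod.mk.injEq] at h
      exact absurd (by rw [← h.1, ← h.2]) hne
    · simp only [Option.elim, Prod.mk.injEq] at h
      rw [lowerIndex_injective h.1]
  · rintro (_ | k) (_ | l) h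
    · rfl
    · simp only [Option.elim, Prod.swap_prod_mk, Prod.mk.injEq] at h
      exact absurd (by rw [h.1, h.2, Fin.rev_rev]) hne
    · simp only [Option.elim, Prod.swap_prod_mk, Prod.mk.injEq] at h
      exact absurd (by rw [← h.1, ← h.2, Fin.rev_rev]) hne
    · simp only [Option.elim, Prod.swap_prod_mk, Prod.mk.injEq] at h
      exact absurd h.1 (lowerIndex_ne_rev k l)
  · rintro hs (_ | k)
    · exact hdiag hs
    · exact lowerIndex_ne_rev k k
  · rintro (_ | k)
    · exact hab
    · simp only [Option.elim]
      rw [hrev]; ring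

/-- A coincidence `t i = t k` yields a position off the skew diagonal, hence an extra dimension:
`(i, k.rev)` in general. If `i = k.rev`, the common eigenvalue is `0`; then `(i, i)` serves when `s
= -1`, and `i` paired with the middle index serves when `s = 1` and `d` is odd. For `s = 1` and `d`
even nothing serves, a double eigenvalue `0` being regular there, so `h0` excludes it. -/
theorem injective_of_finrank_signedCommutant (h2 : (2 : K) ≠ 0) {s : ℤˣ} {t : Fin d → K}
    (hrev : ∀ i, t i.rev = - t i) (h0 : s = 1 → Even d → ∀ i, t i ≠ 0)
    (h : Module.finrank K (signedCommutant s t) = d / 2) : Function.Injective t := by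
  intro i k hik
  by_contra hne
  by_cases h1 : i = k.rev
  · have hi0 : t i = 0 := by
      have h3 : (2 : K) * t i = 0 := by
        have : t i = - t k := by rw [h1, hrev]
        linear_combination hik + this
      exact (mul_eq_zero.mp h3).resolve_left h2
    rcases Int.units_eq_one_or s with hs | hs
    · rcases Nat.even_or_odd d with hd | ⟨m, hm⟩
      · exact h0 hs hd i hi0
      -- The middle index, whose eigenvalue is `0` by symmetry.
      · let c : Fin d := ⟨m, by omega⟩
        have hc : c.rev = c := by
          apply Fin.ext; rw [Fin.val_rev]; simp only [c]; omega
        have hc0 : t c = 0 := by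
          have h4 := hrev c
          rw [hc] at h4
          have h3 : (2 : K) * t c = 0 := by linear_combination h4
          exact (mul_eq_zero.mp h3).resolve_left h2
        have hci : c ≠ i := by
          intro hci
          apply hne
          rw [← Fin.rev_rev k, ← h1, ← hci, hc]
        refine absurd h (lt_finrank_signedCommutant h2 hrev (a := i) (b := c)
          (by rw [hi0, hc0, add_zero]) ?_ (fun _ => hci.symm)).ne'
        intro h5
        apply hci
        rw [← hc, h5, Fin.rev_rev]
    · refine absurd h (lt_finrank_signedCommutant h2 hrev (a := i) (b := i)
        (by rw [hi0, add_zero]) ?_ (fun hs1 => by simp [hs] at hs1)).ne'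
      intro h5
      apply hne
      rw [← Fin.rev_rev k, ← h1, ← h5]
  · refine absurd h (lt_finrank_signedCommutant h2 hrev (a := i) (b := k.rev)
      (by rw [hrev, hik]; ring) (fun h5 => hne (Fin.rev_injective h5).symm) (fun _ => h1)).ne'

theorem finrank_diagonalCommutant_of_injective {t : Fin d → K} (ht : Function.Injective t) :
    Module.finrank K (diagonalCommutant t) = d := by
  apply le_antisymm
  · let f : diagonalCommutant t →ₗ[K] (Fin d → K) :=
      { toFun := fun S k => S.1 k k
        map_add' := fun _ _ => rfl
        map_smul' := fun _ _ => rfl }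
    have hf : Function.Injective f := by
      rw [← LinearMap.ker_eq_bot, LinearMap.ker_eq_bot']
      intro S hS
      ext i j
      change S.1 i j = 0
      by_cases hij : i = j
      · subst hij; exact congrFun hS i
      · exact (mul_eq_zero.mp (S.2 i j)).resolve_right (sub_ne_zero.mpr fun h => hij (ht h))
    simpa using LinearMap.finrank_le_finrank_of_injective hf
  · simpa using card_le_finrank_diagonalCommutant t (fun k : Fin d => (k, k))
      (fun a b h => congrArg Prod.fst h) (fun _ => rfl)

theorem injective_of_finrank_diagonalCommutant {t : Fin d → K}
    (h : Module.finrank K (diagonalCommutant t) = d) : Function.Injective t := by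
  intro i k hik
  by_contra hne
  have := card_le_finrank_diagonalCommutant t
    (fun o : Option (Fin d) => o.elim (i, k) fun k => (k, k)) ?_ ?_
  · simp [h] at this
  · rintro (_ | a) (_ | b) h
    · rfl
    · simp only [Option.elim, Prod.mk.injEq] at h
      exact absurd (h.1.trans h.2.symm) hne
    · simp only [Option.elim, Prod.mk.injEq] at h
      exact absurd (h.1.symm.trans h.2) hne
    · simp only [Option.elim, Prod.mk.injEq] at h
      rw [h.1]
  · rintro (_ | a)
    · exact hik
    · rfl

/-- Left multiplication by `A` and right multiplication by `B`, for units `A` and `B`. -/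
def mulEquivLR (A B : GL (Fin d) K) :
    Matrix (Fin d) (Fin d) K ≃ₗ[K] Matrix (Fin d) (Fin d) K where
  toFun S := A.1 * S * B.1
  invFun S := (A⁻¹).1 * S * (B⁻¹).1
  map_add' := by intros; simp [Matrix.mul_add, Matrix.add_mul]
  map_smul' := by intros; simp
  left_inv S := by
    change (A⁻¹).1 * (A.1 * S * B.1) * (B⁻¹).1 = S
    rw [show (A⁻¹).1 * (A.1 * S * B.1) * (B⁻¹).1 = ((A⁻¹).1 * A.1) * S * (B.1 * (B⁻¹).1) by
      simp only [Matrix.mul_assoc]]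
    rw [Units.inv_mul, Units.mul_inv, Matrix.one_mul, Matrix.mul_one]
  right_inv S := by
    change A.1 * ((A⁻¹).1 * S * (B⁻¹).1) * B.1 = S
    rw [show A.1 * ((A⁻¹).1 * S * (B⁻¹).1) * B.1 = (A.1 * (A⁻¹).1) * S * ((B⁻¹).1 * B.1) by
      simp only [Matrix.mul_assoc]]
    rw [Units.mul_inv, Units.inv_mul, Matrix.one_mul, Matrix.mul_one]

/-- The form as an invertible matrix. -/
def skewDiagGL (ε : Fin d → ℤˣ) (K : Type*) [Field K] : GL (Fin d) K :=
  ⟨skewDiag ε K, (skewDiag ε K)ᵀ, skewDiag_mul_transpose, transpose_mul_skewDiag⟩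

/-- The transpose of an invertible matrix. -/
def transposeGL (P : GL (Fin d) K) : GL (Fin d) K :=
  ⟨P.1ᵀ, (P⁻¹).1ᵀ, by rw [← Matrix.transpose_mul, Units.inv_mul, Matrix.transpose_one],
    by rw [← Matrix.transpose_mul, Units.mul_inv, Matrix.transpose_one]⟩

/-- The substitution `Y = P S ᵗP J` turns skew-adjointness into `ᵗS = -s S`, and, because `ᵗP J X =
-D ᵗP J` with `D` the diagonal matrix of `t`, commutation with `X` into `S i j * (t i + t j) = 0`.
The eigenmatrix `P` need not be an isometry. -/
theorem finrank_form_centralizer {ε : Fin d → ℤˣ} {s : ℤˣ} (hε : ∀ i, ε i.rev = s * ε i)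
    {X : Matrix (Fin d) (Fin d) K} (hX : X ∈ (MatAlg.form ε).lie K)
    {t : Fin d → AlgebraicClosure K} {P : GL (Fin d) (AlgebraicClosure K)}
    (hP : geom X * P.1 = P.1 * Matrix.diagonal t) :
    Module.finrank (AlgebraicClosure K) ((MatAlg.form ε).centralizer X) =
      Module.finrank (AlgebraicClosure K) (signedCommutant s t) := by
  let e := mulEquivLR P (transposeGL P * skewDiagGL ε (AlgebraicClosure K))
  have he : ∀ S, e S = P.1 * S * (P.1ᵀ * skewDiag ε (AlgebraicClosure K)) := fun S => rfl
  have hmap : (MatAlg.form ε).centralizer X = (signedCommutant s t).map (e : _ →ₗ[_] _) := by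
    have hg := mem_form_lie.mp (geom_mem_form_lie hX)
    have hJ := skewDiag_transpose (R := AlgebraicClosure K) hε
    have hJJ := skewDiag_mul_transpose (ε := ε) (R := AlgebraicClosure K)
    have hJJ' := transpose_mul_skewDiag (ε := ε) (R := AlgebraicClosure K)
    set J := skewDiag ε (AlgebraicClosure K) with hJdef
    have hs2 : (((s : ℤ) : AlgebraicClosure K)) * ((s : ℤ) : AlgebraicClosure K) = 1 :=
      units_cast_mul_self s
    set σ : AlgebraicClosure K := ((s : ℤ) : AlgebraicClosure K) with hσ
    have hPt : P.1ᵀ * (geom X)ᵀ = Matrix.diagonal t * P.1ᵀ := by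
      rw [← Matrix.transpose_mul, hP, Matrix.transpose_mul, Matrix.diagonal_transpose]
    have hXJ : J * geom X = - ((geom X)ᵀ * J) := by rw [hg, neg_neg]
    have hmem : ∀ Y, Y ∈ (MatAlg.form ε).centralizer X ↔
        Yᵀ * J = -(J * Y) ∧ geom X * Y = Y * geom X := by
      intro Y
      rw [MatAlg.centralizer, Submodule.mem_inf, LinearMap.mem_ker]
      simp only [LinearMap.sub_apply, LinearMap.mulLeft_apply, LinearMap.mulRight_apply, sub_eq_zero]
      exact and_congr mem_form_lie Iff.rfl
    have hcond : ∀ S, e S ∈ (MatAlg.form ε).centralizer X ↔ S ∈ signedCommutant s t := by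
      intro S
      rw [hmem]
      have h1 : (e S)ᵀ * J = σ • mulEquivLR (skewDiagGL ε _ * P)
          (transposeGL P * skewDiagGL ε (AlgebraicClosure K)) Sᵀ := by
        change (P.1 * S * (P.1ᵀ * J))ᵀ * J = σ • (J * P.1 * Sᵀ * (P.1ᵀ * J))
        simp only [Matrix.transpose_mul, Matrix.transpose_transpose, hJ, Matrix.smul_mul,
          Matrix.mul_assoc]
      have h2 : J * e S = mulEquivLR (skewDiagGL ε _ * P)
          (transposeGL P * skewDiagGL ε (AlgebraicClosure K)) S := by
        change J * (P.1 * S * (P.1ᵀ * J)) = J * P.1 * S * (P.1ᵀ * J)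
        simp only [Matrix.mul_assoc]
      have h3 : geom X * e S = e (Matrix.diagonal t * S) := by
        rw [he, he, ← Matrix.mul_assoc, ← Matrix.mul_assoc (geom X), hP]
        simp only [Matrix.mul_assoc]
      have h4 : e S * geom X = -e (S * Matrix.diagonal t) := by
        rw [he, he, Matrix.mul_assoc, Matrix.mul_assoc P.1ᵀ, hXJ, Matrix.mul_neg,
          ← Matrix.mul_assoc P.1ᵀ, hPt]
        simp only [Matrix.mul_assoc, Matrix.mul_neg]
      refine and_congr ?_ ?_
      · rw [h1, h2, ← map_smul, ← map_neg, EmbeddingLike.apply_eq_iff_eq]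
        constructor
        · intro h
          have h5 := congrArg (fun M => σ • M) h
          simpa only [smul_smul, hs2, one_smul, smul_neg] using h5
        · intro h
          rw [h, smul_neg, smul_smul, hs2, one_smul]
      · rw [h3, h4, ← map_neg, EmbeddingLike.apply_eq_iff_eq, ← Matrix.ext_iff]
        refine forall_congr' fun i => forall_congr' fun j => ?_
        rw [Matrix.diagonal_mul, Matrix.neg_apply, Matrix.mul_diagonal, eq_neg_iff_add_eq_zero,
          mul_add, mul_comm (t i)]
    ext Y
    rw [Submodule.mem_map]
    constructor
    · intro hY
      exact ⟨e.symm Y, (hcond _).mp (by simpa using hY), by simp⟩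
    · rintro ⟨S, hS, rfl⟩
      exact (hcond S).mpr hS
  rw [hmap]
  exact LinearEquiv.finrank_map_eq e _

theorem finrank_gl_centralizer {X : Matrix (Fin d) (Fin d) K}
    {t : Fin d → AlgebraicClosure K} {P : GL (Fin d) (AlgebraicClosure K)}
    (hP : geom X * P.1 = P.1 * Matrix.diagonal t) :
    Module.finrank (AlgebraicClosure K) (MatAlg.gl.centralizer X) =
      Module.finrank (AlgebraicClosure K) (diagonalCommutant t) := by
  let e := mulEquivLR P P⁻¹
  have hP' : (P⁻¹).1 * geom X = Matrix.diagonal t * (P⁻¹).1 := by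
    calc (P⁻¹).1 * geom X = (P⁻¹).1 * (geom X * P.1) * (P⁻¹).1 := by
          rw [Matrix.mul_assoc, Matrix.mul_assoc, Units.mul_inv, Matrix.mul_one]
      _ = Matrix.diagonal t * (P⁻¹).1 := by
          rw [hP, ← Matrix.mul_assoc, Units.inv_mul, Matrix.one_mul]
  have hmap : MatAlg.gl.centralizer X = (diagonalCommutant t).map (e : _ →ₗ[_] _) := by
    have hcond : ∀ S, e S ∈ MatAlg.gl.centralizer X ↔ S ∈ diagonalCommutant t := by
      intro S
      have hmem : e S ∈ MatAlg.gl.centralizer X ↔ geom X * e S = e S * geom X := by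
        rw [MatAlg.centralizer, Submodule.mem_inf, LinearMap.mem_ker]
        simp only [LinearMap.sub_apply, LinearMap.mulLeft_apply, LinearMap.mulRight_apply,
          sub_eq_zero]
        exact and_iff_right trivial
      have h3 : geom X * e S = e (Matrix.diagonal t * S) := by
        change geom X * (P.1 * S * (P⁻¹).1) = P.1 * (Matrix.diagonal t * S) * (P⁻¹).1
        rw [← Matrix.mul_assoc, ← Matrix.mul_assoc, hP]
        simp only [Matrix.mul_assoc]
      have h4 : e S * geom X = e (S * Matrix.diagonal t) := by
        change P.1 * S * (P⁻¹).1 * geom X = P.1 * (S * Matrix.diagonal t) * (P⁻¹).1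
        rw [Matrix.mul_assoc, hP']
        simp only [Matrix.mul_assoc]
      rw [hmem, h3, h4, EmbeddingLike.apply_eq_iff_eq, ← Matrix.ext_iff]
      refine forall_congr' fun i => forall_congr' fun j => ?_
      rw [Matrix.diagonal_mul, Matrix.mul_diagonal, mul_sub, sub_eq_zero, mul_comm (t i)]
    ext Y
    rw [Submodule.mem_map]
    constructor
    · intro hY
      exact ⟨e.symm Y, (hcond _).mp (by simpa using hY), by simp⟩
    · rintro ⟨S, hS, rfl⟩
      exact (hcond S).mpr hS
  rw [hmap]
  exact LinearEquiv.finrank_map_eq e _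

theorem geom_charpoly (X : Matrix (Fin d) (Fin d) K) :
    (geom X).charpoly = X.charpoly.map (algebraMap K (AlgebraicClosure K)) := by
  exact Matrix.charpoly_map X _

theorem separable_iff_injective_of_roots {L : Type*} [Field L] {p : K[X]} {f : K →+* L}
    {t : Fin d → L} (h : p.map f = ∏ i, (Polynomial.X - C (t i))) :
    p.Separable ↔ Function.Injective t := by
  rw [← Polynomial.separable_map f, h, Polynomial.separable_prod_X_sub_C_iff]

theorem isSemisimple_of_separable {X : Matrix (Fin d) (Fin d) K} (h : X.charpoly.Separable) :
    Module.End.IsSemisimple (Matrix.toLin' (geom X)) := by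
  refine Module.End.isSemisimple_of_squarefree_aeval_eq_zero (p := (geom X).charpoly) ?_ ?_
  · rw [geom_charpoly]
    exact (Polynomial.Separable.map h).squarefree
  · rw [← Matrix.charpoly_toLin']
    exact LinearMap.aeval_self_charpoly _

theorem geom_charpoly_eq_prod_of_roots {X : Matrix (Fin d) (Fin d) K}
    {t : Fin d → AlgebraicClosure K} (ht : (geom X).charpoly.roots = Finset.univ.val.map t) :
    (geom X).charpoly = ∏ i, (Polynomial.X - C (t i)) := by
  rw [(IsAlgClosed.splits (geom X).charpoly).eq_prod_roots_of_monic (Matrix.charpoly_monic _), ht,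
    Multiset.map_map]
  rfl

theorem two_ne_zero_algebraicClosure (h2 : (2 : K) ≠ 0) : (2 : AlgebraicClosure K) ≠ 0 := by
  rw [← map_ofNat (algebraMap K (AlgebraicClosure K)) 2]
  exact (_root_.map_ne_zero _).mpr h2

theorem isRegularSemisimple_form_of_separable (h2 : (2 : K) ≠ 0) {ε : Fin d → ℤˣ} {s : ℤˣ}
    (hs : s = -1 → Even d) (hε : ∀ i, ε i.rev = s * ε i) {X : Matrix (Fin d) (Fin d) K}
    (hX : X ∈ (MatAlg.form ε).lie K) (h : X.charpoly.Separable) :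
    (MatAlg.form ε).IsRegularSemisimple X := by
  refine ⟨isSemisimple_of_separable h, ?_⟩
  obtain ⟨t, ht, hrev⟩ :=
    exists_symmetric_roots (two_ne_zero_algebraicClosure h2) (geom_mem_form_lie hX)
  have hprod := geom_charpoly_eq_prod_of_roots ht
  have hinj := (separable_iff_injective_of_roots ((geom_charpoly X).symm.trans hprod)).mp h
  obtain ⟨P, hP⟩ := exists_eigenmatrix_of_injective hinj hprod
  rw [finrank_form_centralizer hε hX hP,
    finrank_signedCommutant_of_injective (two_ne_zero_algebraicClosure h2) hs hinj hrev]
  rfl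

theorem separable_of_isRegularSemisimple_form (h2 : (2 : K) ≠ 0) {ε : Fin d → ℤˣ} {s : ℤˣ}
    (hε : ∀ i, ε i.rev = s * ε i) {X : Matrix (Fin d) (Fin d) K}
    (hX : X ∈ (MatAlg.form ε).lie K) (h : (MatAlg.form ε).IsRegularSemisimple X)
    (h0 : s = 1 → Even d → (geom X).charpoly.rootMultiplicity 0 ≤ 1) : X.charpoly.Separable := by
  have h2' := two_ne_zero_algebraicClosure h2
  obtain ⟨t, ht, hrev⟩ := exists_symmetric_roots h2' (geom_mem_form_lie hX)
  have hprod := geom_charpoly_eq_prod_of_roots ht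
  obtain ⟨P, hP⟩ := exists_eigenmatrix_of_isSemisimple h.1 ht
  have hr := h.2
  rw [finrank_form_centralizer hε hX hP] at hr
  refine (separable_iff_injective_of_roots ((geom_charpoly X).symm.trans hprod)).mpr
    (injective_of_finrank_signedCommutant h2' hrev ?_ hr)
  intro hs hd i hi
  have h3 := h0 hs hd
  classical
  rw [← Polynomial.count_roots, ht, Multiset.count_map] at h3
  have h4 : ({i, i.rev} : Finset (Fin d)) ⊆ Finset.univ.filter fun j => 0 = t j := by
    intro j hj
    simp only [Finset.mem_insert, Finset.mem_singleton] at hj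
    simp only [Finset.mem_filter, Finset.mem_univ, true_and]
    rcases hj with rfl | rfl
    · exact hi.symm
    · rw [hrev, hi, neg_zero]
  have h5 := Finset.card_le_card h4
  -- For even `d` no index is its own opposite, so an eigenvalue `0` would occur at least twice.
  have h6 : i ≠ i.rev := by
    intro h
    have := congrArg Fin.val h
    rw [Fin.val_rev] at this
    have := i.2
    obtain ⟨m, hm⟩ := hd
    omega
  rw [Finset.card_pair h6] at h5
  have h7 : (Finset.univ.filter fun j => 0 = t j).card ≤ 1 := h3
  omega

theorem isRegularSemisimple_gl_iff {X : Matrix (Fin d) (Fin d) K} :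
    MatAlg.gl.IsRegularSemisimple X ↔ X.charpoly.Separable := by
  have hcard : (geom X).charpoly.roots.card = d := by
    rw [(IsAlgClosed.splits (geom X).charpoly).natDegree_eq_card_roots.symm]; simp
  obtain ⟨t, ht⟩ := exists_enumeration d _ hcard
  have hprod := geom_charpoly_eq_prod_of_roots ht
  have hiff := separable_iff_injective_of_roots ((geom_charpoly X).symm.trans hprod)
  constructor
  · intro h
    obtain ⟨P, hP⟩ := exists_eigenmatrix_of_isSemisimple h.1 ht
    have hr := h.2
    rw [finrank_gl_centralizer hP] at hr
    exact hiff.mpr (injective_of_finrank_diagonalCommutant hr)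
  · intro h
    obtain ⟨P, hP⟩ := exists_eigenmatrix_of_injective (hiff.mp h) hprod
    refine ⟨isSemisimple_of_separable h, ?_⟩
    rw [finrank_gl_centralizer hP, finrank_diagonalCommutant_of_injective (hiff.mp h)]
    rfl

end Centralizer

/-! ### Normal forms and stable conjugacy -/

section NormalForm

variable {d m : ℕ} {ε : Fin d → ℤˣ} {s : ℤˣ}

/-- The Gram matrix `G` of an eigenbasis is supported on the skew diagonal, since eigenvectors are
orthogonal unless their eigenvalues are opposite. Rescaling the eigenvectors makes it equal to `J`.
-/
theorem exists_isometric_eigenmatrix {L : Type*} [Field L] [IsAlgClosed L]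
    (hε : ∀ i, ε i.rev = s * ε i) {X : Matrix (Fin d) (Fin d) L}
    (hX : X ∈ (MatAlg.form ε).lie L) {t : Fin d → L} (ht : Function.Injective t)
    (hrev : ∀ i, t i.rev = - t i) {P : GL (Fin d) L} (hP : X * P.1 = P.1 * Matrix.diagonal t) :
    ∃ Q : GL (Fin d) L, X * Q.1 = Q.1 * Matrix.diagonal t ∧
      Q.1ᵀ * skewDiag ε L * Q.1 = skewDiag ε L := by
  rw [mem_form_lie] at hX
  have hJ := skewDiag_transpose (R := L) hε
  set J := skewDiag ε L with hJdef
  set G : Matrix (Fin d) (Fin d) L := P.1ᵀ * J * P.1 with hG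
  have hGt : Gᵀ = ((s : ℤ) : L) • G := by
    rw [hG, Matrix.transpose_mul, Matrix.transpose_mul, Matrix.transpose_transpose, hJ]
    simp [Matrix.mul_assoc]
  have hPt : P.1ᵀ * Xᵀ = Matrix.diagonal t * P.1ᵀ := by
    rw [← Matrix.transpose_mul, hP, Matrix.transpose_mul, Matrix.diagonal_transpose]
  have hDG : Matrix.diagonal t * G = -(G * Matrix.diagonal t) := by
    calc Matrix.diagonal t * G = (Matrix.diagonal t * P.1ᵀ) * J * P.1 := by
          rw [hG]; simp only [Matrix.mul_assoc]
      _ = P.1ᵀ * (Xᵀ * J) * P.1 := by rw [← hPt]; simp only [Matrix.mul_assoc]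
      _ = -(P.1ᵀ * J * (X * P.1)) := by rw [hX]; simp [Matrix.mul_assoc]
      _ = _ := by rw [hP, hG]; simp only [Matrix.mul_assoc]
  have hG0 : ∀ i j, j ≠ i.rev → G i j = 0 := by
    intro i j hij
    have h := congrFun (congrFun hDG i) j
    rw [Matrix.diagonal_mul, Matrix.neg_apply, Matrix.mul_diagonal] at h
    have h1 : G i j * (t i + t j) = 0 := by linear_combination h
    exact (mul_eq_zero.mp h1).resolve_right fun h2 => hij (eq_rev_of_injective ht hrev h2)
  have hGdet : G.det ≠ 0 := by
    have hPd : P.1.det ≠ 0 := ((Matrix.isUnit_iff_isUnit_det _).mp P.isUnit).ne_zero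
    have hJd : J.det ≠ 0 := ((Matrix.isUnit_iff_isUnit_det _).mp (skewDiagGL ε L).isUnit).ne_zero
    rw [hG, Matrix.det_mul, Matrix.det_mul, Matrix.det_transpose]
    exact mul_ne_zero (mul_ne_zero hPd hJd) hPd
  have hG1 : ∀ i, G i i.rev ≠ 0 := by
    intro i h
    apply hGdet
    refine Matrix.det_eq_zero_of_row_eq_zero i fun j => ?_
    by_cases hj : j = i.rev
    · rw [hj, h]
    · exact hG0 i j hj
  have hGs : ∀ i, G i.rev i = ((s : ℤ) : L) * G i i.rev := fun i => by
    have := congrFun (congrFun hGt i) i.rev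
    simpa using this
  have hε0 : ∀ i, ((ε i : ℤ) : L) ≠ 0 := fun i h => by
    have := units_cast_mul_self (R := L) (ε i)
    rw [h, zero_mul] at this
    exact zero_ne_one this
  choose r hr using fun i => IsAlgClosed.exists_eq_mul_self (((ε i : ℤ) : L) / G i i.rev)
  -- Of two opposite vectors the lower one absorbs the whole factor. The middle vector is paired
  -- with itself and needs a square root.
  let a : Fin d → L := fun i =>
    if i < i.rev then ((ε i : ℤ) : L) / G i i.rev else if i.rev < i then 1 else r i
  have ha : ∀ i, a i * G i i.rev * a i.rev = ((ε i : ℤ) : L) := by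
    intro i
    simp only [a, Fin.rev_rev]
    rcases lt_trichotomy i i.rev with h | h | h
    · rw [if_pos h, if_neg h.not_gt, if_pos h, div_mul_cancel₀ _ (hG1 i), mul_one]
    · rw [if_neg h.not_lt, if_neg h.not_gt, if_neg h.not_gt, if_neg h.not_lt, ← h]
      have h1 := hr i
      have h2 := hG1 i
      rw [← h] at h1 h2
      rw [div_eq_iff h2] at h1
      linear_combination -h1
    · rw [if_neg h.not_gt, if_pos h, if_pos h, one_mul, hGs, hε]
      have hs2 := units_cast_mul_self (R := L) s
      have hs0 : ((s : ℤ) : L) ≠ 0 := fun h0 => by rw [h0, zero_mul] at hs2; exact zero_ne_one hs2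
      have := hG1 i
      push_cast
      rw [mul_comm, div_mul_eq_mul_div, div_eq_iff (mul_ne_zero hs0 this)]
      ring
  have ha0 : ∀ i, a i ≠ 0 := fun i h => hε0 i (by rw [← ha, h]; ring)
  have hA : IsUnit (Matrix.diagonal a) := by
    rw [Matrix.isUnit_iff_isUnit_det, Matrix.det_diagonal]
    exact (Finset.prod_ne_zero_iff.mpr fun i _ => ha0 i).isUnit
  refine ⟨P * hA.unit, ?_, ?_⟩
  · rw [Units.val_mul, IsUnit.unit_spec, ← Matrix.mul_assoc, hP, Matrix.mul_assoc, Matrix.mul_assoc,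
      Matrix.diagonal_mul_diagonal, Matrix.diagonal_mul_diagonal]
    simp only [mul_comm]
  · rw [Units.val_mul, IsUnit.unit_spec, Matrix.transpose_mul, Matrix.diagonal_transpose]
    have : Matrix.diagonal a * P.1ᵀ * J * (P.1 * Matrix.diagonal a) =
        Matrix.diagonal a * G * Matrix.diagonal a := by rw [hG]; simp only [Matrix.mul_assoc]
    rw [this]
    ext i j
    rw [Matrix.mul_diagonal, Matrix.diagonal_mul, hJdef, skewDiag, Matrix.of_apply]
    split_ifs with h
    · rw [h, ha]
    · rw [hG0 i j h, mul_zero, zero_mul]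

theorem geom_injective {K : Type*} [Field K] :
    Function.Injective (geom : Matrix (Fin d) (Fin d) K → _) :=
  Matrix.map_injective (algebraMap K (AlgebraicClosure K)).injective

variable {K : Type*} [Field K]

theorem charpoly_eq_of_stablyConj {A : MatAlg d} {X X' : Matrix (Fin d) (Fin d) K}
    (h : A.StablyConj X X') : X.charpoly = X'.charpoly := by
  obtain ⟨g, -, hg⟩ := h
  apply Polynomial.map_injective _ (algebraMap K (AlgebraicClosure K)).injective
  rw [← geom_charpoly, ← geom_charpoly, ← hg]
  rw [Matrix.coe_units_inv]
  exact (Matrix.charpoly_units_conj g (geom X)).symm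

theorem pfaffian_geom (Y : Matrix (Fin d) (Fin d) K) :
    pfaffian (geom Y) = algebraMap K (AlgebraicClosure K) (pfaffian Y) := by
  simp only [pfaffian, geom, map_sum, map_mul, map_prod, map_inv₀, map_natCast, map_intCast,
    Matrix.map_apply]

theorem geom_skewDiag_mul (X : Matrix (Fin d) (Fin d) K) :
    geom (skewDiag ε K * X) = skewDiag ε (AlgebraicClosure K) * geom X := by
  rw [geom, Matrix.map_mul, skewDiag_map]
  rfl

/-- Conjugation of `X` by an isometry is a congruence of `J X`, and under a congruence the Pfaffian
is multiplied by the determinant. -/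
theorem transpose_inv_mul_mul_inv {L : Type*} [Field L] {J X : Matrix (Fin d) (Fin d) L}
    {h : GL (Fin d) L} (hJ : h.1ᵀ * J * h.1 = J) :
    J * (h.1 * X * (h⁻¹).1) = ((h⁻¹).1)ᵀ * (J * X) * (h⁻¹).1 := by
  have h1 : ((h⁻¹).1)ᵀ * h.1ᵀ = 1 := by
    rw [← Matrix.transpose_mul, Units.mul_inv, Matrix.transpose_one]
  calc J * (h.1 * X * (h⁻¹).1) = (((h⁻¹).1)ᵀ * h.1ᵀ) * J * (h.1 * X * (h⁻¹).1) := by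
        rw [h1, Matrix.one_mul]
    _ = ((h⁻¹).1)ᵀ * (h.1ᵀ * J * h.1) * X * (h⁻¹).1 := by simp only [Matrix.mul_assoc]
    _ = _ := by rw [hJ]; simp only [Matrix.mul_assoc]

theorem pfaffian_conj {L : Type*} [Field L] (hd : d = 2 * m) {J X : Matrix (Fin d) (Fin d) L}
    {h : GL (Fin d) L} (hJ : h.1ᵀ * J * h.1 = J) :
    pfaffian (J * (h.1 * X * (h⁻¹).1)) = (h⁻¹).1.det * pfaffian (J * X) := by
  subst hd
  rw [transpose_inv_mul_mul_inv hJ, pfaffian_transpose_mul_mul]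

theorem det_mul_det_inv {L : Type*} [Field L] (h : GL (Fin d) L) : h.1.det * (h⁻¹).1.det = 1 := by
  rw [← Matrix.det_mul, Units.mul_inv, Matrix.det_one]

theorem pfaffian_eq_of_stablyConj (hd : d = 2 * m) {X X' : Matrix (Fin d) (Fin d) K}
    (h : (MatAlg.form ε).StablyConj X X') :
    pfaffian (skewDiag ε K * X) = pfaffian (skewDiag ε K * X') := by
  obtain ⟨g, ⟨hg, hdet⟩, he⟩ := h
  apply (algebraMap K (AlgebraicClosure K)).injective
  rw [← pfaffian_geom, ← pfaffian_geom, geom_skewDiag_mul, geom_skewDiag_mul, ← he,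
    pfaffian_conj hd hg]
  have := det_mul_det_inv g
  rw [hdet, one_mul] at this
  rw [this, one_mul]

/-- Isometric eigenmatrices `Q`, `Q'` for the same ordered eigenvalues give the isometry `Q' Q⁻¹`.
Its determinant is not controlled yet; this is where the three types part. -/
theorem exists_isometry_conj (h2 : (2 : K) ≠ 0) (hε : ∀ i, ε i.rev = s * ε i)
    {X X' : Matrix (Fin d) (Fin d) K} (hX : X ∈ (MatAlg.form ε).lie K)
    (hX' : X' ∈ (MatAlg.form ε).lie K) (hsep : X.charpoly.Separable)
    (hch : X.charpoly = X'.charpoly) :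
    ∃ h : GL (Fin d) (AlgebraicClosure K),
      h.1ᵀ * skewDiag ε (AlgebraicClosure K) * h.1 = skewDiag ε (AlgebraicClosure K) ∧
      h.1 * geom X * (h⁻¹).1 = geom X' := by
  obtain ⟨t, ht, hrev⟩ :=
    exists_symmetric_roots (two_ne_zero_algebraicClosure h2) (geom_mem_form_lie hX)
  have hprod := geom_charpoly_eq_prod_of_roots ht
  have hinj := (separable_iff_injective_of_roots ((geom_charpoly X).symm.trans hprod)).mp hsep
  have hprod' : (geom X').charpoly = ∏ i, (Polynomial.X - C (t i)) := by
    rw [geom_charpoly, ← hch, ← geom_charpoly, hprod]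
  obtain ⟨P, hP⟩ := exists_eigenmatrix_of_injective hinj hprod
  obtain ⟨P', hP'⟩ := exists_eigenmatrix_of_injective hinj hprod'
  obtain ⟨Q, hQ, hQJ⟩ := exists_isometric_eigenmatrix hε (geom_mem_form_lie hX) hinj hrev hP
  obtain ⟨Q', hQ', hQJ'⟩ := exists_isometric_eigenmatrix hε (geom_mem_form_lie hX') hinj hrev hP'
  set J := skewDiag ε (AlgebraicClosure K)
  have hinvJ : ((Q⁻¹).1)ᵀ * J * (Q⁻¹).1 = J := by
    have h1 : Q.1 * (Q⁻¹).1 = 1 := Units.mul_inv Q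
    have h3 : ((Q⁻¹).1)ᵀ * Q.1ᵀ = 1 := by rw [← Matrix.transpose_mul, h1, Matrix.transpose_one]
    calc _ = ((Q⁻¹).1)ᵀ * (Q.1ᵀ * J * Q.1) * (Q⁻¹).1 := by rw [hQJ]
      _ = (((Q⁻¹).1)ᵀ * Q.1ᵀ) * J * (Q.1 * (Q⁻¹).1) := by simp only [Matrix.mul_assoc]
      _ = J := by rw [h1, h3, Matrix.one_mul, Matrix.mul_one]
  refine ⟨Q' * Q⁻¹, ?_, ?_⟩
  · calc (Q' * Q⁻¹).1ᵀ * J * (Q' * Q⁻¹).1 = ((Q⁻¹).1)ᵀ * (Q'.1ᵀ * J * Q'.1) * (Q⁻¹).1 := by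
          rw [Units.val_mul, Matrix.transpose_mul]; simp only [Matrix.mul_assoc]
      _ = J := by rw [hQJ', hinvJ]
  · rw [mul_inv_rev, inv_inv, Units.val_mul, Units.val_mul]
    calc Q'.1 * (Q⁻¹).1 * geom X * (Q.1 * (Q'⁻¹).1)
        = Q'.1 * (Q⁻¹).1 * (geom X * Q.1) * (Q'⁻¹).1 := by simp only [Matrix.mul_assoc]
      _ = Q'.1 * ((Q⁻¹).1 * Q.1) * Matrix.diagonal t * (Q'⁻¹).1 := by
          rw [hQ]; simp only [Matrix.mul_assoc]
      _ = geom X' * (Q'.1 * (Q'⁻¹).1) := by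
          rw [Units.inv_mul, Matrix.mul_one, ← hQ', Matrix.mul_assoc]
      _ = geom X' := by rw [Units.mul_inv, Matrix.mul_one]

theorem det_sq_of_isometry {L : Type*} [Field L] {h : GL (Fin d) L}
    (hJ : h.1ᵀ * skewDiag ε L * h.1 = skewDiag ε L) : h.1.det = 1 ∨ h.1.det = -1 := by
  have h1 := congrArg Matrix.det hJ
  rw [Matrix.det_mul, Matrix.det_mul, Matrix.det_transpose] at h1
  have hJd : (skewDiag ε L).det ≠ 0 :=
    ((Matrix.isUnit_iff_isUnit_det _).mp (skewDiagGL ε L).isUnit).ne_zero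
  refine sq_eq_one_iff.mp ?_
  have : (skewDiag ε L).det * (h.1.det ^ 2 - 1) = 0 := by linear_combination h1
  linear_combination (mul_eq_zero.mp this).resolve_left hJd

theorem det_skewDiag_symm {ε : Fin (2 * m) → ℤˣ} (hε : ∀ i, ε i.rev = ε i) :
    (skewDiag ε K).det = (-1) ^ m := by
  let e := oppositePairs m
  have hrev : ∀ i : Fin m, e (i, true) = (e (i, false)).rev := fun i => rfl
  have hlt : ∀ i : Fin m, (e (i, false)).1 < m := fun i => i.2
  have hge : ∀ i : Fin m, ¬ (e (i, true)).1 < m := fun i => by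
    rw [hrev, Fin.val_rev]; have := hlt i; omega
  -- Negating half of the columns makes `J` skew-symmetric, so that its determinant becomes a
  -- square; the column signs contribute `(-1)^m`.
  let a : Fin (2 * m) → K := fun i => if i.1 < m then 1 else -1
  have harev : ∀ i, a i.rev = - a i := fun i => by
    simp only [a, Fin.val_rev]
    have := i.2
    split_ifs <;> first | omega | simp
  have hZ := det_of_skewDiagonal (skewDiag ε K * Matrix.diagonal a) (fun i j h => by
      by_contra hij
      apply h
      rw [Matrix.mul_diagonal, skewDiag, Matrix.of_apply, if_neg hij, zero_mul]) (fun i => by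
      simp only [Matrix.mul_diagonal, skewDiag, Matrix.of_apply, Fin.rev_rev, if_true, harev, hε]
      ring)
  rw [Matrix.det_mul, Matrix.det_diagonal, ← e.prod_comp, prod_pair_bool] at hZ
  have h3 : ∏ i, a (e (i, false)) * a (e (i, true)) = (-1) ^ m := by
    have : ∀ i, a (e (i, false)) * a (e (i, true)) = -1 := fun i => by
      simp only [a]; rw [if_pos (hlt i), if_neg (hge i)]; ring
    simp [this]
  have h4 : (∏ i, (skewDiag ε K * Matrix.diagonal a) (e (i, false)) (e (i, true))) ^ 2 = 1 := by
    rw [← Finset.prod_pow]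
    refine Finset.prod_eq_one fun i _ => ?_
    rw [Matrix.mul_diagonal, skewDiag, Matrix.of_apply, hrev, if_pos rfl, ← hrev]
    simp only [a]
    rw [if_neg (hge i), mul_neg_one, neg_sq, sq, units_cast_mul_self]
  rw [h3, h4] at hZ
  have h5 : ((-1 : K) ^ m) * (-1) ^ m = 1 := by rw [← mul_pow]; simp
  linear_combination (-1) ^ m * hZ - (skewDiag ε K).det * h5

theorem pfaffian_skewDiag_ne_zero (hd : d = 2 * m) (hK : ((2 ^ m * m.factorial : ℕ) : K) ≠ 0)
    (hε : ∀ i, ε i.rev = -1 * ε i) : pfaffian (skewDiag ε K) ≠ 0 := by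
  subst hd
  intro h
  have h1 := pfaffian_sq_of_skewDiagonal hK (skewDiag ε K) (fun i j h => by
      by_contra hij
      apply h
      rw [skewDiag, Matrix.of_apply, if_neg hij]) (fun i => by
      simp only [skewDiag, Matrix.of_apply, Fin.rev_rev, if_true, hε]
      simp)
  rw [h] at h1
  exact ((Matrix.isUnit_iff_isUnit_det _).mp (skewDiagGL ε K).isUnit).ne_zero
    (h1.symm.trans (by simp))

theorem cast_ne_zero_algebraicClosure {k : ℕ} (h : (k : K) ≠ 0) :
    (k : AlgebraicClosure K) ≠ 0 := by
  rw [← map_natCast (algebraMap K (AlgebraicClosure K))]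
  exact (_root_.map_ne_zero _).mpr h

/-- Over the closure an isometry makes `X` diagonal. Then `J X` is supported on the skew diagonal,
where the identity is explicit; this avoids the general identity between Pfaffian and determinant.
The sign is `det J`. -/
theorem pfaffian_sq_eq_det (hd : d = 2 * m) (hK : ((2 ^ m * m.factorial : ℕ) : K) ≠ 0)
    (h2 : (2 : K) ≠ 0) (hε : ∀ i, ε i.rev = ε i) {X : Matrix (Fin d) (Fin d) K}
    (hX : X ∈ (MatAlg.form ε).lie K) (hsep : X.charpoly.Separable) :
    pfaffian (skewDiag ε K * X) ^ 2 = (-1) ^ m * X.det := by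
  subst hd
  obtain ⟨t, ht, hrev⟩ :=
    exists_symmetric_roots (two_ne_zero_algebraicClosure h2) (geom_mem_form_lie hX)
  have hprod := geom_charpoly_eq_prod_of_roots ht
  have hinj := (separable_iff_injective_of_roots ((geom_charpoly X).symm.trans hprod)).mp hsep
  obtain ⟨P, hP⟩ := exists_eigenmatrix_of_injective hinj hprod
  obtain ⟨Q, hQ, hQJ⟩ := exists_isometric_eigenmatrix (s := 1) (by simpa using hε)
    (geom_mem_form_lie hX) hinj hrev hP
  have hXQ : geom X = Q.1 * Matrix.diagonal t * (Q⁻¹).1 := by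
    rw [← hQ, Matrix.mul_assoc, Units.mul_inv, Matrix.mul_one]
  apply (algebraMap K (AlgebraicClosure K)).injective
  rw [map_pow, ← pfaffian_geom, geom_skewDiag_mul, ← det_skewDiag_symm hε, ← Matrix.det_mul,
    RingHom.map_det]
  change _ = (geom (skewDiag ε K * X)).det
  rw [geom_skewDiag_mul, hXQ, pfaffian_conj rfl hQJ, mul_pow, pfaffian_sq_of_skewDiagonal
    (cast_ne_zero_algebraicClosure hK), transpose_inv_mul_mul_inv hQJ]
  · simp only [Matrix.det_mul, Matrix.det_transpose]
    ring
  · intro i j h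
    by_contra hij
    apply h
    rw [Matrix.mul_diagonal, skewDiag, Matrix.of_apply, if_neg hij, zero_mul]
  · intro i
    simp only [Matrix.mul_diagonal, skewDiag, Matrix.of_apply, Fin.rev_rev, if_true, hrev, hε]
    ring

/-- Here `J` itself has a nonzero Pfaffian, and its invariance forces every isometry to have
determinant one. -/
theorem stablyConj_symplectic (hd : d = 2 * m) (hK : ((2 ^ m * m.factorial : ℕ) : K) ≠ 0)
    (h2 : (2 : K) ≠ 0) (hε : ∀ i, ε i.rev = -1 * ε i)
    {X X' : Matrix (Fin d) (Fin d) K} (hX : X ∈ (MatAlg.form ε).lie K)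
    (hX' : X' ∈ (MatAlg.form ε).lie K) (hsep : X.charpoly.Separable)
    (hch : X.charpoly = X'.charpoly) : (MatAlg.form ε).StablyConj X X' := by
  obtain ⟨h, hJ, hc⟩ := exists_isometry_conj h2 hε hX hX' hsep hch
  refine ⟨h, ⟨hJ, ?_⟩, hc⟩
  have h0 := pfaffian_skewDiag_ne_zero hd (cast_ne_zero_algebraicClosure hK) hε
  subst hd
  have h1 := congrArg pfaffian hJ
  rw [pfaffian_transpose_mul_mul] at h1
  exact mul_right_cancel₀ h0 (h1.trans (one_mul _).symm)

/-- The determinant of the isometry is the quotient of the two Pfaffians, which is one because they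
agree and do not vanish. -/
theorem stablyConj_evenOrthogonal (hd : d = 2 * m)
    (h2 : (2 : K) ≠ 0) (hε : ∀ i, ε i.rev = ε i)
    {X X' : Matrix (Fin d) (Fin d) K} (hX : X ∈ (MatAlg.form ε).lie K)
    (hX' : X' ∈ (MatAlg.form ε).lie K) (hsep : X.charpoly.Separable)
    (hch : X.charpoly = X'.charpoly)
    (hpf : pfaffian (skewDiag ε K * X) = pfaffian (skewDiag ε K * X'))
    (hpf0 : pfaffian (skewDiag ε K * X) ≠ 0) : (MatAlg.form ε).StablyConj X X' := by
  obtain ⟨h, hJ, hc⟩ := exists_isometry_conj (s := 1) h2 (by simpa using hε) hX hX' hsep hch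
  refine ⟨h, ⟨hJ, ?_⟩, hc⟩
  have h1 := pfaffian_conj (X := geom X) hd hJ
  rw [hc, ← geom_skewDiag_mul, ← geom_skewDiag_mul, pfaffian_geom, pfaffian_geom, ← hpf] at h1
  have h3 : (h⁻¹).1.det = 1 :=
    mul_right_cancel₀ ((_root_.map_ne_zero (algebraMap K (AlgebraicClosure K))).mpr hpf0)
      (h1.symm.trans (one_mul _).symm)
  have h4 := det_mul_det_inv h
  rwa [h3, mul_one] at h4

/-- In odd dimension `-1` is a central isometry of determinant `-1`, so the sign of the determinant
can be corrected. -/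
theorem stablyConj_oddOrthogonal (hd : Odd d)
    (h2 : (2 : K) ≠ 0) (hε : ∀ i, ε i.rev = ε i)
    {X X' : Matrix (Fin d) (Fin d) K} (hX : X ∈ (MatAlg.form ε).lie K)
    (hX' : X' ∈ (MatAlg.form ε).lie K) (hsep : X.charpoly.Separable)
    (hch : X.charpoly = X'.charpoly) : (MatAlg.form ε).StablyConj X X' := by
  obtain ⟨h, hJ, hc⟩ := exists_isometry_conj (s := 1) h2 (by simpa using hε) hX hX' hsep hch
  rcases det_sq_of_isometry hJ with h1 | h1
  · exact ⟨h, ⟨hJ, h1⟩, hc⟩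
  · refine ⟨-h, ⟨?_, ?_⟩, ?_⟩
    · simpa using hJ
    · rw [Units.val_neg, Matrix.det_neg, h1, Fintype.card_fin, hd.neg_one_pow]; simp
    · rw [show (-h)⁻¹ = -h⁻¹ from inv_neg]
      simpa using hc

theorem stablyConj_gl {X X' : Matrix (Fin d) (Fin d) K} (hsep : X.charpoly.Separable)
    (hch : X.charpoly = X'.charpoly) : MatAlg.gl.StablyConj X X' := by
  have hcard : (geom X).charpoly.roots.card = d := by
    rw [(IsAlgClosed.splits (geom X).charpoly).natDegree_eq_card_roots.symm]; simp
  obtain ⟨t, ht⟩ := exists_enumeration d _ hcard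
  have hprod := geom_charpoly_eq_prod_of_roots ht
  have hinj := (separable_iff_injective_of_roots ((geom_charpoly X).symm.trans hprod)).mp hsep
  have hprod' : (geom X').charpoly = ∏ i, (Polynomial.X - C (t i)) := by
    rw [geom_charpoly, ← hch, ← geom_charpoly, hprod]
  obtain ⟨Q, hQ⟩ := exists_eigenmatrix_of_injective hinj hprod
  obtain ⟨Q', hQ'⟩ := exists_eigenmatrix_of_injective hinj hprod'
  refine ⟨Q' * Q⁻¹, trivial, ?_⟩
  rw [mul_inv_rev, inv_inv, Units.val_mul, Units.val_mul]
  calc Q'.1 * (Q⁻¹).1 * geom X * (Q.1 * (Q'⁻¹).1)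
      = Q'.1 * (Q⁻¹).1 * (geom X * Q.1) * (Q'⁻¹).1 := by simp only [Matrix.mul_assoc]
    _ = Q'.1 * ((Q⁻¹).1 * Q.1) * Matrix.diagonal t * (Q'⁻¹).1 := by
        rw [hQ]; simp only [Matrix.mul_assoc]
    _ = geom X' * (Q'.1 * (Q'⁻¹).1) := by
        rw [Units.inv_mul, Matrix.mul_one, ← hQ', Matrix.mul_assoc]
    _ = geom X' := by rw [Units.mul_inv, Matrix.mul_one]

end NormalForm

/-! ### Elements of the split algebras with given characteristic polynomial -/

section Existence

variable {K : Type*} [Field K]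

theorem skewDiag_apply {d : ℕ} (ε : Fin d → ℤˣ) (i j : Fin d) :
    skewDiag ε K i j = if j = i.rev then ((ε i : ℤ) : K) else 0 := rfl

/-- The matrix of a skew-adjoint map in a basis with Gram matrix `J` lies in the Lie algebra.
Independence of the `b i` follows from the invertibility of `J`. -/
theorem exists_mem_lie_of_gram {d : ℕ} (hd0 : 0 < d) {V : Type*} [AddCommGroup V] [Module K V]
    [FiniteDimensional K V] (hfin : Module.finrank K V = d) (B : V →ₗ[K] V →ₗ[K] K) (T : V →ₗ[K] V)
    (hT : ∀ x y, B (T x) y = - B x (T y)) (ε : Fin d → ℤˣ) (b : Fin d → V)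
    (hb : ∀ i j, B (b i) (b j) = skewDiag ε K i j) :
    ∃ X ∈ (MatAlg.form ε).lie K, X.charpoly = T.charpoly := by
  have hli : LinearIndependent K b := by
    rw [Fintype.linearIndependent_iff]
    intro g hg i
    have h := congrArg (fun x => B x (b i.rev)) hg
    simp only [map_sum, map_smul, LinearMap.sum_apply, LinearMap.smul_apply, hb, smul_eq_mul,
      map_zero, LinearMap.zero_apply] at h
    rw [Finset.sum_eq_single i (fun j _ hj => by
      rw [skewDiag_apply, if_neg (fun h => hj (Fin.rev_injective h).symm), mul_zero]) (by simp),
      skewDiag_apply, if_pos rfl] at h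
    refine (mul_eq_zero.mp h).resolve_right fun h0 => ?_
    have := units_cast_mul_self (R := K) (ε i)
    rw [h0, zero_mul] at this
    exact zero_ne_one this
  have : Nonempty (Fin d) := ⟨⟨0, hd0⟩⟩
  let β := basisOfLinearIndependentOfCardEqFinrank hli (by rw [hfin, Fintype.card_fin])
  have hβ : ∀ i, β i = b i := fun i => by simp [β]
  refine ⟨LinearMap.toMatrix β β T, ?_, LinearMap.charpoly_toMatrix T β⟩
  have hTb : ∀ j, T (b j) = ∑ k, LinearMap.toMatrix β β T k j • b k := by
    intro j
    conv_lhs => rw [← β.sum_repr (T (b j))]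
    refine Finset.sum_congr rfl fun k _ => ?_
    rw [LinearMap.toMatrix_apply, hβ, hβ]
  rw [mem_form_lie]
  ext i j
  have h := hT (b i) (b j)
  rw [hTb i, hTb j] at h
  simp only [map_sum, map_smul, LinearMap.sum_apply, LinearMap.smul_apply, hb, smul_eq_mul] at h
  rw [Matrix.neg_apply, Matrix.mul_apply, Matrix.mul_apply]
  simp only [Matrix.transpose_apply]
  rw [h]
  congr 1
  exact Finset.sum_congr rfl fun k _ => mul_comm _ _

/-- A Witt basis is completed from `d / 2` isotropic vectors `u` and, in odd dimension, a middle
vector `e`. The functionals `f` witness the independence of the `u` and, by nondegeneracy, are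
represented by vectors that are dual to them. -/
theorem exists_mem_lie_of_isotropic (h2 : (2 : K) ≠ 0) {d : ℕ} (hd0 : 0 < d) {V : Type*}
    [AddCommGroup V] [Module K V] [FiniteDimensional K V] (hfin : Module.finrank K V = d) (B : V →ₗ[K] V →ₗ[K] K)
    (s : ℤˣ) (hB : ∀ x y, B x y = ((s : ℤ) : K) * B y x) (hnd : ∀ x, (∀ y, B x y = 0) → x = 0)
    (T : V →ₗ[K] V) (hT : ∀ x y, B (T x) y = - B x (T y)) (ε : Fin d → ℤˣ)
    (hε : ∀ i, ε i.rev = s * ε i) (u : Fin (d / 2) → V) (f : Fin (d / 2) → V →ₗ[K] K)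
    (hf : ∀ i j, f j (u i) = if i = j then 1 else 0) (hu : ∀ i j, B (u i) (u j) = 0)
    (e : V) (heu : ∀ i, B e (u i) = 0) (he : e = 0 ∨ B e e * B e e = 1)
    (hmid : ∀ i : Fin d, i.rev = i → B e e = ((ε i : ℤ) : K)) :
    ∃ X ∈ (MatAlg.form ε).lie K, X.charpoly = T.charpoly := by
  have hs2 := units_cast_mul_self (R := K) s
  set σ : K := ((s : ℤ) : K) with hσ
  have hue : ∀ i, B (u i) e = 0 := fun i => by rw [hB, heu, mul_zero]
  have hsurj : Function.Surjective B := by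
    have hinj : Function.Injective B := by
      rw [← LinearMap.ker_eq_bot, LinearMap.ker_eq_bot']
      intro x hx
      exact hnd x fun y => by rw [hx]; rfl
    exact (LinearMap.injective_iff_surjective_of_finrank_eq_finrank
      (Subspace.dual_finrank_eq).symm).mp hinj
  choose w0 hw0 using fun j => hsurj (f j)
  -- Removes the component along `e`. As `B e e` is its own inverse or `e = 0`, multiplying by `B e
  -- e` replaces a division. The factor `σ` makes `B (u i) (w1 j)`, in this order, equal to the
  -- Kronecker delta.
  let w1 : Fin (d / 2) → V := fun j => σ • w0 j - (σ * B (w0 j) e * B e e) • e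
  have hw1u : ∀ i j, B (w1 j) (u i) = if i = j then σ else 0 := by
    intro i j
    simp only [w1, map_sub, map_smul, LinearMap.sub_apply, LinearMap.smul_apply, smul_eq_mul, heu,
      mul_zero, sub_zero, hw0, hf]
    split_ifs <;> simp
  have hw1e : ∀ j, B (w1 j) e = 0 := by
    intro j
    simp only [w1, map_sub, map_smul, LinearMap.sub_apply, LinearMap.smul_apply, smul_eq_mul]
    rcases he with he | he
    · simp [he]
    · linear_combination (-(σ * B (w0 j) e)) * he
  have huw1 : ∀ i j, B (u i) (w1 j) = if i = j then 1 else 0 := by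
    intro i j
    rw [hB, hw1u]
    split_ifs
    · exact hs2
    · rw [mul_zero]
  -- Half of each product is removed from each of the two factors, so the `w` become mutually
  -- orthogonal and isotropic without disturbing their pairing with the `u`.
  let w : Fin (d / 2) → V := fun j => w1 j - ∑ k, ((2 : K)⁻¹ * B (w1 j) (w1 k)) • u k
  have huw : ∀ i j, B (u i) (w j) = if i = j then 1 else 0 := by
    intro i j
    simp [w, map_sum, hu, huw1]
  have hwu : ∀ i j, B (w j) (u i) = if i = j then σ else 0 := by
    intro i j
    rw [hB, huw]; simp
  have hwe : ∀ j, B (w j) e = 0 := by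
    intro j
    simp [w, map_sum, hue, hw1e]
  have hew : ∀ j, B e (w j) = 0 := fun j => by rw [hB, hwe, mul_zero]
  have hww : ∀ j l, B (w j) (w l) = 0 := by
    intro j l
    have h1 : B (w j) (w l) = B (w1 j) (w l) - (2 : K)⁻¹ * B (w1 j) (w1 l) := by
      conv_lhs => rw [show w j = w1 j - ∑ k, ((2 : K)⁻¹ * B (w1 j) (w1 k)) • u k from rfl]
      simp [map_sum, huw]
    have h3 : B (w1 j) (w l) = B (w1 j) (w1 l) - (2 : K)⁻¹ * (B (w1 l) (w1 j) * σ) := by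
      simp [w, map_sum, hw1u]
      ring
    rw [h1, h3, hB (w1 l) (w1 j)]
    field_simp
    linear_combination (-(B (w1 j) (w1 l))) * hs2
  have hlow : ∀ k : Fin (d / 2), (lowerIndex k).1 < d / 2 := fun k => k.2
  have hup : ∀ k : Fin (d / 2), ¬ ((lowerIndex k).rev).1 < d / 2 := fun k => by
    rw [Fin.val_rev]; have := hlow k; omega
  -- The lower half consists of the `u`, the upper half of the duals with the signs of `J`, in
  -- reverse order, and `e` sits in the middle.
  let b : Fin d → V := fun i =>
    if h : i.1 < d / 2 then u ⟨i, h⟩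
    else if h' : i.rev.1 < d / 2 then ((ε i.rev : ℤ) : K) • w ⟨i.rev, h'⟩ else e
  have hb1 : ∀ k, b (lowerIndex k) = u k := fun k => dif_pos (hlow k)
  have hb2 : ∀ k, b (lowerIndex k).rev = ((ε (lowerIndex k) : ℤ) : K) • w k := fun k => by
    simp only [b]
    rw [dif_neg (hup k), dif_pos (by rw [Fin.rev_rev]; exact hlow k)]
    simp only [Fin.rev_rev]
    rfl
  have hb3 : ∀ i : Fin d, i = i.rev → b i = e := fun i hi => by
    have h3 : ¬ i.1 < d / 2 := by
      have := congrArg Fin.val hi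
      rw [Fin.val_rev] at this
      have := i.2
      omega
    simp only [b]
    rw [dif_neg h3, dif_neg (by rw [← hi]; exact h3)]
  have hne1 : ∀ k l : Fin (d / 2), lowerIndex k ≠ (lowerIndex l).rev := lowerIndex_ne_rev
  have hne2 : ∀ (k : Fin (d / 2)) (i : Fin d), i = i.rev → i ≠ lowerIndex k := fun k i hi h => by
    apply hne1 k k; rw [← h]; exact hi
  have hne3 : ∀ (k : Fin (d / 2)) (i : Fin d), i = i.rev → i ≠ (lowerIndex k).rev :=
    fun k i hi h => by
      apply hne2 k i hi; rw [hi, h, Fin.rev_rev]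
  refine exists_mem_lie_of_gram hd0 hfin B T hT ε b fun i j => ?_
  rw [skewDiag_apply]
  rcases exists_lowerIndex i with ⟨k, rfl⟩ | ⟨k, rfl⟩ | ⟨-, hi⟩ <;>
    rcases exists_lowerIndex j with ⟨l, rfl⟩ | ⟨l, rfl⟩ | ⟨-, hj⟩
  · rw [hb1, hb1, hu, if_neg (hne1 l k)]
  · rw [hb1, hb2, map_smul, huw, smul_eq_mul]
    by_cases hkl : k = l
    · subst hkl; simp
    · rw [if_neg hkl, if_neg (fun h => hkl (lowerIndex_injective (Fin.rev_injective h)).symm),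
        mul_zero]
  · rw [hb1, hb3 j hj, hue, if_neg (hne3 k j hj)]
  · rw [hb1, hb2, map_smul, LinearMap.smul_apply, hwu, smul_eq_mul, Fin.rev_rev]
    by_cases hkl : l = k
    · subst hkl; rw [if_pos rfl, if_pos rfl, hε, hσ]; push_cast; ring
    · rw [if_neg hkl, if_neg (fun h => hkl (lowerIndex_injective h)), mul_zero]
  · rw [hb2, hb2, map_smul, map_smul, LinearMap.smul_apply, hww, Fin.rev_rev, smul_zero, smul_zero,
      if_neg (hne1 k l).symm]
  · rw [hb2, hb3 j hj, map_smul, LinearMap.smul_apply, hwe, smul_zero, Fin.rev_rev,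
      if_neg (hne2 k j hj)]
  · rw [hb3 i hi, hb1, heu, ← hi, if_neg (hne2 l i hi).symm]
  · rw [hb3 i hi, hb2, map_smul, hew, smul_zero, ← hi, if_neg (hne3 l i hi).symm]
  · have hij : j = i := by
      apply Fin.ext
      have h3 := congrArg Fin.val hi
      have h4 := congrArg Fin.val hj
      rw [Fin.val_rev] at h3 h4
      omega
    rw [hb3 i hi, hb3 j hj, hij, ← hi, if_pos rfl, hmid i hi.symm]

/-! #### The model `K[λ] / (p)` -/

variable {p : K[X]}

/-- The involution `λ ↦ -λ` of `K[λ] / (p)`, for an even or odd polynomial `p`. -/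
def negRoot (p : K[X]) (h : p ∣ p.comp (-X)) : AdjoinRoot p →ₐ[K] AdjoinRoot p :=
  AdjoinRoot.liftAlgHom p (Algebra.ofId K _) (-AdjoinRoot.root p) (by
    have h1 : (AdjoinRoot.mk p) (p.comp (-X)) = 0 := AdjoinRoot.mk_eq_zero.mpr h
    rw [← AdjoinRoot.aeval_eq, aeval_comp] at h1
    simpa [aeval_def] using h1)

theorem negRoot_root (h : p ∣ p.comp (-X)) :
    negRoot p h (AdjoinRoot.root p) = -AdjoinRoot.root p := by
  simp [negRoot]

theorem negRoot_mk (h : p ∣ p.comp (-X)) (f : K[X]) :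
    negRoot p h (AdjoinRoot.mk p f) = AdjoinRoot.mk p (f.comp (-X)) := by
  rw [← AdjoinRoot.aeval_eq, ← AdjoinRoot.aeval_eq, aeval_comp, ← Polynomial.aeval_algHom_apply,
    negRoot_root]
  simp

theorem negRoot_negRoot (h : p ∣ p.comp (-X)) (x : AdjoinRoot p) :
    negRoot p h (negRoot p h x) = x := by
  obtain ⟨f, rfl⟩ := AdjoinRoot.mk_surjective x
  rw [negRoot_mk, negRoot_mk, comp_assoc]
  simp

/-- The `k`-th coefficient of the reduced representative. -/
def reducedCoeff (hp : p.Monic) (k : ℕ) : AdjoinRoot p →ₗ[K] K :=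
  Polynomial.lcoeff K k ∘ₗ AdjoinRoot.modByMonicHom hp

theorem reducedCoeff_mk (hp : p.Monic) (k : ℕ) {f : K[X]} (hf : f.degree < p.degree) :
    reducedCoeff hp k (AdjoinRoot.mk p f) = f.coeff k := by
  rw [reducedCoeff, LinearMap.comp_apply, AdjoinRoot.modByMonicHom_mk,
    (modByMonic_eq_self_iff hp).mpr hf, lcoeff_apply]

theorem exists_reduced (hp : p.Monic) (x : AdjoinRoot p) :
    ∃ f : K[X], f.degree < p.degree ∧ AdjoinRoot.mk p f = x := by
  obtain ⟨f, rfl⟩ := AdjoinRoot.mk_surjective x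
  refine ⟨f %ₘ p, degree_modByMonic_lt f hp, ?_⟩
  have := AdjoinRoot.mk_leftInverse hp (AdjoinRoot.mk p f)
  rwa [AdjoinRoot.modByMonicHom_mk] at this

theorem reducedCoeff_root_pow (hp : p.Monic) (k : ℕ) {i : ℕ} (hi : i < p.natDegree) :
    reducedCoeff hp k (AdjoinRoot.root p ^ i) = if i = k then 1 else 0 := by
  rw [← AdjoinRoot.mk_X, ← map_pow, reducedCoeff_mk hp k, coeff_X_pow]
  · simp only [eq_comm]
  · rw [degree_X_pow, degree_eq_natDegree hp.ne_zero]; exact_mod_cast hi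

theorem reducedCoeff_negRoot (hp : p.Monic) (h : p ∣ p.comp (-X)) (k : ℕ) (x : AdjoinRoot p) :
    reducedCoeff hp k (negRoot p h x) = (-1) ^ k * reducedCoeff hp k x := by
  obtain ⟨f, hf, rfl⟩ := exists_reduced hp x
  rw [negRoot_mk, reducedCoeff_mk hp k hf, reducedCoeff_mk hp k (by rwa [degree_comp_neg_X])]
  have h3 : f.comp (-X) = f.comp (C (-1) * X) := by simp
  rw [h3, comp_C_mul_X_coeff, mul_comm]

/-- The form `(x, y) ↦ a · ψ(x ȳ)`, where `ψ` is the `k`-th reduced coefficient. -/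
def modelForm (hp : p.Monic) (h : p ∣ p.comp (-X)) (k : ℕ) (a : K) :
    AdjoinRoot p →ₗ[K] AdjoinRoot p →ₗ[K] K :=
  LinearMap.mk₂ K (fun x y => a * reducedCoeff hp k (x * negRoot p h y))
    (fun x y z => by rw [add_mul, map_add, mul_add])
    (fun c x y => by rw [smul_mul_assoc, map_smul, smul_eq_mul, smul_eq_mul]; ring)
    (fun x y z => by rw [map_add, mul_add, map_add, mul_add])
    (fun c x y => by rw [map_smul, mul_smul_comm, map_smul, smul_eq_mul, smul_eq_mul]; ring)

theorem modelForm_apply (hp : p.Monic) (h : p ∣ p.comp (-X)) (k : ℕ) (a : K) (x y : AdjoinRoot p) :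
    modelForm hp h k a x y = a * reducedCoeff hp k (x * negRoot p h y) := rfl

/-- The involution multiplies the `k`-th coefficient by `(-1)^k`. So the parity of `k` decides the
symmetry: the top coefficient `k = d - 1` suits the symplectic and odd orthogonal forms, and `k = 0`
the even orthogonal one. -/
theorem modelForm_symm (hp : p.Monic) (h : p ∣ p.comp (-X)) (k : ℕ) (a : K) (x y : AdjoinRoot p) :
    modelForm hp h k a x y = (-1) ^ k * modelForm hp h k a y x := by
  rw [modelForm_apply, modelForm_apply]
  have : y * negRoot p h x = negRoot p h (x * negRoot p h y) := by
    rw [map_mul, negRoot_negRoot, mul_comm]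
  rw [this, reducedCoeff_negRoot]
  have h1 : ((-1 : K) ^ k) * (-1) ^ k = 1 := by rw [← mul_pow]; simp
  linear_combination (-(a * reducedCoeff hp k (x * negRoot p h y))) * h1

theorem modelForm_root_mul (hp : p.Monic) (h : p ∣ p.comp (-X)) (k : ℕ) (a : K)
    (x y : AdjoinRoot p) :
    modelForm hp h k a (AdjoinRoot.root p * x) y = - modelForm hp h k a x (AdjoinRoot.root p * y) := by
  rw [modelForm_apply, modelForm_apply, map_mul (negRoot p h), negRoot_root]
  rw [show x * (-AdjoinRoot.root p * negRoot p h y) = -(AdjoinRoot.root p * x * negRoot p h y) by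
    ring, map_neg]
  ring

theorem modelForm_root_pow (hp : p.Monic) (h : p ∣ p.comp (-X)) (k : ℕ) (a : K) (i j : ℕ) :
    modelForm hp h k a (AdjoinRoot.root p ^ i) (AdjoinRoot.root p ^ j) =
      a * ((-1) ^ j * reducedCoeff hp k (AdjoinRoot.root p ^ (i + j))) := by
  rw [modelForm_apply, map_pow, negRoot_root, ← neg_one_smul K (AdjoinRoot.root p), _root_.smul_pow,
    mul_smul_comm, map_smul, ← pow_add, smul_eq_mul]

theorem modelForm_nondegenerate (hp : p.Monic) (h : p ∣ p.comp (-X)) (k : ℕ) {a : K} (ha : a ≠ 0)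
    (hk : ∀ x, (∀ y, reducedCoeff hp k (x * y) = 0) → x = 0) (x : AdjoinRoot p)
    (hx : ∀ y, modelForm hp h k a x y = 0) : x = 0 := by
  refine hk x fun y => ?_
  have := hx (negRoot p h y)
  rw [modelForm_apply, negRoot_negRoot] at this
  exact (mul_eq_zero.mp this).resolve_left ha

/-- Multiplication by a power of `λ` moves the leading coefficient of the representative into the
top position, without any reduction modulo `p`. -/
theorem topCoeff_nondegenerate (hp : p.Monic) (x : AdjoinRoot p)
    (hx : ∀ y, reducedCoeff hp (p.natDegree - 1) (x * y) = 0) : x = 0 := by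
  obtain ⟨f, hf, rfl⟩ := exists_reduced hp x
  by_contra hne
  have hf0 : f ≠ 0 := fun h => hne (by rw [h, map_zero])
  rw [degree_eq_natDegree hf0, degree_eq_natDegree hp.ne_zero] at hf
  have hf' : f.natDegree < p.natDegree := by exact_mod_cast hf
  have h1 := hx (AdjoinRoot.mk p (X ^ (p.natDegree - 1 - f.natDegree)))
  rw [← map_mul, reducedCoeff_mk] at h1
  · rw [show p.natDegree - 1 = f.natDegree + (p.natDegree - 1 - f.natDegree) by omega] at h1
    rw [show f.natDegree + (p.natDegree - 1 - f.natDegree) - f.natDegree =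
      p.natDegree - 1 - f.natDegree by omega, coeff_mul_X_pow] at h1
    exact hf0 (leadingCoeff_eq_zero.mp h1)
  · rw [degree_mul, degree_X_pow, degree_eq_natDegree hf0, degree_eq_natDegree hp.ne_zero]
    have : f.natDegree + (p.natDegree - 1 - f.natDegree) < p.natDegree := by omega
    exact_mod_cast this

/-- Since `p(0) ≠ 0`, powers of `λ` are invertible modulo `p`. Dividing the representative by the
highest power of `λ` in it leaves a polynomial with nonzero constant term. -/
theorem constCoeff_nondegenerate (hp : p.Monic) (h0 : p.coeff 0 ≠ 0) (x : AdjoinRoot p)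
    (hx : ∀ y, reducedCoeff hp 0 (x * y) = 0) : x = 0 := by
  obtain ⟨f, hf, rfl⟩ := exists_reduced hp x
  by_contra hne
  have hf0 : f ≠ 0 := fun h => hne (by rw [h, map_zero])
  obtain ⟨q, hq⟩ : X ^ f.natTrailingDegree ∣ f := X_pow_dvd_iff.mpr fun k hk =>
    coeff_eq_zero_of_lt_natTrailingDegree hk
  have hcop : IsCoprime (X ^ f.natTrailingDegree) p := by
    apply IsCoprime.pow_left
    rw [Polynomial.irreducible_X.coprime_iff_not_dvd, X_dvd_iff]
    exact h0
  obtain ⟨a, b, hab⟩ := hcop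
  have h1 := hx (AdjoinRoot.mk p a)
  have h3 : AdjoinRoot.mk p f * AdjoinRoot.mk p a = AdjoinRoot.mk p q := by
    rw [← map_mul, AdjoinRoot.mk_eq_mk]
    refine ⟨-(q * b), ?_⟩
    have h4 := congrArg (fun r => q * r) hab
    simp only [mul_one] at h4
    conv_lhs => rw [hq]
    linear_combination (exp := 1) h4
  have hqf : q ≠ 0 := fun h => hf0 (by rw [hq, h, mul_zero])
  have hq0 : q.coeff 0 ≠ 0 := by
    have h4 : f.coeff f.natTrailingDegree ≠ 0 := trailingCoeff_nonzero_iff_nonzero.mpr hf0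
    have h5 := congrArg (fun r => r.coeff f.natTrailingDegree) hq
    simp only [coeff_X_pow_mul', le_refl, if_true, Nat.sub_self] at h5
    rwa [← h5]
  rw [h3, reducedCoeff_mk] at h1
  · exact hq0 h1
  · refine lt_of_le_of_lt ?_ hf
    conv_rhs => rw [hq, mul_comm]
    exact degree_le_mul_left q (pow_ne_zero _ X_ne_zero)

theorem charpoly_mul_root (hp : p.Monic) [Module.Finite K (AdjoinRoot p)] :
    (LinearMap.mulLeft K (AdjoinRoot.root p)).charpoly = p := by
  rw [← LinearMap.charpoly_toMatrix _ (AdjoinRoot.powerBasis' hp).basis]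
  have h := charpoly_leftMulMatrix (AdjoinRoot.powerBasis' hp)
  rw [AdjoinRoot.powerBasis'_gen, AdjoinRoot.minpoly_root hp.ne_zero, hp.leadingCoeff, inv_one, C_1,
    mul_one] at h
  exact h

theorem finrank_adjoinRoot (hp : p.Monic) : Module.finrank K (AdjoinRoot p) = p.natDegree := by
  rw [(AdjoinRoot.powerBasis' hp).finrank, AdjoinRoot.powerBasis'_dim]

/-- The powers `λ^i` with `i < d / 2` span an isotropic subspace, because their products have degree
less than `d - 1`. For odd `d = 2m + 1` the middle vector is `λ^m`, orthogonal to the lower powers.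
-/
theorem exists_mem_lie_of_topCoeff (h2 : (2 : K) ≠ 0) {d : ℕ} (hd0 : 0 < d) {ε : Fin d → ℤˣ}
    (hε : ∀ i, ε i.rev = (-1) ^ (d - 1) * ε i) (hp : p.Monic) (hpd : p.natDegree = d)
    (hpe : p ∣ p.comp (-X)) : ∃ X ∈ (MatAlg.form ε).lie K, X.charpoly = p := by
  have := (AdjoinRoot.powerBasis' hp).finite
  have key : ∀ (a : K) (ha : a ≠ 0) (e : AdjoinRoot p),
      (∀ i < d / 2, modelForm hp hpe (d - 1) a e (AdjoinRoot.root p ^ i) = 0) →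
      (e = 0 ∨ modelForm hp hpe (d - 1) a e e * modelForm hp hpe (d - 1) a e e = 1) →
      (∀ i : Fin d, i.rev = i → modelForm hp hpe (d - 1) a e e = ((ε i : ℤ) : K)) →
      ∃ X ∈ (MatAlg.form ε).lie K, X.charpoly = p := by
    intro a ha e heu he hmid
    obtain ⟨X, hX, hXc⟩ := exists_mem_lie_of_isotropic h2 hd0 ((finrank_adjoinRoot hp).trans hpd)
      (modelForm hp hpe (d - 1) a) ((-1) ^ (d - 1))
      (fun x y => by rw [modelForm_symm]; simp)
      (modelForm_nondegenerate hp hpe (d - 1) ha (by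
        rw [← hpd]; exact topCoeff_nondegenerate hp))
      (LinearMap.mulLeft K (AdjoinRoot.root p)) (modelForm_root_mul hp hpe (d - 1) a) ε hε
      (fun i => AdjoinRoot.root p ^ (i : ℕ)) (fun j => reducedCoeff hp j)
      (fun i j => by
        rw [reducedCoeff_root_pow hp _ (by have := i.2; omega)]
        simp only [Fin.ext_iff])
      (fun i j => by
        rw [modelForm_root_pow, reducedCoeff_root_pow hp _ (by have := i.2; have := j.2; omega),
          if_neg (by have := i.2; have := j.2; omega)]
        ring)
      e (fun i => heu i i.2) he hmid
    exact ⟨X, hX, hXc.trans (charpoly_mul_root hp)⟩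
  rcases Nat.even_or_odd d with ⟨m, hm⟩ | ⟨m, hm⟩
  · refine key 1 one_ne_zero 0 (fun i _ => by simp) (Or.inl rfl) (fun i hi => ?_)
    have := congrArg Fin.val hi
    rw [Fin.val_rev] at this
    have := i.2
    omega
  -- The vector `λ^m` has product `(-1)^m a` with itself. The scalar `a = (-1)^m ε c` makes this the
  -- middle entry of `J`.
  · let c : Fin d := ⟨m, by omega⟩
    have hs := units_cast_mul_self (R := K) ((-1) ^ m * ε c)
    have hee : modelForm hp hpe (d - 1) ((((-1) ^ m * ε c : ℤˣ) : ℤ) : K) (AdjoinRoot.root p ^ m)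
        (AdjoinRoot.root p ^ m) = ((ε c : ℤ) : K) := by
      rw [modelForm_root_pow, reducedCoeff_root_pow hp _ (by omega), if_pos (by omega)]
      have h1 : ((-1 : K) ^ m) * (-1) ^ m = 1 := by rw [← mul_pow]; simp
      push_cast
      linear_combination ((ε c : ℤ) : K) * h1
    refine key ((((-1) ^ m * ε c : ℤˣ) : ℤ) : K)
      (fun h => by rw [h, zero_mul] at hs; exact zero_ne_one hs)
      (AdjoinRoot.root p ^ m) (fun i hi => ?_) (Or.inr ?_) (fun i hi => ?_)
    · rw [modelForm_root_pow, reducedCoeff_root_pow hp _ (by omega), if_neg (by omega)]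
      ring
    · rw [hee, units_cast_mul_self]
    · rw [hee]
      have : i = c := by
        apply Fin.ext
        have := congrArg Fin.val hi
        rw [Fin.val_rev] at this
        have := i.2
        simp only [c]
        omega
      rw [this]

theorem reducedCoeff_root_pow_natDegree (hp : p.Monic) (hd : 0 < p.natDegree) :
    reducedCoeff hp 0 (AdjoinRoot.root p ^ p.natDegree) = - p.coeff 0 := by
  have h1 : AdjoinRoot.root p ^ p.natDegree = AdjoinRoot.mk p (X ^ p.natDegree - p) := by
    rw [map_sub, AdjoinRoot.mk_self, sub_zero, map_pow, AdjoinRoot.mk_X]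
  rw [h1, reducedCoeff_mk, coeff_sub, coeff_X_pow, if_neg (by omega), zero_sub]
  rw [← degree_neg, neg_sub]
  refine degree_sub_lt_left ?_ hp.ne_zero ?_
  · rw [degree_X_pow, degree_eq_natDegree hp.ne_zero]
  · rw [hp.leadingCoeff, (monic_X_pow _).leadingCoeff]

/-- For the constant-term form the powers `λ, …, λ^(m-1)` are isotropic and mutually orthogonal. The
product of `λ^m` with itself is `-(-1)^m p(0) = -v^2`, so `v + λ^m` is the missing isotropic vector:
the square root `v` is what makes the form split. -/
theorem exists_mem_lie_of_constCoeff (h2 : (2 : K) ≠ 0) {m : ℕ} (hm : 0 < m) {d : ℕ}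
    (hd : d = 2 * m) {ε : Fin d → ℤˣ} (hε : ∀ i, ε i.rev = ε i) (hp : p.Monic)
    (hpd : p.natDegree = d) (hpe : p ∣ p.comp (-X)) {v : K} (hv : v ^ 2 = (-1) ^ m * p.coeff 0)
    (hv0 : v ≠ 0) : ∃ X ∈ (MatAlg.form ε).lie K, X.charpoly = p := by
  have := (AdjoinRoot.powerBasis' hp).finite
  have hp0 : p.coeff 0 ≠ 0 := fun h => hv0 (by
    rw [h, mul_zero] at hv; exact pow_eq_zero_iff (two_ne_zero) |>.mp hv)
  have hB := modelForm_root_pow hp hpe 0 1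
  have hr0 : ∀ i, 0 < i → i < 2 * m → reducedCoeff hp 0 (AdjoinRoot.root p ^ i) = 0 :=
    fun i h0 hi => by rw [reducedCoeff_root_pow hp _ (by omega), if_neg (by omega)]
  have hr1 : reducedCoeff hp 0 (AdjoinRoot.root p ^ 0) = 1 := by
    rw [reducedCoeff_root_pow hp _ (by omega), if_pos rfl]
  have hrm : reducedCoeff hp 0 (AdjoinRoot.root p ^ (m + m)) = - p.coeff 0 := by
    rw [show m + m = p.natDegree by omega]
    exact reducedCoeff_root_pow_natDegree hp (by omega)
  -- The vector with index `i` is `λ^(i+1)`; only the last one, `i + 1 = m`, is corrected by the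
  -- constant `v`.
  let c : ℕ → K := fun i => if i + 1 = m then v else 0
  have hc : ∀ i, i + 1 < m → c i = 0 := fun i hi => if_neg (by omega)
  have hcm : ∀ i, i + 1 = m → c i = v := fun i hi => if_pos hi
  have h1m : ((-1 : K) ^ m) * (-1) ^ m = 1 := by rw [← mul_pow]; simp
  obtain ⟨X, hX, hXc⟩ := exists_mem_lie_of_isotropic h2 (by omega : 0 < d)
    ((finrank_adjoinRoot hp).trans hpd) (modelForm hp hpe 0 1) 1
    (fun x y => by rw [modelForm_symm]; simp)
    (modelForm_nondegenerate hp hpe 0 one_ne_zero (constCoeff_nondegenerate hp hp0))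
    (LinearMap.mulLeft K (AdjoinRoot.root p)) (modelForm_root_mul hp hpe 0 1) ε
    (by simpa using hε)
    (fun i => c i • AdjoinRoot.root p ^ 0 + AdjoinRoot.root p ^ ((i : ℕ) + 1))
    (fun j => reducedCoeff hp ((j : ℕ) + 1))
    (fun i j => by
      have := i.2
      rw [map_add, map_smul, reducedCoeff_root_pow hp _ (by omega),
        reducedCoeff_root_pow hp _ (by omega), if_neg (by omega)]
      simp [Fin.ext_iff])
    (fun i j => by
      have := i.2
      have := j.2
      simp only [map_add, map_smul, LinearMap.add_apply, LinearMap.smul_apply, smul_eq_mul, hB,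
        zero_add, add_zero]
      rw [hr1, hr0 _ (by omega : 0 < (i : ℕ) + 1) (by omega), hr0 _ (by omega : 0 < (j : ℕ) + 1)
        (by omega)]
      by_cases hij : (i : ℕ) + 1 = m ∧ (j : ℕ) + 1 = m
      · rw [hij.1, hij.2, hrm, hcm _ hij.1, hcm _ hij.2]
        linear_combination hv + 0 * h1m
      · rw [hr0 _ (by omega : 0 < (i : ℕ) + 1 + (j + 1)) (by omega)]
        have : c i * c j = 0 := by
          rcases not_and_or.mp hij with h | h
          · rw [hc i (by omega), zero_mul]
          · rw [hc j (by omega), mul_zero]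
        linear_combination this)
    0 (fun i => by simp) (Or.inl rfl) (fun i hi => by
      have := congrArg Fin.val hi
      rw [Fin.val_rev] at this
      have := i.2
      omega)
  exact ⟨X, hX, hXc.trans (charpoly_mul_root hp)⟩

theorem dvd_comp_neg_X_of_coeff {s : ℕ} (hp : ∀ k, Odd (s + k) → p.coeff k = 0) :
    p ∣ p.comp (-X) := by
  refine Dvd.intro_left (C ((-1) ^ s)) ?_
  ext k
  have h3 : p.comp (-X) = p.comp (C (-1) * X) := by simp
  rw [h3, comp_C_mul_X_coeff, coeff_C_mul]
  rcases Nat.even_or_odd (s + k) with h | h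
  · have h1 : ((-1 : K) ^ s) * (-1) ^ k = 1 := by rw [← pow_add]; exact h.neg_one_pow
    have h4 : ((-1 : K) ^ k) * (-1) ^ k = 1 := by rw [← mul_pow]; simp
    linear_combination p.coeff k * (-1) ^ k * h1 - p.coeff k * (-1) ^ s * h4
  · rw [hp k h]; ring

theorem exists_mem_lie_symplectic (h2 : (2 : K) ≠ 0) {m : ℕ} (hm : 0 < m) {d : ℕ} (hd : d = 2 * m)
    {ε : Fin d → ℤˣ} (hε : ∀ i, ε i.rev = -1 * ε i) (hp : p.Monic) (hpd : p.natDegree = d)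
    (hpe : ∀ k, Odd k → p.coeff k = 0) : ∃ X ∈ (MatAlg.form ε).lie K, X.charpoly = p := by
  refine exists_mem_lie_of_topCoeff h2 (by omega) (fun i => ?_) hp hpd
    (dvd_comp_neg_X_of_coeff (s := 0) (by simpa using hpe))
  rw [hε, (show Odd (d - 1) from ⟨m - 1, by omega⟩).neg_one_pow]

theorem exists_mem_lie_oddOrthogonal (h2 : (2 : K) ≠ 0) {m : ℕ} {d : ℕ} (hd : d = 2 * m + 1)
    {ε : Fin d → ℤˣ} (hε : ∀ i, ε i.rev = ε i) (hp : p.Monic) (hpd : p.natDegree = d)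
    (hpe : ∀ k, Even k → p.coeff k = 0) : ∃ X ∈ (MatAlg.form ε).lie K, X.charpoly = p := by
  refine exists_mem_lie_of_topCoeff h2 (by omega) (fun i => ?_) hp hpd
    (dvd_comp_neg_X_of_coeff (s := 1) (fun k hk => hpe k ?_))
  · rw [hε, (show Even (d - 1) from ⟨m, by omega⟩).neg_one_pow, one_mul]
  · rcases Nat.even_or_odd k with h | ⟨a, ha⟩
    · exact h
    · obtain ⟨b, hb⟩ := hk; exact ⟨b, by omega⟩

theorem pfaffian_submatrix_perm {m : ℕ} (Y : Matrix (Fin (2 * m)) (Fin (2 * m)) K)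
    (σ : Equiv.Perm (Fin (2 * m))) :
    pfaffian (Y.submatrix σ σ) = ((Equiv.Perm.sign σ : ℤ) : K) * pfaffian Y := by
  let e := consecutivePairs m
  have h : (Y.submatrix σ σ).submatrix e e =
      (Y.submatrix e e).submatrix (e.symm.permCongr σ) (e.symm.permCongr σ) := by
    ext a b; simp [Equiv.permCongr_apply]
  rw [pfaffian_eq_pfaffianSum, pfaffian_eq_pfaffianSum, h, pfaffianSum_submatrix_perm,
    Equiv.Perm.sign_permCongr]
  ring

/-- The element just constructed has Pfaffian `v` or `-v`. In the latter case it is conjugated by an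
isometry of determinant `-1`. -/
theorem exists_mem_lie_evenOrthogonal (h2 : (2 : K) ≠ 0) {m : ℕ} (hm : 0 < m)
    (hK : ((2 ^ m * m.factorial : ℕ) : K) ≠ 0) {d : ℕ}
    (hd : d = 2 * m) {ε : Fin d → ℤˣ} (hε : ∀ i, ε i.rev = ε i) (hp : p.Monic)
    (hpd : p.natDegree = d) (hpe : ∀ k, Odd k → p.coeff k = 0) (hsep : p.Separable) {v : K}
    (hv : v ^ 2 = (-1) ^ m * p.coeff 0) (hv0 : v ≠ 0) :
    ∃ X ∈ (MatAlg.form ε).lie K, X.charpoly = p ∧ pfaffian (skewDiag ε K * X) = v := by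
  obtain ⟨X, hX, hXp⟩ := exists_mem_lie_of_constCoeff h2 hm hd hε hp hpd
    (dvd_comp_neg_X_of_coeff (s := 0) (by simpa using hpe)) hv hv0
  have hpf := pfaffian_sq_eq_det hd hK h2 hε hX (by rwa [hXp])
  rw [Matrix.det_eq_sign_charpoly_coeff, hXp, Fintype.card_fin,
    (show Even d from ⟨m, by omega⟩).neg_one_pow, one_mul, ← hv] at hpf
  rcases sq_eq_sq_iff_eq_or_eq_neg.mp hpf with h | h
  · exact ⟨X, hX, hXp, h⟩
  · subst hd
    let i : Fin (2 * m) := ⟨0, by omega⟩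
    -- Exchanging two opposite basis vectors preserves `J`, whose signs are symmetric, and reverses
    -- the Pfaffian.
    let σ := Equiv.swap i i.rev
    have hi : i ≠ i.rev := fun h => by
      have := congrArg Fin.val h
      rw [Fin.val_rev] at this
      simp only [i] at this
      omega
    have hσrev : ∀ a, (σ a).rev = σ a.rev := fun a => by
      simp only [σ, Equiv.swap_apply_def]
      have h1 : a.rev = i ↔ a = i.rev := by rw [Fin.rev_eq_iff]
      have h3 : a.rev = i.rev ↔ a = i := Fin.rev_inj
      simp only [h1, h3]
      split_ifs with h4 h5 <;> simp_all
    have hσε : ∀ a, ε (σ a) = ε a := fun a => by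
      simp only [σ, Equiv.swap_apply_def]
      split_ifs with h4 h5
      · rw [hε, h4]
      · rw [h5, hε]
      · rfl
    have hJ : (skewDiag ε K).submatrix σ σ = skewDiag ε K := by
      ext a b
      rw [Matrix.submatrix_apply, skewDiag_apply, skewDiag_apply, hσrev, hσε]
      simp only [EmbeddingLike.apply_eq_iff_eq]
    refine ⟨X.submatrix σ σ, ?_, ?_, ?_⟩
    · rw [mem_form_lie] at hX ⊢
      calc (X.submatrix σ σ)ᵀ * skewDiag ε K = (Xᵀ * skewDiag ε K).submatrix σ σ := by
            conv_lhs => rw [← hJ]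
            rw [Matrix.transpose_submatrix, Matrix.submatrix_mul_equiv]
        _ = -((skewDiag ε K * X).submatrix σ σ) := by rw [hX]; rfl
        _ = -(skewDiag ε K * X.submatrix σ σ) := by
            conv_rhs => rw [← hJ]
            rw [Matrix.submatrix_mul_equiv]
    · rw [← hXp]
      exact Matrix.charpoly_reindex σ.symm X
    · conv_lhs => rw [← hJ]
      rw [Matrix.submatrix_mul_equiv, pfaffian_submatrix_perm, h, Equiv.Perm.sign_swap hi]
      simp

theorem exists_charpoly_eq {d : ℕ} (hp : p.Monic) (hpd : p.natDegree = d) :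
    ∃ X : Matrix (Fin d) (Fin d) K, X.charpoly = p := by
  have := (AdjoinRoot.powerBasis' hp).finite
  subst hpd
  exact ⟨_, (LinearMap.charpoly_toMatrix _ (AdjoinRoot.powerBasis' hp).basis).trans
    (charpoly_mul_root hp)⟩

end Existence

/-! ### Points of the parameter space -/

section ParamPoint

variable {T : ClassicalType} {c : ℕ} {r : ℚ} {M : ℕ} {k : Type*} [Field k]

/-- The pairs `(R, v)` that are the points of the parameter space over a field. -/
structure IsParam (T : ClassicalType) (c : ℕ) (r : ℚ) (R : k[X]) (v : k) : Prop where
  monic : R.Monic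
  natDegree_eq : R.natDegree = redDegree c r
  separable : R.Separable
  coeff_zero_ne_zero : R.coeff 0 ≠ 0
  coeff_eq_zero : Odd r.den → ∀ i, Odd (redDegree c r + i) → R.coeff i = 0
  pfaffian_eq : match T with
    | .evenOrthogonal => v ^ 2 = (-1) ^ c * R.coeff 0
    | .oddOrthogonal => v = 0
    | .symplectic => v = 0

/-- The monic polynomial of degree `g` with lower coefficients `a j`. -/
def monicOfCoeffs {g : ℕ} {S : Type*} [CommRing S] (a : Fin g → S) : S[X] :=
  X ^ g + ∑ j : Fin g, C (a j) * X ^ (g - 1 - (j : ℕ))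

section MonicOfCoeffs

variable {g : ℕ} {S : Type*} [CommRing S]

theorem map_genericPoly {B : Type*} [CommRing B] (φ : MvPolynomial (ParamVar g) B →+* S) :
    (genericPoly g B).map φ = monicOfCoeffs fun j => φ (MvPolynomial.X (ParamVar.a j)) := by
  simp [genericPoly, monicOfCoeffs, Polynomial.map_sum]

theorem coeff_monicOfCoeffs (a : Fin g → S) (j : Fin g) :
    (monicOfCoeffs a).coeff (g - 1 - (j : ℕ)) = a j := by
  have := j.2
  rw [monicOfCoeffs, coeff_add, coeff_X_pow, if_neg (by omega), zero_add, finsetSum_coeff]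
  rw [Finset.sum_eq_single j]
  · simp
  · intro i _ hi
    have := i.2
    rw [coeff_C_mul, coeff_X_pow, if_neg (fun h => hi (Fin.ext (by omega))), mul_zero]
  · simp

theorem degree_sum_lt (a : Fin g → S) :
    (∑ j : Fin g, C (a j) * X ^ (g - 1 - (j : ℕ)) : S[X]).degree < (g : WithBot ℕ) := by
  refine mem_degreeLT.mp (Submodule.sum_mem _ fun j _ => mem_degreeLT.mpr ?_)
  refine (degree_C_mul_X_pow_le _ _).trans_lt ?_
  have := j.2
  exact_mod_cast (by omega : g - 1 - (j : ℕ) < g)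

theorem monic_monicOfCoeffs (a : Fin g → S) : (monicOfCoeffs a).Monic :=
  monic_X_pow_add (degree_sum_lt a)

theorem natDegree_monicOfCoeffs [Nontrivial S] (a : Fin g → S) :
    (monicOfCoeffs a).natDegree = g := by
  have h : (monicOfCoeffs a).degree = g := by
    rw [monicOfCoeffs, degree_add_eq_left_of_degree_lt, degree_X_pow]
    rw [degree_X_pow]
    exact degree_sum_lt a
  exact natDegree_eq_of_degree_eq_some h

theorem monicOfCoeffs_coeff {R : S[X]} (hR : R.Monic) (hd : R.natDegree = g) :
    (monicOfCoeffs fun j : Fin g => R.coeff (g - 1 - (j : ℕ))) = R := by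
  nontriviality S
  ext i
  rcases lt_trichotomy i g with h | h | h
  · have h1 := coeff_monicOfCoeffs (fun j : Fin g => R.coeff (g - 1 - (j : ℕ)))
      ⟨g - 1 - i, by omega⟩
    simp only [show g - 1 - (g - 1 - i) = i by omega] at h1
    exact h1
  · have h1 := monic_monicOfCoeffs fun j : Fin g => R.coeff (g - 1 - (j : ℕ))
    rw [Monic, leadingCoeff, natDegree_monicOfCoeffs] at h1
    rw [Monic, leadingCoeff, hd] at hR
    rw [h, h1, hR]
  · rw [coeff_eq_zero_of_natDegree_lt (by rwa [natDegree_monicOfCoeffs]),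
      coeff_eq_zero_of_natDegree_lt (by rwa [hd])]

theorem map_discriminantEquation {B : Type*} [CommRing B]
    (φ : MvPolynomial (ParamVar g) B →+* S) :
    φ (MvPolynomial.X .w * ((genericPoly g B).resultant (genericPoly g B).derivative g (g - 1) *
        (genericPoly g B).coeff 0) - 1) =
      φ (MvPolynomial.X .w) * (((genericPoly g B).map φ).resultant
        ((genericPoly g B).map φ).derivative g (g - 1) * ((genericPoly g B).map φ).coeff 0) - 1 := by
  rw [map_sub φ, map_one φ, map_mul φ, map_mul φ, derivative_map, coeff_map, resultant_map_map]

theorem map_pfaffianEquation {B : Type*} [CommRing B] (T : ClassicalType) (c : ℕ)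
    (φ : MvPolynomial (ParamVar g) B →+* S) :
    φ (T.pfaffianEquation c g B) = 0 ↔ match T with
      | .evenOrthogonal =>
        φ (MvPolynomial.X .v) ^ 2 = (-1) ^ c * ((genericPoly g B).map φ).coeff 0
      | .oddOrthogonal => φ (MvPolynomial.X .v) = 0
      | .symplectic => φ (MvPolynomial.X .v) = 0 := by
  cases T
  · rfl
  · rfl
  · simp only [ClassicalType.pfaffianEquation]
    rw [map_sub φ, sub_eq_zero, map_pow φ, map_mul φ, map_pow φ, map_neg φ, map_one φ, coeff_map]

end MonicOfCoeffs

/-- The resultant is formed with the nominal degree `g - 1` of the derivative, which may exceed the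
true degree. As `R` is monic, this does not change its value. -/
theorem resultant_derivative_ne_zero_iff {R : k[X]} {g : ℕ} (hR : R.Monic) (hd : R.natDegree = g) :
    R.resultant R.derivative g (g - 1) ≠ 0 ↔ R.Separable := by
  have h1 : R.derivative.natDegree ≤ g - 1 := hd ▸ natDegree_derivative_le R
  have h2 := resultant_add_right_deg (f := R) (g := R.derivative) (m := g)
    (n := R.derivative.natDegree) (g - 1 - R.derivative.natDegree) le_rfl
  have hl : R.coeff g = 1 := by rw [← hd]; exact hR
  rw [hl, one_pow, one_mul, show R.derivative.natDegree + (g - 1 - R.derivative.natDegree) = g - 1 by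
    omega] at h2
  rw [h2, ← hd, Ne, resultant_eq_zero_iff, Separable]
  simp [hR.ne_zero]

/-- The value of a point at a coordinate. -/
abbrev paramEval (s : T.ParamPoint c r M k) :
    MvPolynomial (ParamVar (redDegree c r)) (Localization.Away (M : ℤ)) →+* k :=
  s.comp (Ideal.Quotient.mk (T.paramIdeal c r (Localization.Away (M : ℤ))))

theorem paramPoly_eq (s : T.ParamPoint c r M k) :
    paramPoly s = monicOfCoeffs fun j => paramEval s (MvPolynomial.X (ParamVar.a j)) :=
  map_genericPoly _

theorem paramEval_eq_zero (s : T.ParamPoint c r M k)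
    {f : MvPolynomial (ParamVar (redDegree c r)) (Localization.Away (M : ℤ))}
    (hf : f ∈ T.paramIdeal c r (Localization.Away (M : ℤ))) : paramEval s f = 0 := by
  rw [paramEval, RingHom.comp_apply, Ideal.Quotient.eq_zero_iff_mem.mpr hf, map_zero]

theorem paramEval_inverse (s : T.ParamPoint c r M k) :
    paramEval s (MvPolynomial.X .w) *
      ((paramPoly s).resultant (paramPoly s).derivative (redDegree c r) (redDegree c r - 1) *
        (paramPoly s).coeff 0) = 1 := by
  have h := paramEval_eq_zero s (Ideal.subset_span (Or.inr (Or.inr rfl)))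
  rw [map_discriminantEquation] at h
  exact sub_eq_zero.mp h

theorem paramEval_pfaffianEquation (s : T.ParamPoint c r M k) :
    paramEval s (T.pfaffianEquation c (redDegree c r) (Localization.Away (M : ℤ))) = 0 :=
  paramEval_eq_zero s (Ideal.subset_span (Or.inr (Or.inl rfl)))

theorem isParam_of_paramPoint (s : T.ParamPoint c r M k) :
    IsParam T c r (paramPoly s) (paramPfaffian s) := by
  have hmon : (paramPoly s).Monic := by rw [paramPoly_eq]; exact monic_monicOfCoeffs _
  have hdeg : (paramPoly s).natDegree = redDegree c r := by
    rw [paramPoly_eq]; exact natDegree_monicOfCoeffs _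
  have hinv := paramEval_inverse s
  have hne := right_ne_zero_of_mul (hinv.trans_ne one_ne_zero)
  refine ⟨hmon, hdeg, ?_, right_ne_zero_of_mul hne, ?_, ?_⟩
  · exact (resultant_derivative_ne_zero_iff hmon hdeg).mp (left_ne_zero_of_mul hne)
  · intro hodd i hi
    rcases lt_or_ge i (redDegree c r) with h | h
    · have h1 := coeff_monicOfCoeffs (fun j => paramEval s (MvPolynomial.X (ParamVar.a j)))
        ⟨redDegree c r - 1 - i, by omega⟩
      simp only [show redDegree c r - 1 - (redDegree c r - 1 - i) = i by omega] at h1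
      rw [paramPoly_eq, h1]
      refine paramEval_eq_zero s (Ideal.subset_span (Or.inl ⟨hodd, _, ?_, rfl⟩))
      obtain ⟨a, ha⟩ := hi
      exact ⟨a - i, by simp only; omega⟩
    · rcases h.eq_or_lt with h | h
      · rw [h] at hi; exact absurd hi (by simp)
      · exact coeff_eq_zero_of_natDegree_lt (by omega)
  · exact (map_pfaffianEquation T c (paramEval s)).mp (paramEval_pfaffianEquation s)

/-- The coordinate `w` is determined as an inverse, and a ring homomorphism from a localization of
the integers is unique. -/
theorem paramPoint_ext {s s' : T.ParamPoint c r M k} (h : paramPoly s = paramPoly s')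
    (h' : paramPfaffian s = paramPfaffian s') : s = s' := by
  apply Ideal.Quotient.ringHom_ext
  apply MvPolynomial.ringHom_ext
  · intro x
    have : (paramEval s).comp MvPolynomial.C = (paramEval s').comp MvPolynomial.C :=
      IsLocalization.ringHom_ext (Submonoid.powers (M : ℤ)) (Subsingleton.elim _ _)
    exact DFunLike.congr_fun this x
  · intro i
    cases i with
    | a j =>
      have h1 := congrArg (fun p => p.coeff (redDegree c r - 1 - (j : ℕ))) h
      simp only [paramPoly_eq, coeff_monicOfCoeffs] at h1
      exact h1
    | v => exact h'
    | w =>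
      have h1 := paramEval_inverse s
      have h2 := paramEval_inverse s'
      rw [← h] at h2
      exact mul_right_cancel₀ (right_ne_zero_of_mul (h1.trans_ne one_ne_zero)) (h1.trans h2.symm)

theorem exists_paramPoint (hM : (M : k) ≠ 0) {R : k[X]} {v : k} (h : IsParam T c r R v) :
    ∃ s : T.ParamPoint c r M k, paramPoly s = R ∧ paramPfaffian s = v := by
  have hu : IsUnit (Int.castRingHom k (M : ℤ)) := by simpa using hM.isUnit
  let φ0 : Localization.Away (M : ℤ) →+* k := IsLocalization.Away.lift (M : ℤ) hu
  let D : k := R.resultant R.derivative (redDegree c r) (redDegree c r - 1) * R.coeff 0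
  have hD : D ≠ 0 := mul_ne_zero
    ((resultant_derivative_ne_zero_iff h.monic h.natDegree_eq).mpr h.separable)
    h.coeff_zero_ne_zero
  let val : ParamVar (redDegree c r) → k := fun i => match i with
    | .a j => R.coeff (redDegree c r - 1 - (j : ℕ))
    | .v => v
    | .w => D⁻¹
  let φ := MvPolynomial.eval₂Hom φ0 val
  have hφa : ∀ j, φ (MvPolynomial.X (.a j)) = R.coeff (redDegree c r - 1 - (j : ℕ)) := fun j =>
    MvPolynomial.eval₂Hom_X' _ _ _
  have hφv : φ (MvPolynomial.X .v) = v := MvPolynomial.eval₂Hom_X' _ _ _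
  have hφw : φ (MvPolynomial.X .w) = D⁻¹ := MvPolynomial.eval₂Hom_X' _ _ _
  have hmap : (genericPoly (redDegree c r) (Localization.Away (M : ℤ))).map φ = R := by
    rw [map_genericPoly]
    simp only [hφa]
    exact monicOfCoeffs_coeff h.monic h.natDegree_eq
  have hker : ∀ f ∈ T.paramIdeal c r (Localization.Away (M : ℤ)), φ f = 0 := by
    intro f hf
    rw [← RingHom.mem_ker]
    refine (Ideal.span_le.mpr ?_) hf
    rintro f (⟨hodd, j, hj, rfl⟩ | rfl | rfl)
    · rw [SetLike.mem_coe, RingHom.mem_ker, hφa]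
      have := j.2
      apply h.coeff_eq_zero hodd
      obtain ⟨a, ha⟩ := hj
      exact ⟨redDegree c r - 1 - a, by omega⟩
    · rw [SetLike.mem_coe, RingHom.mem_ker, map_pfaffianEquation, hmap, hφv]
      exact h.pfaffian_eq
    · rw [SetLike.mem_coe, RingHom.mem_ker, map_discriminantEquation, hmap, hφw]
      exact sub_eq_zero.mpr (inv_mul_cancel₀ hD)
  refine ⟨Ideal.Quotient.lift _ φ hker, ?_, ?_⟩
  · rw [paramPoly, Ideal.Quotient.lift_comp_mk, hmap]
  · rw [paramPfaffian, Ideal.Quotient.lift_mk, hφv]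

end ParamPoint

/-! ### Characteristic polynomials in the classical algebras -/

section FormPoly

variable {T : ClassicalType} {m d : ℕ} {K : Type*} [Field K]

/-- The polynomials `f / λ^m` for regular semisimple elements of the classical algebras. -/
structure IsFormPoly (m : ℕ) (P : K[X]) : Prop where
  monic : P.Monic
  natDegree_eq : P.natDegree = 2 * m
  separable : P.Separable
  coeff_zero_ne_zero : P.coeff 0 ≠ 0
  coeff_eq_zero : ∀ i, Odd i → P.coeff i = 0

/-- The characteristic polynomial with nonzero part `P`. -/
def ClassicalType.fullPoly (T : ClassicalType) (P : K[X]) : K[X] :=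
  match T with
  | .oddOrthogonal => X * P
  | .symplectic => P
  | .evenOrthogonal => P

theorem nonzeroPart_of_coeff_ne_zero {f : K[X]} (h : f.coeff 0 ≠ 0) : nonzeroPart f = f := by
  have : f.rootMultiplicity 0 = 0 := rootMultiplicity_eq_zero (by
    rwa [IsRoot.def, ← coeff_zero_eq_eval_zero])
  rw [nonzeroPart, this, pow_zero, divByMonic_one]

theorem nonzeroPart_X_mul {f : K[X]} (h : f.coeff 0 ≠ 0) : nonzeroPart (X * f) = f := by
  have hf : f ≠ 0 := fun h0 => h (by rw [h0, coeff_zero])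
  have h0 : f.rootMultiplicity 0 = 0 := rootMultiplicity_eq_zero (by
    rwa [IsRoot.def, ← coeff_zero_eq_eval_zero])
  have h1 : (X : K[X]).rootMultiplicity 0 = 1 := by
    have := rootMultiplicity_X_sub_C_self (x := (0 : K))
    rwa [C_0, sub_zero] at this
  have : (X * f).rootMultiplicity 0 = 1 := by
    rw [rootMultiplicity_mul (mul_ne_zero X_ne_zero hf), h0, h1]
  rw [nonzeroPart, this, pow_one, mul_divByMonic_cancel_left f monic_X]

theorem nonzeroPart_fullPoly {P : K[X]} (h : P.coeff 0 ≠ 0) : nonzeroPart (T.fullPoly P) = P := by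
  cases T
  · exact nonzeroPart_X_mul h
  · exact nonzeroPart_of_coeff_ne_zero h
  · exact nonzeroPart_of_coeff_ne_zero h

theorem separable_fullPoly {P : K[X]} (h : IsFormPoly m P) : (T.fullPoly P).Separable := by
  cases T
  · refine Separable.mul separable_X h.separable ?_
    rw [Polynomial.irreducible_X.coprime_iff_not_dvd, X_dvd_iff]
    exact h.coeff_zero_ne_zero
  · exact h.separable
  · exact h.separable

theorem monic_fullPoly {P : K[X]} (h : IsFormPoly m P) : (T.fullPoly P).Monic := by
  cases T
  · exact monic_X.mul h.monic
  · exact h.monic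
  · exact h.monic

theorem natDegree_fullPoly {P : K[X]} (h : IsFormPoly m P) : (T.fullPoly P).natDegree = T.dim m := by
  cases T
  · change (X * P).natDegree = 2 * m + 1
    rw [natDegree_X_mul h.monic.ne_zero, h.natDegree_eq]
  · exact h.natDegree_eq
  · exact h.natDegree_eq

/-- The sign of transposition of the form. -/
def ClassicalType.sign (T : ClassicalType) : ℤˣ :=
  match T with
  | .oddOrthogonal => 1
  | .symplectic => -1
  | .evenOrthogonal => 1

theorem formSign_rev {ε : Fin d → ℤˣ} (hd : d = T.dim m) (hε : T.IsFormSign ε) (i : Fin d) :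
    ε i.rev = T.sign * ε i := by
  cases T
  · exact (hε i).trans (one_mul _).symm
  · change d = 2 * m at hd
    have h : ∀ i : Fin d, ε i = if i < i.rev then 1 else -1 := hε
    change _ = -1 * ε i
    rw [h, h, Fin.rev_rev]
    have hne : i ≠ i.rev := fun h => by
      have h := congrArg Fin.val h
      rw [Fin.val_rev] at h; have := i.2; omega
    rcases lt_or_gt_of_ne hne with h1 | h1
    · rw [if_neg (not_lt.mpr (le_of_lt h1)), if_pos h1]; rfl
    · rw [if_pos h1, if_neg (not_lt.mpr (le_of_lt h1))]; rfl
  · exact (hε i).trans (one_mul _).symm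

theorem even_of_sign (hd : d = T.dim m) (h : T.sign = -1) : Even d := by
  cases T
  · exact absurd h (by decide)
  · exact ⟨m, by rw [hd]; change 2 * m = _; omega⟩
  · exact ⟨m, by rw [hd]; change 2 * m = _; omega⟩

theorem natCast_ne_zero_of_factorial {N j : ℕ} (h : ((N.factorial : ℕ) : K) ≠ 0) (hj : 0 < j)
    (hjN : j ≤ N) : (j : K) ≠ 0 := by
  obtain ⟨a, ha⟩ := Nat.dvd_factorial hj hjN
  rw [ha, Nat.cast_mul] at h
  exact left_ne_zero_of_mul h

theorem pfaffianConst_ne_zero {N m : ℕ} (h : ((N.factorial : ℕ) : K) ≠ 0) (hm : m ≤ N) (h2 : 2 ≤ N) :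
    ((2 ^ m * m.factorial : ℕ) : K) ≠ 0 := by
  obtain ⟨a, ha⟩ := Nat.factorial_dvd_factorial hm
  have h3 := natCast_ne_zero_of_factorial h two_pos h2
  rw [ha, Nat.cast_mul] at h
  rw [Nat.cast_mul, Nat.cast_pow]
  exact mul_ne_zero (pow_ne_zero _ h3) (left_ne_zero_of_mul h)

variable {ε : Fin d → ℤˣ} {X X' : Matrix (Fin d) (Fin d) K}

theorem two_ne_zero_of_factorial (hm : 0 < m) (hK : (((2 * m + 1).factorial : ℕ) : K) ≠ 0) :
    (2 : K) ≠ 0 := by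
  have := natCast_ne_zero_of_factorial hK two_pos (by omega)
  exact_mod_cast this

/-- The characteristic polynomial has the parity of `d`. In even dimension a root `0` would
therefore be a double root, against separability; in odd dimension `0` is a root, and a simple one.
-/
theorem isFormPoly_of_separable (hd : d = T.dim m) (h2 : (2 : K) ≠ 0)
    (hX : X ∈ (MatAlg.form ε).lie K) (hsep : X.charpoly.Separable) :
    IsFormPoly m (nonzeroPart X.charpoly) ∧ X.charpoly = T.fullPoly (nonzeroPart X.charpoly) := by
  have hmon := Matrix.charpoly_monic X
  have hdeg : X.charpoly.natDegree = d := by simp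
  have heven : d = 2 * m → IsFormPoly m X.charpoly := by
    intro hdm
    have hodd : ∀ i, Odd i → X.charpoly.coeff i = 0 := fun i ⟨a, ha⟩ =>
      charpoly_coeff_eq_zero h2 hX ⟨m + a, by omega⟩
    refine ⟨hmon, by omega, hsep, fun h0 => ?_, hodd⟩
    have hdvd : (Polynomial.X : K[X]) ^ 2 ∣ X.charpoly := X_pow_dvd_iff.mpr fun i hi => by
      interval_cases i
      · exact h0
      · exact hodd 1 odd_one
    rw [sq] at hdvd
    exact not_isUnit_X (hsep.squarefree _ hdvd)
  cases T
  · change d = 2 * m + 1 at hd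
    have hz : ∀ i, Even i → X.charpoly.coeff i = 0 := fun i ⟨a, ha⟩ =>
      charpoly_coeff_eq_zero h2 hX ⟨m + a, by omega⟩
    obtain ⟨Q, hQ⟩ := X_dvd_iff.mpr (hz 0 ⟨0, rfl⟩)
    have hcop : IsCoprime (Polynomial.X : K[X]) Q := by
      rw [hQ] at hsep; exact hsep.isCoprime
    have hQ0 : Q.coeff 0 ≠ 0 := by
      rw [Polynomial.irreducible_X.coprime_iff_not_dvd, X_dvd_iff] at hcop
      exact hcop
    have hnz : nonzeroPart X.charpoly = Q := by rw [hQ, nonzeroPart_X_mul hQ0]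
    have hQm : Q.Monic := monic_X.of_mul_monic_left (by rw [← hQ]; exact hmon)
    refine ⟨?_, by rw [hnz]; exact hQ⟩
    rw [hnz]
    refine ⟨hQm, ?_, ?_, hQ0, fun i ⟨a, ha⟩ => ?_⟩
    · have := hdeg
      rw [hQ, natDegree_X_mul hQm.ne_zero] at this
      omega
    · rw [hQ] at hsep; exact hsep.of_mul_right
    · have := hz (i + 1) ⟨a + 1, by omega⟩
      rwa [hQ, coeff_X_mul] at this
  · have h := heven hd
    rw [nonzeroPart_of_coeff_ne_zero h.coeff_zero_ne_zero]
    exact ⟨h, rfl⟩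
  · have h := heven hd
    rw [nonzeroPart_of_coeff_ne_zero h.coeff_zero_ne_zero]
    exact ⟨h, rfl⟩

theorem separable_of_isRegularSemisimple (hd : d = T.dim m) (h2 : (2 : K) ≠ 0)
    (hε : T.IsFormSign ε) (hX : X ∈ (MatAlg.form ε).lie K)
    (hreg : (MatAlg.form ε).IsRegularSemisimple X)
    (h0 : T = .evenOrthogonal → (geom X).charpoly.rootMultiplicity 0 ≤ 1) :
    X.charpoly.Separable := by
  refine separable_of_isRegularSemisimple_form h2 (formSign_rev hd hε) hX hreg ?_
  intro hs hev
  cases T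
  · change d = 2 * m + 1 at hd
    obtain ⟨a, ha⟩ := hev
    omega
  · exact absurd hs (by decide)
  · exact h0 rfl

theorem isRegularSemisimple_of_separable (hd : d = T.dim m) (h2 : (2 : K) ≠ 0)
    (hε : T.IsFormSign ε) (hX : X ∈ (MatAlg.form ε).lie K) (hsep : X.charpoly.Separable) :
    (MatAlg.form ε).IsRegularSemisimple X :=
  isRegularSemisimple_form_of_separable h2 (even_of_sign hd) (formSign_rev hd hε) hX hsep

theorem pfaffian_sq_eq_coeff_zero {ε : Fin d → ℤˣ} (hd : d = 2 * m) (hm : 0 < m)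
    (hK : (((2 * m + 1).factorial : ℕ) : K) ≠ 0)
    (hε : ∀ i, ε i.rev = ε i) (hX : X ∈ (MatAlg.form ε).lie K) (hsep : X.charpoly.Separable) :
    pfaffian (skewDiag ε K * X) ^ 2 = (-1) ^ m * X.charpoly.coeff 0 := by
  rw [pfaffian_sq_eq_det hd (pfaffianConst_ne_zero hK (by omega) (by omega))
    (two_ne_zero_of_factorial hm hK) hε hX hsep, Matrix.det_eq_sign_charpoly_coeff,
    Fintype.card_fin, (show Even d from ⟨m, by omega⟩).neg_one_pow, one_mul]

theorem exists_mem_lie_form (hd : d = T.dim m) (hm : 0 < m)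
    (hK : (((2 * m + 1).factorial : ℕ) : K) ≠ 0) (hε : T.IsFormSign ε) {P : K[X]}
    (hP : IsFormPoly m P) {v : K} (hv : T = .evenOrthogonal → v ^ 2 = (-1) ^ m * P.coeff 0) :
    ∃ X ∈ (MatAlg.form ε).lie K, X.charpoly = T.fullPoly P ∧
      (T = .evenOrthogonal → pfaffian (skewDiag ε K * X) = v) := by
  have h2 := two_ne_zero_of_factorial hm hK
  have hmon := monic_fullPoly (T := T) hP
  have hdeg := (natDegree_fullPoly (T := T) hP).trans hd.symm
  have hrev := formSign_rev hd hε
  cases T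
  · obtain ⟨X, hX, hXP⟩ := exists_mem_lie_oddOrthogonal h2 hd hε hmon hdeg (fun k hk => by
      rw [ClassicalType.fullPoly]
      rcases k with _ | k
      · simp
      · rw [coeff_X_mul]
        exact hP.coeff_eq_zero k (by
          obtain ⟨a, ha⟩ := hk
          exact ⟨a - 1, by omega⟩))
    exact ⟨X, hX, hXP, fun h => by cases h⟩
  · obtain ⟨X, hX, hXP⟩ := exists_mem_lie_symplectic h2 hm hd hrev hmon hdeg hP.coeff_eq_zero
    exact ⟨X, hX, hXP, fun h => by cases h⟩
  · have hv0 : v ≠ 0 := fun h => by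
      have := hv rfl
      rw [h, zero_pow two_ne_zero] at this
      exact mul_ne_zero (pow_ne_zero _ (neg_ne_zero.mpr one_ne_zero)) hP.coeff_zero_ne_zero this.symm
    obtain ⟨X, hX, hXP, hpf⟩ := exists_mem_lie_evenOrthogonal h2 hm
      (pfaffianConst_ne_zero hK (by omega) (by omega)) hd hε hmon hdeg hP.coeff_eq_zero
      hP.separable (hv rfl) hv0
    exact ⟨X, hX, hXP, fun _ => hpf⟩

theorem stablyConj_form (hd : d = T.dim m) (hm : 0 < m)
    (hK : (((2 * m + 1).factorial : ℕ) : K) ≠ 0) (hε : T.IsFormSign ε)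
    (hX : X ∈ (MatAlg.form ε).lie K) (hX' : X' ∈ (MatAlg.form ε).lie K)
    (hsep : X.charpoly.Separable) (hch : X.charpoly = X'.charpoly)
    (hpf : T = .evenOrthogonal →
      pfaffian (skewDiag ε K * X) = pfaffian (skewDiag ε K * X')) :
    (MatAlg.form ε).StablyConj X X' := by
  have h2 := two_ne_zero_of_factorial hm hK
  have hrev := formSign_rev hd hε
  have hfp := isFormPoly_of_separable hd h2 hX hsep
  have hK' := pfaffianConst_ne_zero hK (m := m) (by omega) (by omega)
  cases T
  · exact stablyConj_oddOrthogonal ⟨m, hd⟩ h2 hε hX hX' hsep hch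
  · exact stablyConj_symplectic hd hK' h2 hrev hX hX' hsep hch
  · refine stablyConj_evenOrthogonal hd h2 hε hX hX' hsep hch (hpf rfl) fun h0 => ?_
    have hpf2 := pfaffian_sq_eq_coeff_zero hd hm hK hε hX hsep
    rw [h0, zero_pow two_ne_zero] at hpf2
    have h3 : X.charpoly.coeff 0 ≠ 0 := by
      rw [hfp.2]; exact hfp.1.coeff_zero_ne_zero
    exact mul_ne_zero (pow_ne_zero _ (neg_ne_zero.mpr one_ne_zero)) h3 hpf2.symm

end FormPoly

/-! ### The parameter space and the reduced algebra -/

section Reduced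

variable {T : ClassicalType} {c : ℕ} {r : ℚ} {k : Type*} [Field k]

theorem ClassicalType.minRank_pos (T : ClassicalType) : 0 < T.minRank := by
  cases T <;> decide

theorem den_dvd_of_admissible (h : T.Admissible c r) : r.den ∣ 2 * c := by
  cases T
  · exact h
  · exact h
  · exact Dvd.dvd.mul_left h 2

/-- An odd `n` that divides `2c` divides `c`, and the reduced algebra then has rank `m = c / n`.
Since `n` is odd, `(-1)^c = (-1)^m`, so the Pfaffian equations of the two ranks carry the same sign.
-/
theorem exists_rank_of_odd (hc : 0 < c) (h : T.Admissible c r) (hn : Odd r.den) :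
    ∃ m, 0 < m ∧ c = r.den * m ∧ redDegree c r = 2 * m ∧ T.redDim c r = T.dim m := by
  obtain ⟨m, hm⟩ : r.den ∣ c :=
    (Nat.coprime_two_right.mpr hn).dvd_of_dvd_mul_left (den_dvd_of_admissible h)
  have hg : redDegree c r = 2 * m := by
    rw [redDegree, hm, show 2 * (r.den * m) = r.den * (2 * m) by ring,
      Nat.mul_div_cancel_left _ r.den_pos]
  refine ⟨m, Nat.pos_of_ne_zero fun h0 => ?_, hm, hg, ?_⟩
  · rw [h0, mul_zero] at hm; omega
  · cases T
    · rw [ClassicalType.redDim, if_pos hn, hg]; rfl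
    · exact hg
    · exact hg

theorem even_redDegree (h : ClassicalType.evenOrthogonal.Admissible c r) :
    Even (ClassicalType.evenOrthogonal.redDim c r) := by
  obtain ⟨a, ha⟩ := (h : r.den ∣ c)
  refine ⟨a, ?_⟩
  change redDegree c r = _
  rw [redDegree, ha, show 2 * (r.den * a) = r.den * (a + a) by ring,
    Nat.mul_div_cancel_left _ r.den_pos]

theorem redDim_of_even (hn : ¬ Odd r.den) : T.redDim c r = redDegree c r := by
  cases T
  · rw [ClassicalType.redDim, if_neg hn]
  · rfl
  · rfl

theorem factorial_ne_zero_of_le {N N' : ℕ} (h : ((N.factorial : ℕ) : k) ≠ 0) (hN : N' ≤ N) :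
    ((N'.factorial : ℕ) : k) ≠ 0 := by
  obtain ⟨a, ha⟩ := Nat.factorial_dvd_factorial hN
  rw [ha, Nat.cast_mul] at h
  exact left_ne_zero_of_mul h

theorem neg_one_pow_of_odd {R : Type*} [Ring R] {n m : ℕ} (hn : Odd n) :
    (-1 : R) ^ (n * m) = (-1) ^ m := by
  rw [pow_mul, hn.neg_one_pow]

variable {η : Fin (T.redDim c r) → ℤˣ}

theorem redAlg_of_odd (hn : Odd r.den) : T.redAlg c r η = .form η := if_pos hn

theorem redAlg_of_even (hn : ¬ Odd r.den) : T.redAlg c r η = .gl := if_neg hn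

theorem det_ne_zero_of_even (hn : ¬ Odd r.den)
    {x : Matrix (Fin (T.redDim c r)) (Fin (T.redDim c r)) k} (h : T.DetCondition c r x) :
    x.det ≠ 0 := by
  cases T
  · exact h (Nat.not_odd_iff_even.mp hn)
  · exact h (Nat.not_odd_iff_even.mp hn)
  · exact h

theorem det_ne_zero_iff_coeff_zero {d : ℕ} {x : Matrix (Fin d) (Fin d) k} :
    x.det ≠ 0 ↔ x.charpoly.coeff 0 ≠ 0 := by
  rw [Matrix.det_eq_sign_charpoly_coeff]
  exact (mul_ne_zero_iff_left (pow_ne_zero _ (neg_ne_zero.mpr one_ne_zero)))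

theorem redElement_separable (hc : 0 < c) (hadm : T.Admissible c r)
    (hM : (((2 * c + 1).factorial : ℕ) : k) ≠ 0) (hη : T.IsFormSign η)
    (y : RedElement T c r η k) : y.x.charpoly.Separable := by
  by_cases hn : Odd r.den
  · obtain ⟨m, hm, hcm, hg, hd⟩ := exists_rank_of_odd hc hadm hn
    have hmem := y.mem
    have hreg := y.regular
    rw [redAlg_of_odd hn] at hmem hreg
    refine separable_of_isRegularSemisimple hd (two_ne_zero_of_factorial hc hM) hη hmem hreg ?_
    intro hT
    have hdet : y.x.det ≠ 0 := by
      subst hT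
      exact y.det_ne_zero
    rw [det_ne_zero_iff_coeff_zero] at hdet
    rw [geom_charpoly]
    refine (rootMultiplicity_eq_zero ?_).le.trans zero_le_one
    rw [IsRoot.def, ← coeff_zero_eq_eval_zero, coeff_map]
    exact (_root_.map_ne_zero _).mpr hdet
  · have hreg := y.regular
    rw [redAlg_of_even hn, isRegularSemisimple_gl_iff] at hreg
    exact hreg

theorem isParam_of_redElement (hc : 0 < c) (hadm : T.Admissible c r)
    (hM : (((2 * c + 1).factorial : ℕ) : k) ≠ 0) (hη : T.IsFormSign η)
    (y : RedElement T c r η k) : IsParam T c r (nonzeroPart y.x.charpoly) y.v := by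
  have hsep := redElement_separable hc hadm hM hη y
  by_cases hn : Odd r.den
  · obtain ⟨m, hm, hcm, hg, hd⟩ := exists_rank_of_odd hc hadm hn
    have hmem := y.mem
    rw [redAlg_of_odd hn] at hmem
    obtain ⟨h1, h2⟩ := isFormPoly_of_separable hd (two_ne_zero_of_factorial hc hM) hmem hsep
    refine ⟨h1.monic, h1.natDegree_eq.trans hg.symm, h1.separable, h1.coeff_zero_ne_zero,
      fun _ i hi => h1.coeff_eq_zero i ?_, ?_⟩
    · rw [hg] at hi
      obtain ⟨a, ha⟩ := hi
      exact ⟨a - m, by omega⟩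
    · have hdat := y.datum
      cases T
      · exact hdat
      · exact hdat
      · have hdat : y.v = pfaffian (skewDiag η k * y.x) := by
          rw [ClassicalType.PfaffianDatum, if_pos hn] at hdat; exact hdat
        have h2' : y.x.charpoly = nonzeroPart y.x.charpoly := h2
        have hsgn : (-1 : k) ^ c = (-1) ^ m :=
          (congrArg (fun e => (-1 : k) ^ e) hcm).trans (neg_one_pow_of_odd hn)
        change y.v ^ 2 = (-1) ^ c * (nonzeroPart y.x.charpoly).coeff 0
        rw [← h2', hdat, hsgn]
        refine pfaffian_sq_eq_coeff_zero hd hm (factorial_ne_zero_of_le hM ?_) hη hmem hsep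
        have := Nat.le_mul_of_pos_left m r.den_pos
        omega
  · have hdet := det_ne_zero_of_even hn y.det_ne_zero
    have h0 := det_ne_zero_iff_coeff_zero.mp hdet
    rw [nonzeroPart_of_coeff_ne_zero h0]
    have hdeg : y.x.charpoly.natDegree = redDegree c r := by
      rw [Matrix.charpoly_natDegree_eq_dim, Fintype.card_fin, redDim_of_even hn]
    refine ⟨Matrix.charpoly_monic _, hdeg, hsep, h0, fun h => absurd h hn, ?_⟩
    have hdat := y.datum
    cases T
    · exact hdat
    · exact hdat
    · have hdat : y.v ^ 2 = y.x.det := by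
        rw [ClassicalType.PfaffianDatum, if_neg hn] at hdat; exact hdat
      have hev := Nat.not_odd_iff_even.mp hn
      have hev' := even_redDegree hadm
      -- In the even orthogonal case `n` divides `c`. So for even `n` the sign `(-1)^c` is `1`, and
      -- the equation for `v` becomes `v ^ 2 = det x`.
      have hevc : Even c := hev.trans_dvd hadm
      change y.v ^ 2 = (-1) ^ c * y.x.charpoly.coeff 0
      rw [hdat, Matrix.det_eq_sign_charpoly_coeff, Fintype.card_fin, hev'.neg_one_pow,
        hevc.neg_one_pow]

theorem exists_redElement (hc : 0 < c) (hadm : T.Admissible c r)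
    (hM : (((2 * c + 1).factorial : ℕ) : k) ≠ 0) (hη : T.IsFormSign η) {R : k[X]} {v : k}
    (h : IsParam T c r R v) :
    ∃ y : RedElement T c r η k, nonzeroPart y.x.charpoly = R ∧ y.v = v := by
  by_cases hn : Odd r.den
  · obtain ⟨m, hm, hcm, hg, hd⟩ := exists_rank_of_odd hc hadm hn
    have hR : IsFormPoly m R := ⟨h.monic, h.natDegree_eq.trans hg, h.separable,
      h.coeff_zero_ne_zero, fun i hi => h.coeff_eq_zero hn i (by
        rw [hg]; obtain ⟨a, ha⟩ := hi; exact ⟨m + a, by omega⟩)⟩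
    have hK := factorial_ne_zero_of_le hM (N' := 2 * m + 1) (by
      have := Nat.le_mul_of_pos_left m r.den_pos
      omega)
    obtain ⟨x, hx, hxR, hpf⟩ := exists_mem_lie_form hd hm hK hη hR (v := v) (fun hT => by
      subst hT
      have := h.pfaffian_eq
      rw [hcm, neg_one_pow_of_odd hn] at this
      exact this)
    have hsep : x.charpoly.Separable := by rw [hxR]; exact separable_fullPoly hR
    refine ⟨⟨x, v, by rw [redAlg_of_odd hn]; exact hx, ?_, ?_, ?_⟩, ?_, rfl⟩
    · rw [redAlg_of_odd hn]
      exact isRegularSemisimple_of_separable hd (two_ne_zero_of_factorial hc hM) hη hx hsep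
    · cases T
      · exact fun he => absurd hn (Nat.not_odd_iff_even.mpr he)
      · exact fun he => absurd hn (Nat.not_odd_iff_even.mpr he)
      · refine det_ne_zero_iff_coeff_zero.mpr ?_
        rw [hxR]; exact h.coeff_zero_ne_zero
    · have hv := h.pfaffian_eq
      cases T
      · exact hv
      · exact hv
      · rw [ClassicalType.PfaffianDatum, if_pos hn]; exact (hpf rfl).symm
    · change nonzeroPart x.charpoly = R
      rw [hxR, nonzeroPart_fullPoly h.coeff_zero_ne_zero]
  · obtain ⟨x, hx⟩ := exists_charpoly_eq h.monic (h.natDegree_eq.trans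
      (redDim_of_even (T := T) hn).symm)
    have h0 : x.charpoly.coeff 0 ≠ 0 := by rw [hx]; exact h.coeff_zero_ne_zero
    have hdet := det_ne_zero_iff_coeff_zero.mpr h0
    refine ⟨⟨x, v, by rw [redAlg_of_even hn]; trivial, ?_, ?_, ?_⟩, ?_, rfl⟩
    · rw [redAlg_of_even hn, isRegularSemisimple_gl_iff, hx]; exact h.separable
    · cases T
      · exact fun _ => hdet
      · exact fun _ => hdet
      · exact hdet
    · have hv := h.pfaffian_eq
      cases T
      · exact hv
      · exact hv
      · rw [ClassicalType.PfaffianDatum, if_neg hn]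
        have hev := Nat.not_odd_iff_even.mp hn
        have hev' := even_redDegree hadm
        have hevc : Even c := hev.trans_dvd hadm
        rw [Matrix.det_eq_sign_charpoly_coeff, Fintype.card_fin, hev'.neg_one_pow, hx]
        rw [hevc.neg_one_pow] at hv
        exact hv
    · change nonzeroPart x.charpoly = R
      rw [hx, nonzeroPart_of_coeff_ne_zero h.coeff_zero_ne_zero]

/-- The nonzero part gives back the whole characteristic polynomial: for odd `n` the type fixes the
missing factor, and for even `n` nothing is missing as `det x ≠ 0`. Equality of the Pfaffians, where
it is needed, is contained in `hv`. -/
theorem redElement_stablyConj_iff (hc : 0 < c) (hadm : T.Admissible c r)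
    (hM : (((2 * c + 1).factorial : ℕ) : k) ≠ 0) (hη : T.IsFormSign η)
    (y y' : RedElement T c r η k) (hv : y.v = y'.v) :
    nonzeroPart y.x.charpoly = nonzeroPart y'.x.charpoly ↔
      (T.redAlg c r η).StablyConj y.x y'.x := by
  have hsep := redElement_separable hc hadm hM hη y
  refine ⟨fun h => ?_, fun h => by rw [charpoly_eq_of_stablyConj h]⟩
  by_cases hn : Odd r.den
  · obtain ⟨m, hm, hcm, hg, hd⟩ := exists_rank_of_odd hc hadm hn
    have hmem := y.mem
    have hmem' := y'.mem
    rw [redAlg_of_odd hn] at hmem hmem'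
    rw [redAlg_of_odd hn]
    have h2 := two_ne_zero_of_factorial hc hM
    refine stablyConj_form hd hm (factorial_ne_zero_of_le hM ?_) hη hmem hmem' hsep ?_ ?_
    · have := Nat.le_mul_of_pos_left m r.den_pos
      omega
    · rw [(isFormPoly_of_separable hd h2 hmem hsep).2, h,
        ← (isFormPoly_of_separable hd h2 hmem' (redElement_separable hc hadm hM hη y')).2]
    · intro hT
      subst hT
      have h1 := y.datum
      have h1' := y'.datum
      rw [ClassicalType.PfaffianDatum, if_pos hn] at h1 h1'
      rw [← h1, ← h1', hv]
  · rw [redAlg_of_even hn]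
    refine stablyConj_gl hsep ?_
    rwa [nonzeroPart_of_coeff_ne_zero, nonzeroPart_of_coeff_ne_zero] at h
    · exact det_ne_zero_iff_coeff_zero.mp (det_ne_zero_of_even hn y'.det_ne_zero)
    · exact det_ne_zero_iff_coeff_zero.mp (det_ne_zero_of_even hn y.det_ne_zero)

theorem exists_redElement_classification (hc : 0 < c) (hadm : T.Admissible c r) {M : ℕ}
    (hMc : M = (2 * c + 1).factorial) (hM : (M : k) ≠ 0) (hη : T.IsFormSign η) :
    ∃ χ : RedElement T c r η k → T.ParamPoint c r M k,
      (∀ y, paramPoly (χ y) = nonzeroPart y.x.charpoly ∧ paramPfaffian (χ y) = y.v) ∧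
      Function.Surjective χ ∧
      ∀ y y', χ y = χ y' ↔ (T.redAlg c r η).StablyConj y.x y'.x ∧ y.v = y'.v := by
  have hM' : (((2 * c + 1).factorial : ℕ) : k) ≠ 0 := hMc ▸ hM
  choose χ hχ using fun y : RedElement T c r η k =>
    exists_paramPoint hM (isParam_of_redElement hc hadm hM' hη y)
  refine ⟨χ, hχ, fun s => ?_, fun y y' => ?_⟩
  · obtain ⟨y, hy, hy'⟩ := exists_redElement (η := η) hc hadm hM' hη (isParam_of_paramPoint s)
    exact ⟨y, paramPoint_ext ((hχ y).1.trans hy) ((hχ y).2.trans hy')⟩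
  · constructor
    · intro h
      have hv : y.v = y'.v := by rw [← (hχ y).2, h, (hχ y').2]
      exact ⟨(redElement_stablyConj_iff hc hadm hM' hη y y' hv).mp
        (by rw [← (hχ y).1, h, (hχ y').1]), hv⟩
    · rintro ⟨h, hv⟩
      refine paramPoint_ext ?_ ?_
      · rw [(hχ y).1, (hχ y').1]
        exact (redElement_stablyConj_iff hc hadm hM' hη y y' hv).mpr h
      · rw [(hχ y).2, (hχ y').2, hv]

end Reduced

/-! ### Residues and angular components -/

section Residue

variable {K : Type*} [NontriviallyNormedField K] [IsUltrametricDist K] {x y : K}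

theorem mem_integer_iff : x ∈ 𝒪[K] ↔ ‖x‖ ≤ 1 := Valued.integer.mem_iff

theorem res_coe (x : 𝒪[K]) : res (x : K) = IsLocalRing.residue 𝒪[K] x := by
  rw [res, dif_pos x.2]

theorem res_sub (hx : ‖x‖ ≤ 1) (hy : ‖y‖ ≤ 1) : res (x - y) = res x - res y := by
  lift x to 𝒪[K] using mem_integer_iff.mpr hx
  lift y to 𝒪[K] using mem_integer_iff.mpr hy
  rw [← AddSubgroupClass.coe_sub, res_coe, res_coe, res_coe, map_sub]

theorem res_mul (hx : ‖x‖ ≤ 1) (hy : ‖y‖ ≤ 1) : res (x * y) = res x * res y := by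
  lift x to 𝒪[K] using mem_integer_iff.mpr hx
  lift y to 𝒪[K] using mem_integer_iff.mpr hy
  rw [← Subring.coe_mul, res_coe, res_coe, res_coe, map_mul]

theorem res_pow (hx : ‖x‖ ≤ 1) (n : ℕ) : res (x ^ n) = res x ^ n := by
  lift x to 𝒪[K] using mem_integer_iff.mpr hx
  rw [← Subring.coe_pow, res_coe, res_coe, map_pow]

theorem res_zero : res (0 : K) = 0 := by
  rw [← Subring.coe_zero 𝒪[K], res_coe, map_zero]

theorem res_one : res (1 : K) = 1 := by
  rw [← Subring.coe_one 𝒪[K], res_coe, map_one]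

theorem norm_sub_le_one (hx : ‖x‖ ≤ 1) (hy : ‖y‖ ≤ 1) : ‖x - y‖ ≤ 1 :=
  mem_integer_iff.mp (sub_mem (mem_integer_iff.mpr hx) (mem_integer_iff.mpr hy))

theorem res_eq_zero_iff (hx : ‖x‖ ≤ 1) : res x = 0 ↔ ‖x‖ < 1 := by
  lift x to 𝒪[K] using mem_integer_iff.mpr hx
  rw [res_coe, ← not_iff_not, ← Ne, IsLocalRing.residue_ne_zero_iff_isUnit,
    Valued.integer.isUnit_iff_norm_eq_one, not_lt]
  exact ⟨fun h => h.ge, fun h => le_antisymm hx h⟩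

theorem res_ne_zero_iff (hx : ‖x‖ ≤ 1) : res x ≠ 0 ↔ ‖x‖ = 1 := by
  rw [Ne, res_eq_zero_iff hx, not_lt]
  exact ⟨fun h => le_antisymm hx h, fun h => h.ge⟩

theorem res_eq_res_iff (hx : ‖x‖ ≤ 1) (hy : ‖y‖ ≤ 1) : res x = res y ↔ ‖x - y‖ < 1 := by
  rw [← sub_eq_zero, ← res_sub hx hy, res_eq_zero_iff]
  exact norm_sub_le_one hx hy

theorem exists_res_eq (a : 𝓀[K]) : ∃ x : K, ‖x‖ ≤ 1 ∧ res x = a := by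
  obtain ⟨x, rfl⟩ := IsLocalRing.residue_surjective a
  exact ⟨x, mem_integer_iff.mp x.2, res_coe x⟩

theorem res_natCast (n : ℕ) : res (n : K) = n := by
  have : ((n : 𝒪[K]) : K) = n := by norm_cast
  rw [← this, res_coe, map_natCast]

theorem norm_natCast_le_one (n : ℕ) : ‖(n : K)‖ ≤ 1 := by
  have : ((n : 𝒪[K]) : K) = n := by norm_cast
  rw [← this]
  exact mem_integer_iff.mp (n : 𝒪[K]).2

theorem norm_natCast_eq_one {n : ℕ} (h : (n : 𝓀[K]) ≠ 0) : ‖(n : K)‖ = 1 := by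
  rwa [← res_natCast (K := K), res_ne_zero_iff (norm_natCast_le_one n)] at h

/-! ### Residue fields of extensions -/

section Extension

variable {L : Type*} [NontriviallyNormedField L] [IsUltrametricDist L] [NormedAlgebra K L]

variable (K L) in
/-- The inclusion of the rings of integers. -/
def integerMap : 𝒪[K] →+* 𝒪[L] :=
  ((algebraMap K L).comp 𝒪[K].subtype).codRestrict 𝒪[L] fun x => by
    rw [mem_integer_iff, RingHom.comp_apply, norm_algebraMap']
    exact mem_integer_iff.mp x.2

theorem coe_integerMap (x : 𝒪[K]) : (integerMap K L x : L) = algebraMap K L x := rfl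

instance : IsLocalHom (integerMap K L) where
  map_nonunit x hx := by
    rw [Valued.integer.isUnit_iff_norm_eq_one] at hx ⊢
    have h : ‖(integerMap K L x : L)‖ = 1 := hx
    rwa [coe_integerMap, norm_algebraMap'] at h

variable (K L) in
/-- The inclusion of the residue fields. -/
def residueMap : 𝓀[K] →+* 𝓀[L] := IsLocalRing.ResidueField.map (integerMap K L)

theorem residueMap_res (hx : ‖x‖ ≤ 1) : residueMap K L (res x) = res (algebraMap K L x) := by
  lift x to 𝒪[K] using mem_integer_iff.mpr hx
  rw [← coe_integerMap, res_coe, res_coe]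
  exact IsLocalRing.ResidueField.map_residue _ _

end Extension

/-! ### Valuations and angular components with respect to a uniformizer -/

section Uniformizer

variable {ϖ : 𝒪[K]}

theorem norm_uniformizer_pos (hϖ : Irreducible ϖ) : 0 < ‖(ϖ : K)‖ :=
  Valued.integer.norm_irreducible_pos hϖ

theorem norm_uniformizer_lt_one (hϖ : Irreducible ϖ) : ‖(ϖ : K)‖ < 1 :=
  Valued.integer.norm_irreducible_lt_one hϖ

/-- In a proper space the closed unit ball is compact, and compactness of the ring of integers
characterizes complete discrete valuation rings with finite residue field. -/
theorem isDiscreteValuationRing_and_finite_residueField [ProperSpace K] :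
    IsDiscreteValuationRing 𝒪[K] ∧ Finite 𝓀[K] := by
  let : (Valued.v : Valuation K NNReal).RankOne :=
    inferInstanceAs (Valuation.RankOne (NormedField.valuation (K := K)))
  have h : CompactSpace 𝒪[K] := by
    refine (isCompact_iff_compactSpace (X := K)).mp ?_
    have : (𝒪[K] : Set K) = Metric.closedBall 0 1 := by
      ext x
      rw [mem_closedBall_zero_iff]
      exact mem_integer_iff
    rw [this]
    exact isCompact_closedBall 0 1
  exact (Valued.integer.compactSpace_iff_completeSpace_and_isDiscreteValuationRing_and_finite_residueField.mp
    h).2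

theorem norm_zpow_injective (hϖ : Irreducible ϖ) :
    Function.Injective fun i : ℤ => ‖(ϖ : K)‖ ^ i :=
  (zpow_right_strictAnti₀ (norm_uniformizer_pos hϖ) (norm_uniformizer_lt_one hϖ)).injective

theorem exists_norm_eq_zpow [ProperSpace K] (hϖ : Irreducible ϖ) (hx : x ≠ 0) :
    ∃ i : ℤ, ‖x‖ = ‖(ϖ : K)‖ ^ i := by
  have hdvr := (isDiscreteValuationRing_and_finite_residueField (K := K)).1
  have key : ∀ z : K, z ≠ 0 → ‖z‖ ≤ 1 → ∃ i : ℤ, ‖z‖ = ‖(ϖ : K)‖ ^ i := by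
    intro z hz hz1
    lift z to 𝒪[K] using mem_integer_iff.mpr hz1
    have hz0 : z ≠ 0 := fun h => hz (by rw [h]; rfl)
    obtain ⟨n, u, hu⟩ := IsDiscreteValuationRing.eq_unit_mul_pow_irreducible hz0 hϖ
    refine ⟨n, ?_⟩
    rw [hu, Subring.coe_mul, norm_mul, Subring.coe_pow, norm_pow, Valued.integer.norm_coe_unit,
      one_mul, zpow_natCast]
  rcases le_total ‖x‖ 1 with h | h
  · exact key x hx h
  · obtain ⟨i, hi⟩ := key x⁻¹ (inv_ne_zero hx) (by rw [norm_inv]; exact inv_le_one_of_one_le₀ h)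
    exact ⟨-i, by rw [zpow_neg, ← hi, norm_inv, inv_inv]⟩

theorem ord_eq (hϖ : Irreducible ϖ) {i : ℤ} (h : ‖x‖ = ‖(ϖ : K)‖ ^ i) : ord ϖ x = i := by
  have h' : ∃ i : ℤ, ‖x‖ = ‖(ϖ : K)‖ ^ i := ⟨i, h⟩
  rw [ord, dif_pos h']
  exact norm_zpow_injective hϖ (h'.choose_spec.symm.trans h)

theorem ac_eq (hϖ : Irreducible ϖ) {i : ℤ} (h : ‖x‖ = ‖(ϖ : K)‖ ^ i) :
    ac ϖ x = res (x / (ϖ : K) ^ i) := by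
  rw [ac, ord_eq hϖ h]

theorem norm_div_zpow_le_one (hϖ : Irreducible ϖ) {i : ℤ} (h : ‖x‖ ≤ ‖(ϖ : K)‖ ^ i) :
    ‖x / (ϖ : K) ^ i‖ ≤ 1 := by
  rw [norm_div, norm_zpow]
  exact div_le_one_of_le₀ h (zpow_nonneg (norm_uniformizer_pos hϖ).le i)

/-- Once the valuation is known to be at least `i`, the case distinction disappears: if the
valuation is larger, the residue of the quotient is zero by itself. -/
theorem resAt_eq (hϖ : Irreducible ϖ) {i : ℤ} (h : ‖x‖ ≤ ‖(ϖ : K)‖ ^ i) :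
    resAt ϖ i x = res (x / (ϖ : K) ^ i) := by
  rw [resAt]
  split_ifs with h1
  · exact ac_eq hϖ h1
  · refine ((res_eq_zero_iff (norm_div_zpow_le_one hϖ h)).mpr ?_).symm
    rw [norm_div, norm_zpow, div_lt_one (zpow_pos (norm_uniformizer_pos hϖ) i)]
    exact lt_of_le_of_ne h h1

end Uniformizer

section ResidueCharacteristic

theorem resCard_finite [ProperSpace K] : Finite 𝓀[K] :=
  isDiscreteValuationRing_and_finite_residueField.2

theorem one_lt_resCard [ProperSpace K] : 1 < resCard K := by
  have := resCard_finite (K := K)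
  exact Finite.one_lt_card

theorem ringChar_dvd_resCard [ProperSpace K] : ringChar 𝓀[K] ∣ resCard K := by
  have := resCard_finite (K := K)
  have := Fintype.ofFinite 𝓀[K]
  obtain ⟨p, hp, n, -, hn⟩ := FiniteField.card' 𝓀[K]
  rw [ringChar.eq 𝓀[K] p, resCard, Nat.card_eq_fintype_card, hn]
  exact dvd_pow_self p n.ne_zero

theorem natCast_residue_ne_zero [ProperSpace K] {M : ℕ} (h : Nat.Coprime (resCard K) M) :
    (M : 𝓀[K]) ≠ 0 := by
  intro h0
  have h1 : ringChar 𝓀[K] ∣ M := (ringChar.spec _ _).mp h0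
  have h2 := Nat.eq_one_of_dvd_coprimes h ringChar_dvd_resCard h1
  exact (CharP.ringChar_ne_one (R := 𝓀[K])) h2

end ResidueCharacteristic

end Residue

/-! ### Reduction of a polynomial -/

section Reduction

variable {F : Type*} [NontriviallyNormedField F] [IsUltrametricDist F] {ϖ : 𝒪[F]} {r : ℚ}
  {P : F[X]} {g : ℕ}

/-- In terms of exponents rather than of the index `j = g - i`: the coefficient of `λ^i` in the
reduction comes from that of `λ^(ni)` in `P`. -/
theorem coeff_rReduction (hP : P.natDegree = r.den * g) {i : ℕ} (hi : i < g) :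
    (rReduction ϖ r P).coeff i = resAt ϖ (r.num * (g - i : ℕ)) (P.coeff (r.den * i)) := by
  have hg : P.natDegree / r.den = g := by rw [hP, Nat.mul_div_cancel_left _ r.den_pos]
  rw [rReduction, hg, coeff_add, coeff_X_pow, if_neg hi.ne, zero_add, finsetSum_coeff,
    Finset.sum_eq_single (g - i)]
  · have h1 : P.natDegree - r.den * (g - i) = r.den * i := by
      rw [hP, ← Nat.mul_sub, Nat.sub_sub_self hi.le]
    rw [coeff_C_mul, coeff_X_pow, if_pos (Nat.sub_sub_self hi.le).symm, mul_one, h1]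
  · intro j hj hne
    rw [Finset.mem_Icc] at hj
    rw [coeff_C_mul, coeff_X_pow, if_neg (by omega), mul_zero]
  · intro h
    exact absurd (Finset.mem_Icc.mpr ⟨by omega, by omega⟩) h

theorem coeff_rReduction_self (hP : P.natDegree = r.den * g) :
    (rReduction ϖ r P).coeff g = 1 := by
  have hg : P.natDegree / r.den = g := by rw [hP, Nat.mul_div_cancel_left _ r.den_pos]
  rw [rReduction, hg, coeff_add, coeff_X_pow, if_pos rfl, finsetSum_coeff, Finset.sum_eq_zero,
    add_zero]
  intro j hj
  rw [Finset.mem_Icc] at hj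
  rw [coeff_C_mul, coeff_X_pow, if_neg (by omega), mul_zero]

theorem coeff_rReduction_of_lt (hP : P.natDegree = r.den * g) {i : ℕ} (hi : g < i) :
    (rReduction ϖ r P).coeff i = 0 := by
  have hg : P.natDegree / r.den = g := by rw [hP, Nat.mul_div_cancel_left _ r.den_pos]
  rw [rReduction, hg, coeff_add, coeff_X_pow, if_neg hi.ne', finsetSum_coeff, Finset.sum_eq_zero,
    add_zero]
  intro j hj
  rw [coeff_C_mul, coeff_X_pow, if_neg (by omega), mul_zero]

theorem natDegree_rReduction (hP : P.natDegree = r.den * g) :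
    (rReduction ϖ r P).natDegree = g := by
  refine le_antisymm (natDegree_le_iff_coeff_eq_zero.mpr fun i hi => coeff_rReduction_of_lt hP hi)
    (le_natDegree_of_ne_zero ?_)
  rw [coeff_rReduction_self hP]
  exact one_ne_zero

theorem monic_rReduction (hP : P.natDegree = r.den * g) : (rReduction ϖ r P).Monic := by
  rw [Monic, leadingCoeff, natDegree_rReduction hP, coeff_rReduction_self hP]

theorem rReduction_ext {Q : 𝓀[F][X]} (hP : P.natDegree = r.den * g) (hQ : Q.Monic)
    (hd : Q.natDegree = g)
    (h : ∀ i < g, Q.coeff i = resAt ϖ (r.num * (g - i : ℕ)) (P.coeff (r.den * i))) :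
    rReduction ϖ r P = Q := by
  ext i
  rcases lt_trichotomy i g with hi | rfl | hi
  · rw [coeff_rReduction hP hi, h i hi]
  · rw [coeff_rReduction_self hP, ← hd]; exact hQ.symm
  · rw [coeff_rReduction_of_lt hP hi, coeff_eq_zero_of_natDegree_lt (by omega)]

section Roots

variable {L : Type*} [NontriviallyNormedField L] [IsUltrametricDist L] [NormedAlgebra F L] {y₀ : L}

theorem coeff_prod_X_sub_C_mul {S : Type*} [CommRing S] [IsDomain S] (s : Multiset S) (a : S)
    (i : ℕ) :
    (s.map fun y => X - C (a * y)).prod.coeff i =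
      (s.map fun y => X - C y).prod.coeff i * a ^ (s.card - i) := by
  have h1 : (s.map fun y => X - C (a * y)).prod = ((s.map fun y => X - C y).prod).scaleRoots a := by
    induction s using Multiset.induction_on with
    | empty => simp
    | cons y s ih =>
      rw [Multiset.map_cons, Multiset.prod_cons, ih, Multiset.map_cons, Multiset.prod_cons,
        mul_scaleRoots_of_noZeroDivisors]
      congr 1
      ext i
      rw [coeff_scaleRoots, natDegree_X_sub_C]
      rcases i with _ | _ | i
      · simp [mul_comm]
      · simp
      · simp [coeff_X]
  rw [h1, coeff_scaleRoots, natDegree_multiset_prod_X_sub_C_eq_card]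

theorem norm_eq_of_pow_eq (hy₀ : y₀ ^ r.den = algebraMap F L ((ϖ : F) ^ r.num)) :
    ‖y₀‖ ^ r.den = ‖(ϖ : F)‖ ^ r.num := by
  rw [← norm_pow, hy₀, norm_algebraMap', norm_zpow]

/-- Comparing valuations gives `i n = ℓ k`, and `n` is prime to `ℓ`. -/
theorem den_dvd_of_norm_eq [ProperSpace F] (hϖ : Irreducible ϖ)
    (hy₀ : y₀ ^ r.den = algebraMap F L ((ϖ : F) ^ r.num)) {x : F} {k : ℕ} (hx : x ≠ 0)
    (h : ‖x‖ = ‖y₀‖ ^ k) : r.den ∣ k := by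
  obtain ⟨i, hi⟩ := exists_norm_eq_zpow hϖ hx
  have h1 : ‖(ϖ : F)‖ ^ (i * r.den) = ‖(ϖ : F)‖ ^ (r.num * k) := by
    rw [zpow_mul, ← hi, h, zpow_mul, ← norm_eq_of_pow_eq hy₀, zpow_natCast, zpow_natCast,
      ← pow_mul, ← pow_mul, mul_comm]
  have h2 : i * r.den = r.num * k := norm_zpow_injective hϖ h1
  have h3 : (r.den : ℤ) ∣ r.num * k := ⟨i, by rw [← h2, mul_comm]⟩
  have h4 : IsCoprime (r.den : ℤ) r.num := by
    rw [Int.isCoprime_iff_nat_coprime, Int.natAbs_natCast]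
    exact r.reduced.symm
  exact_mod_cast h4.dvd_of_dvd_mul_left h3

/-- If `P` has the roots `y₀ y` with integral `y`, the residues of the `y` are the roots of
`R (λ ^ n)`, where `R` is the reduction of `P`. -/
theorem prod_res_eq_rReduction [ProperSpace F] (hϖ : Irreducible ϖ)
    (hy₀ : y₀ ^ r.den = algebraMap F L ((ϖ : F) ^ r.num))
    (hP : P.natDegree = r.den * g) {s : Multiset L} (hs : ∀ y ∈ s, ‖y‖ ≤ 1)
    (h : P.map (algebraMap F L) = (s.map fun y => X - C (y₀ * y)).prod) :
    (s.map fun y => X - C (res y)).prod =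
      (expand 𝓀[F] r.den (rReduction ϖ r P)).map (residueMap F L) := by
  have hϖ0 : (ϖ : F) ≠ 0 := norm_pos_iff.mp (norm_uniformizer_pos hϖ)
  have hy0 : y₀ ≠ 0 := by
    rintro rfl
    rw [zero_pow r.den_ne_zero] at hy₀
    exact zpow_ne_zero _ hϖ0 ((_root_.map_eq_zero _).mp hy₀.symm)
  have hcard : s.card = r.den * g := by
    rw [← hP, ← natDegree_map (algebraMap F L), h]
    have := natDegree_multiset_prod_X_sub_C_eq_card (s.map fun y => y₀ * y)
    rw [Multiset.map_map, Multiset.card_map] at this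
    exact this.symm
  have hn := r.den_pos
  set s' := s with hs'
  lift s to Multiset 𝒪[L] using fun y hy => mem_integer_iff.mpr (hs y hy)
  rw [Multiset.card_map] at hcard
  set Q : 𝒪[L][X] := (s.map fun y => X - C y).prod with hQ
  have hred : (s'.map fun y => X - C (res y)).prod = Q.map (IsLocalRing.residue 𝒪[L]) := by
    rw [hQ, hs', Multiset.map_map, Polynomial.map_multiset_prod, Multiset.map_map]
    congr 1
    refine Multiset.map_congr rfl fun y _ => ?_
    simp [res_coe]
  have hQL : (s'.map fun y => X - C y).prod = Q.map 𝒪[L].subtype := by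
    rw [hQ, hs', Multiset.map_map, Polynomial.map_multiset_prod, Multiset.map_map]
    congr 1
    refine Multiset.map_congr rfl fun y _ => ?_
    simp
  -- The polynomial `Q` has the rescaled, integral roots; its coefficients are those of `P` divided
  -- by powers of `y₀`.
  have hcoeff : ∀ i, algebraMap F L (P.coeff i) = (Q.coeff i : L) * y₀ ^ (r.den * g - i) := by
    intro i
    rw [← coeff_map, h, coeff_prod_X_sub_C_mul, hQL, coeff_map, hs', Multiset.card_map, hcard]
    rfl
  have hQnorm : ∀ i, ‖(Q.coeff i : L)‖ ≤ 1 := fun i => mem_integer_iff.mp (Q.coeff i).2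
  rw [hred]
  ext i
  rw [coeff_map, coeff_map, coeff_expand hn]
  have hQmon : Q.Monic := monic_multiset_prod_of_monic _ _ fun y _ => monic_X_sub_C y
  have hQdeg : Q.natDegree = r.den * g := by
    rw [hQ, natDegree_multiset_prod_X_sub_C_eq_card, hcard]
  rcases lt_trichotomy i (r.den * g) with hi | hi | hi
  · split_ifs with hdvd
    · obtain ⟨j, rfl⟩ := hdvd
      have hj : j < g := lt_of_mul_lt_mul_left hi (Nat.zero_le _)
      rw [Nat.mul_div_cancel_left _ hn, coeff_rReduction hP hj]
      have hy : y₀ ^ (r.den * g - r.den * j) =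
          algebraMap F L ((ϖ : F) ^ (r.num * (g - j : ℕ))) := by
        rw [← Nat.mul_sub, pow_mul, hy₀, ← map_pow, zpow_mul, zpow_natCast]
      have hc := hcoeff (r.den * j)
      rw [hy] at hc
      have hne : algebraMap F L ((ϖ : F) ^ (r.num * (g - j : ℕ))) ≠ 0 :=
        (_root_.map_ne_zero _).mpr (zpow_ne_zero _ hϖ0)
      have hle : ‖P.coeff (r.den * j)‖ ≤ ‖(ϖ : F)‖ ^ (r.num * (g - j : ℕ)) := by
        rw [← norm_algebraMap' L, hc, norm_mul, norm_algebraMap', norm_zpow]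
        exact mul_le_of_le_one_left (zpow_nonneg (norm_nonneg _) _) (hQnorm _)
      rw [resAt_eq hϖ hle, residueMap_res (norm_div_zpow_le_one hϖ hle), map_div₀, hc,
        mul_div_cancel_right₀ _ hne, res_coe]
    -- In a degree `i` not divisible by `n`, a unit coefficient of `Q` would give `P` a coefficient
    -- of absolute value `|y₀| ^ (ng - i)`, which is not in the value group of `F`.
    · rw [map_zero, ← res_coe, res_eq_zero_iff (hQnorm i)]
      refine lt_of_le_of_ne (hQnorm i) fun h1 => hdvd ?_
      have hc := congrArg norm (hcoeff i)
      rw [norm_algebraMap', norm_mul, h1, one_mul, norm_pow] at hc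
      have hne : P.coeff i ≠ 0 := by
        rw [← norm_ne_zero_iff, hc]
        exact pow_ne_zero _ (norm_ne_zero_iff.mpr hy0)
      have := den_dvd_of_norm_eq hϖ hy₀ hne hc
      exact (Nat.dvd_sub_iff_right hi.le (dvd_mul_right _ _)).mp this
  · rw [hi, if_pos (dvd_mul_right _ _), Nat.mul_div_cancel_left _ hn, coeff_rReduction_self hP,
      map_one, ← hQdeg, hQmon.coeff_natDegree, map_one]
  · rw [coeff_eq_zero_of_natDegree_lt (by omega), map_zero]
    split_ifs with hdvd
    · obtain ⟨j, rfl⟩ := hdvd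
      rw [Nat.mul_div_cancel_left _ hn,
        coeff_rReduction_of_lt hP (lt_of_mul_lt_mul_left hi (Nat.zero_le _)), map_zero]
    · rw [map_zero]

end Roots

end Reduction

/-! ### Separability of expansions -/

section Expand

variable {k : Type*} [Field k] {n : ℕ} {R : k[X]}

/-- The derivative of `R(λ^n)` is `R'(λ^n)` times `n λ^(n-1)`; `R(λ^n)` is prime to the first factor
by separability, to `n` because it is a unit, and to `λ` because `R(0) ≠ 0`. -/
theorem separable_expand (hn : (n : k) ≠ 0) (hR : R.Separable) (h0 : R.coeff 0 ≠ 0) :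
    (expand k n R).Separable := by
  have hpos : 0 < n := Nat.pos_of_ne_zero fun h => hn (by rw [h, Nat.cast_zero])
  rw [Separable, derivative_expand]
  refine IsCoprime.mul_right ((isCoprime_expand hpos.ne').mpr hR) (IsCoprime.mul_right ?_ ?_)
  · have hu : IsUnit ((n : k[X])) := by
      rw [← C_eq_natCast]; exact (isUnit_C.mpr hn.isUnit)
    exact (isCoprime_one_right.of_isCoprime_of_dvd_right hu.dvd)
  · refine IsCoprime.pow_right ?_
    rw [isCoprime_comm, Polynomial.irreducible_X.coprime_iff_not_dvd, X_dvd_iff,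
      coeff_expand hpos, if_pos (dvd_zero n), Nat.zero_div]
    exact h0

theorem separable_of_separable_expand (hn : 0 < n) (h : (expand k n R).Separable) :
    R.Separable := by
  rw [Separable, derivative_expand] at h
  exact (isCoprime_expand hn.ne').mp h.of_mul_right_left

end Expand

/-! ### The slope condition and equivalence, read off from the reduction -/

section Roots

variable {F : Type*} [NontriviallyNormedField F] [IsUltrametricDist F] [ProperSpace F] {ϖ : 𝒪[F]}
  {r : ℚ} {P P' : F[X]} {g : ℕ}
  {L : Type*} [NontriviallyNormedField L] [IsUltrametricDist L] [NormedAlgebra F L] [IsAlgClosed L]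
  {y₀ : L} {T : ClassicalType}

theorem ne_zero_of_pow_eq (hϖ : Irreducible ϖ)
    (hy₀ : y₀ ^ r.den = algebraMap F L ((ϖ : F) ^ r.num)) : y₀ ≠ 0 := by
  rintro rfl
  rw [zero_pow r.den_ne_zero] at hy₀
  exact zpow_ne_zero _ (norm_pos_iff.mp (norm_uniformizer_pos hϖ))
    ((_root_.map_eq_zero _).mp hy₀.symm)

theorem norm_div_le_one {a : L} (h : ‖a‖ ≤ ‖y₀‖) : ‖a / y₀‖ ≤ 1 := by
  rw [norm_div]
  exact div_le_one_of_le₀ h (norm_nonneg _)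

theorem roots_prod_res (hϖ : Irreducible ϖ)
    (hy₀ : y₀ ^ r.den = algebraMap F L ((ϖ : F) ^ r.num)) (hm : P.Monic)
    (hP : P.natDegree = r.den * g)
    (hs : ∀ a ∈ (P.map (algebraMap F L)).roots, ‖a‖ ≤ ‖y₀‖) :
    ((P.map (algebraMap F L)).roots.map fun a => X - C (res (a / y₀))).prod =
      (expand 𝓀[F] r.den (rReduction ϖ r P)).map (residueMap F L) := by
  have hy := ne_zero_of_pow_eq hϖ hy₀
  rw [← prod_res_eq_rReduction hϖ hy₀ hP (s := (P.map (algebraMap F L)).roots.map (· / y₀)),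
    Multiset.map_map]
  · rfl
  · intro y h
    obtain ⟨a, ha, rfl⟩ := Multiset.mem_map.mp h
    exact norm_div_le_one (hs a ha)
  · rw [Multiset.map_map]
    have h1 := (IsAlgClosed.splits (P.map (algebraMap F L))).eq_prod_roots_of_monic (hm.map _)
    conv_lhs => rw [h1]
    congr 1
    refine Multiset.map_congr rfl fun a _ => ?_
    rw [Function.comp_apply, mul_div_cancel₀ _ hy]

/-- Differences of maximal size mean that the residues of `a / y₀` are distinct, and roots of
maximal size that they are nonzero. They are the roots of `R(λ^n)`. -/
theorem separable_rReduction (hϖ : Irreducible ϖ)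
    (hy₀ : y₀ ^ r.den = algebraMap F L ((ϖ : F) ^ r.num)) (hm : P.Monic)
    (hP : P.natDegree = r.den * g) (hsep : P.Separable)
    (hs : ∀ a ∈ (P.map (algebraMap F L)).roots, ‖a‖ = ‖y₀‖)
    (hd : ∀ a ∈ (P.map (algebraMap F L)).roots, ∀ b ∈ (P.map (algebraMap F L)).roots, a ≠ b →
      ‖a - b‖ = ‖y₀‖) :
    (rReduction ϖ r P).Separable ∧ (rReduction ϖ r P).coeff 0 ≠ 0 := by
  have hy := ne_zero_of_pow_eq hϖ hy₀
  have h := roots_prod_res hϖ hy₀ hm hP fun a ha => (hs a ha).le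
  set s := (P.map (algebraMap F L)).roots with hs_def
  have hs1 : ∀ a ∈ s, ‖a / y₀‖ = 1 := fun a ha => by
    rw [norm_div, hs a ha, div_self (norm_ne_zero_iff.mpr hy)]
  have hnod : s.Nodup := nodup_roots (hsep.map)
  have hnodr : (s.map fun a => res (a / y₀)).Nodup := by
    refine Multiset.Nodup.map_on (fun a ha b hb hab => ?_) hnod
    by_contra hne
    rw [res_eq_res_iff (hs1 a ha).le (hs1 b hb).le, ← sub_div, norm_div, hd a ha b hb hne,
      div_self (norm_ne_zero_iff.mpr hy)] at hab
    exact lt_irrefl _ hab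
  have h' : ((s.map fun a => res (a / y₀)).map fun y => X - C y).prod =
      (expand 𝓀[F] r.den (rReduction ϖ r P)).map (residueMap F L) := by
    rw [Multiset.map_map]; exact h
  constructor
  · refine separable_of_separable_expand r.den_pos ((separable_map (residueMap F L)).mp ?_)
    rw [← h']
    obtain ⟨t, ht⟩ : ∃ t : Finset 𝓀[L], t.val = s.map fun a => res (a / y₀) := ⟨⟨_, hnodr⟩, rfl⟩
    rw [← ht]
    exact separable_prod_X_sub_C_iff'.mpr (fun x _ y _ h => h)
  · intro h0
    have h1 := congrArg (eval 0) h'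
    rw [← coeff_zero_eq_eval_zero (map _ _), coeff_map, coeff_expand r.den_pos,
      if_pos (dvd_zero _), Nat.zero_div, h0, map_zero, eval_multiset_prod, Multiset.map_map,
      Multiset.prod_eq_zero_iff, Multiset.mem_map] at h1
    obtain ⟨y, hy1, hy2⟩ := h1
    obtain ⟨a, ha, rfl⟩ := Multiset.mem_map.mp hy1
    rw [Function.comp_apply, eval_sub, eval_X, eval_C, zero_sub, neg_eq_zero] at hy2
    exact (res_ne_zero_iff (hs1 a ha).le).mpr (hs1 a ha) hy2

/-- The easy half of the Newton polygon: at a larger `a` the leading term would dominate all the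
others. -/
theorem norm_le_of_root (hy : y₀ ≠ 0) (hm : P.Monic)
    (hc : ∀ i < P.natDegree, ‖P.coeff i‖ ≤ ‖y₀‖ ^ (P.natDegree - i)) {a : L}
    (ha : a ∈ (P.map (algebraMap F L)).roots) : ‖a‖ ≤ ‖y₀‖ := by
  by_contra! hlt
  have hev : eval a (P.map (algebraMap F L)) = 0 := (mem_roots'.mp ha).2
  rw [eval_map, eval₂_eq_sum_range, Finset.sum_range_succ, hm.coeff_natDegree, map_one,
    one_mul] at hev
  have hpos : 0 < ‖y₀‖ := norm_pos_iff.mpr hy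
  have hN : 0 < P.natDegree := by
    refine Nat.pos_of_ne_zero fun h0 => ?_
    rw [h0] at hev
    simp at hev
  obtain ⟨i, hi, hle⟩ := IsUltrametricDist.exists_norm_finsetSum_le_of_nonempty
    (Finset.nonempty_range_iff.mpr hN.ne') fun i => algebraMap F L (P.coeff i) * a ^ i
  rw [eq_neg_of_add_eq_zero_left hev, norm_neg, norm_pow, norm_mul, norm_algebraMap',
    norm_pow] at hle
  rw [Finset.mem_range] at hi
  have h1 : ‖P.coeff i‖ * ‖a‖ ^ i ≤ ‖y₀‖ ^ (P.natDegree - i) * ‖a‖ ^ i :=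
    mul_le_mul_of_nonneg_right (hc i hi) (by positivity)
  have h2 : ‖y₀‖ ^ (P.natDegree - i) * ‖a‖ ^ i < ‖a‖ ^ (P.natDegree - i) * ‖a‖ ^ i :=
    mul_lt_mul_of_pos_right (pow_lt_pow_left₀ hlt hpos.le (by omega)) (pow_pos (hpos.trans hlt) _)
  rw [← pow_add, Nat.sub_add_cancel hi.le] at h2
  exact absurd (hle.trans_lt (h1.trans_lt h2)) (lt_irrefl _)

/-- Converse to `separable_rReduction`. As `n` is invertible, `R(λ^n)` is separable too, so the
residues of `a / y₀` are pairwise distinct and nonzero. The roots already exist in `L`, so nothing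
has to be lifted. -/
theorem norm_roots_of_separable (hϖ : Irreducible ϖ)
    (hy₀ : y₀ ^ r.den = algebraMap F L ((ϖ : F) ^ r.num)) (hm : P.Monic)
    (hP : P.natDegree = r.den * g)
    (hs : ∀ a ∈ (P.map (algebraMap F L)).roots, ‖a‖ ≤ ‖y₀‖)
    (hn : (r.den : 𝓀[F]) ≠ 0) (hR : (rReduction ϖ r P).Separable)
    (h0 : (rReduction ϖ r P).coeff 0 ≠ 0) :
    P.Separable ∧ (∀ a ∈ (P.map (algebraMap F L)).roots, ‖a‖ = ‖y₀‖) ∧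
      ∀ a ∈ (P.map (algebraMap F L)).roots, ∀ b ∈ (P.map (algebraMap F L)).roots, a ≠ b →
        ‖a - b‖ = ‖y₀‖ := by
  have hy := ne_zero_of_pow_eq hϖ hy₀
  have h := roots_prod_res hϖ hy₀ hm hP hs
  set s := (P.map (algebraMap F L)).roots with hs_def
  have hle : ∀ a ∈ s, ‖a / y₀‖ ≤ 1 := fun a ha => norm_div_le_one (hs a ha)
  have h' : ((s.map fun a => res (a / y₀)).map fun y => X - C y).prod =
      (expand 𝓀[F] r.den (rReduction ϖ r P)).map (residueMap F L) := by
    rw [Multiset.map_map]; exact h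
  have hsepE : ((s.map fun a => res (a / y₀)).map fun y => X - C y).prod.Separable := by
    rw [h']; exact (separable_expand hn hR h0).map
  have hnodr : (s.map fun a => res (a / y₀)).Nodup := by
    rw [← roots_multiset_prod_X_sub_C (s.map fun a => res (a / y₀))]
    exact nodup_roots hsepE
  have hdist : ∀ a ∈ s, ∀ b ∈ s, a ≠ b → ‖a - b‖ = ‖y₀‖ := by
    intro a ha b hb hne
    have h1 : res (a / y₀) ≠ res (b / y₀) := fun h =>
      hne (Multiset.inj_on_of_nodup_map hnodr a ha b hb h)
    rw [Ne, res_eq_res_iff (hle a ha) (hle b hb), not_lt] at h1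
    have h2 := norm_sub_le_one (hle a ha) (hle b hb)
    have h3 := le_antisymm h2 h1
    rwa [← sub_div, norm_div, div_eq_one_iff_eq (norm_ne_zero_iff.mpr hy)] at h3
  refine ⟨?_, fun a ha => ?_, hdist⟩
  · rw [← separable_map (algebraMap F L)]
    exact (nodup_roots_iff_of_splits (hm.map _).ne_zero (IsAlgClosed.splits _)).mp
      (Multiset.Nodup.of_map _ hnodr)
  · have h1 : res (a / y₀) ≠ 0 := by
      intro hz
      have h2 := congrArg (eval 0) h'
      rw [eval_multiset_prod, Multiset.map_map, Multiset.prod_eq_zero, eq_comm,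
        ← coeff_zero_eq_eval_zero, coeff_map, coeff_expand r.den_pos, if_pos (dvd_zero _),
        Nat.zero_div, _root_.map_eq_zero] at h2
      · exact h0 h2
      · refine Multiset.mem_map.mpr ⟨0, Multiset.mem_map.mpr ⟨a, ha, hz⟩, ?_⟩
        simp
    rwa [res_ne_zero_iff (hle a ha), norm_div,
      div_eq_one_iff_eq (norm_ne_zero_iff.mpr hy)] at h1

theorem prod_res_fullPoly (hϖ : Irreducible ϖ)
    (hy₀ : y₀ ^ r.den = algebraMap F L ((ϖ : F) ^ r.num)) (hm : P.Monic)
    (hP : P.natDegree = r.den * g)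
    (hs : ∀ a ∈ (P.map (algebraMap F L)).roots, ‖a‖ ≤ ‖y₀‖) :
    (((T.fullPoly P).map (algebraMap F L)).roots.map fun a => X - C (res (a / y₀))).prod =
      (T.fullPoly (expand 𝓀[F] r.den (rReduction ϖ r P))).map (residueMap F L) := by
  have h := roots_prod_res hϖ hy₀ hm hP hs
  cases T
  · change ((map _ (X * P)).roots.map fun a => X - C (res (a / y₀))).prod = map _ (X * _)
    rw [Polynomial.map_mul, Polynomial.map_mul, map_X, map_X,
      roots_mul (mul_ne_zero X_ne_zero (hm.map _).ne_zero), roots_X, Multiset.map_add,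
      Multiset.prod_add, h, Multiset.map_singleton, Multiset.prod_singleton, zero_div, res_zero,
      C_0, sub_zero]
  · exact h
  · exact h

theorem fullPoly_injective {k : Type*} [Field k] :
    Function.Injective (T.fullPoly : k[X] → k[X]) := by
  cases T
  · exact fun p q h => mul_left_cancel₀ X_ne_zero h
  · exact fun p q h => h
  · exact fun p q h => h

/-- Both conditions say that the multisets of residues of `a / y₀` coincide, the root `0` of the odd
orthogonal case included: the residues determine `R(λ^n)`, hence `R`, and conversely equal multisets
can be matched by a permutation. -/
theorem rReduction_eq_iff (hϖ : Irreducible ϖ)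
    (hy₀ : y₀ ^ r.den = algebraMap F L ((ϖ : F) ^ r.num)) (hm : P.Monic)
    (hP : P.natDegree = r.den * g) (hm' : P'.Monic) (hP' : P'.natDegree = r.den * g)
    (hs : ∀ a ∈ (P.map (algebraMap F L)).roots, ‖a‖ ≤ ‖y₀‖)
    (hs' : ∀ a ∈ (P'.map (algebraMap F L)).roots, ‖a‖ ≤ ‖y₀‖) {d : ℕ}
    (hd : (T.fullPoly P).natDegree = d) (hd' : (T.fullPoly P').natDegree = d) :
    rReduction ϖ r P = rReduction ϖ r P' ↔
      ∃ l l' : Fin d → L,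
        ((T.fullPoly P).map (algebraMap F L)).roots = Finset.univ.val.map l ∧
        ((T.fullPoly P').map (algebraMap F L)).roots = Finset.univ.val.map l' ∧
        ∀ i, ‖l' i - l i‖ < ‖y₀‖ := by
  have hy := ne_zero_of_pow_eq hϖ hy₀
  have hpos : 0 < ‖y₀‖ := norm_pos_iff.mpr hy
  have h := prod_res_fullPoly (T := T) hϖ hy₀ hm hP hs
  have h' := prod_res_fullPoly (T := T) hϖ hy₀ hm' hP' hs'
  have hfull : ∀ {p : F[X]}, p.Monic → (∀ a ∈ (p.map (algebraMap F L)).roots, ‖a‖ ≤ ‖y₀‖) →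
      ∀ a ∈ ((T.fullPoly p).map (algebraMap F L)).roots, ‖a / y₀‖ ≤ 1 := by
    intro p hpm hp a ha
    refine norm_div_le_one ?_
    cases T
    · change a ∈ (map _ (X * p)).roots at ha
      rw [Polynomial.map_mul, map_X, roots_mul (mul_ne_zero X_ne_zero (hpm.map _).ne_zero),
        roots_X, Multiset.mem_add, Multiset.mem_singleton] at ha
      rcases ha with rfl | ha
      · rw [norm_zero]; exact hpos.le
      · exact hp a ha
    · exact hp a ha
    · exact hp a ha
  have hlt : ∀ a b : L, ‖a / y₀‖ ≤ 1 → ‖b / y₀‖ ≤ 1 →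
      (res (a / y₀) = res (b / y₀) ↔ ‖a - b‖ < ‖y₀‖) := by
    intro a b ha hb
    rw [res_eq_res_iff ha hb, ← sub_div, norm_div, div_lt_one hpos]
  constructor
  · intro hR
    have hcard : ∀ {p : F[X]}, (T.fullPoly p).natDegree = d →
        ((T.fullPoly p).map (algebraMap F L)).roots.card = d := by
      intro p hp
      rw [← (IsAlgClosed.splits _).natDegree_eq_card_roots, natDegree_map, hp]
    obtain ⟨l, hl⟩ := exists_enumeration d _ (hcard hd)
    obtain ⟨l', hl'⟩ := exists_enumeration d _ (hcard hd')
    rw [hR, ← h', hl, hl', Multiset.map_map, Multiset.map_map] at h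
    have h1 : (Finset.univ.val.map fun i => res (l' i / y₀)) =
        Finset.univ.val.map fun i => res (l i / y₀) := by
      have := congrArg roots h
      rw [← roots_multiset_prod_X_sub_C (Finset.univ.val.map fun i => res (l' i / y₀)),
        ← roots_multiset_prod_X_sub_C (Finset.univ.val.map fun i => res (l i / y₀)),
        Multiset.map_map, Multiset.map_map]
      exact this.symm
    obtain ⟨σ, hσ⟩ := exists_perm_of_map_eq h1
    have hli : ∀ i, ‖l i / y₀‖ ≤ 1 := fun i =>
      hfull hm hs _ (by rw [hl]; exact Multiset.mem_map_of_mem _ (Finset.mem_univ i))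
    have hli' : ∀ i, ‖l' i / y₀‖ ≤ 1 := fun i =>
      hfull hm' hs' _ (by rw [hl']; exact Multiset.mem_map_of_mem _ (Finset.mem_univ i))
    refine ⟨l ∘ σ, l', ?_, hl', fun i => (hlt _ _ (hli' i) (hli _)).mp (hσ i).symm⟩
    rw [hl, ← Multiset.map_map, Multiset.map_univ_val_equiv]
  · rintro ⟨l, l', hl, hl', hll⟩
    have h1 : ((Finset.univ.val.map l).map fun a => X - C (res (a / y₀))) =
        (Finset.univ.val.map l').map fun a => X - C (res (a / y₀)) := by
      rw [Multiset.map_map, Multiset.map_map]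
      refine Multiset.map_congr rfl fun i _ => ?_
      have e := (hlt (l' i) (l i)
        (hfull hm' hs' _ (by rw [hl']; exact Multiset.mem_map_of_mem _ (Finset.mem_univ i)))
        (hfull hm hs _ (by rw [hl]; exact Multiset.mem_map_of_mem _ (Finset.mem_univ i)))).mpr
          (hll i)
      simp only [Function.comp_apply, e]
    rw [hl, h1, ← hl', h'] at h
    exact (expand_injective r.den_pos
      (fullPoly_injective (map_injective _ (residueMap F L).injective h))).symm

end Roots

/-! ### Cartan subalgebras and roots -/

section Cartan

variable {d : ℕ} {K : Type*} [Field K] {X Y : Matrix (Fin d) (Fin d) K}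

theorem geom_mul (X Y : Matrix (Fin d) (Fin d) K) : geom (X * Y) = geom X * geom Y :=
  Matrix.map_mul

theorem geom_sub (X Y : Matrix (Fin d) (Fin d) K) : geom (X - Y) = geom X - geom Y :=
  Matrix.map_sub _ (map_sub _) X Y

theorem geom_add (X Y : Matrix (Fin d) (Fin d) K) : geom (X + Y) = geom X + geom Y :=
  Matrix.map_add _ (map_add _) X Y

section Eigenmatrix

variable {L : Type*} [Field L] {t : Fin d → L} {P : GL (Fin d) L} {Z S : Matrix (Fin d) (Fin d) L}

theorem mulEquivLR_inv_apply : mulEquivLR P⁻¹ P S = (P⁻¹).1 * S * P.1 := rfl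

theorem mulEquivLR_inv_mul (S S' : Matrix (Fin d) (Fin d) L) :
    mulEquivLR P⁻¹ P (S * S') = mulEquivLR P⁻¹ P S * mulEquivLR P⁻¹ P S' := by
  simp only [mulEquivLR_inv_apply]
  rw [show (P⁻¹).1 * S * P.1 * ((P⁻¹).1 * S' * P.1) =
    (P⁻¹).1 * S * (P.1 * (P⁻¹).1) * S' * P.1 by simp only [Matrix.mul_assoc], Units.mul_inv,
    Matrix.mul_one]
  simp only [Matrix.mul_assoc]

theorem mulEquivLR_inv_eigenmatrix (hP : Z * P.1 = P.1 * Matrix.diagonal t) :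
    mulEquivLR P⁻¹ P Z = Matrix.diagonal t := by
  rw [mulEquivLR_inv_apply, Matrix.mul_assoc, hP, ← Matrix.mul_assoc, Units.inv_mul,
    Matrix.one_mul]

theorem mulEquivLR_inv_commutator (hP : Z * P.1 = P.1 * Matrix.diagonal t) (i j : Fin d) :
    mulEquivLR P⁻¹ P (Z * S - S * Z) i j = (t i - t j) * mulEquivLR P⁻¹ P S i j := by
  rw [map_sub, mulEquivLR_inv_mul, mulEquivLR_inv_mul, mulEquivLR_inv_eigenmatrix hP,
    Matrix.sub_apply, Matrix.diagonal_mul, Matrix.mul_diagonal]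
  ring

theorem commute_iff_of_eigenmatrix (hP : Z * P.1 = P.1 * Matrix.diagonal t) :
    Z * S = S * Z ↔ ∀ i j, (t i - t j) * mulEquivLR P⁻¹ P S i j = 0 := by
  rw [← sub_eq_zero, ← (mulEquivLR P⁻¹ P).map_eq_zero_iff, ← Matrix.ext_iff]
  simp only [mulEquivLR_inv_commutator hP, Matrix.zero_apply]

theorem commute_iff_diagonal (ht : Function.Injective t)
    (hP : Z * P.1 = P.1 * Matrix.diagonal t) :
    Z * S = S * Z ↔ ∃ h : Fin d → L, mulEquivLR P⁻¹ P S = Matrix.diagonal h := by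
  rw [commute_iff_of_eigenmatrix hP]
  constructor
  · intro h
    refine ⟨fun i => mulEquivLR P⁻¹ P S i i, ?_⟩
    ext i j
    rw [Matrix.diagonal_apply]
    split_ifs with hij
    · rw [hij]
    · exact (mul_eq_zero.mp (h i j)).resolve_left (sub_ne_zero.mpr fun h => hij (ht h))
  · rintro ⟨h, hh⟩ i j
    rw [hh, Matrix.diagonal_apply]
    split_ifs with hij
    · rw [hij, sub_self, zero_mul]
    · rw [mul_zero]

end Eigenmatrix

theorem exists_eigenmatrix_of_separable (hX : X.charpoly.Separable) :
    ∃ (t : Fin d → AlgebraicClosure K) (P : GL (Fin d) (AlgebraicClosure K)),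
      Function.Injective t ∧ (geom X).charpoly.roots = Finset.univ.val.map t ∧
        geom X * P.1 = P.1 * Matrix.diagonal t := by
  have hcard : (geom X).charpoly.roots.card = d := by
    rw [(IsAlgClosed.splits (geom X).charpoly).natDegree_eq_card_roots.symm]; simp
  obtain ⟨t, ht⟩ := exists_enumeration d _ hcard
  have hprod := geom_charpoly_eq_prod_of_roots ht
  have hinj := (separable_iff_injective_of_roots ((geom_charpoly X).symm.trans hprod)).mp hX
  obtain ⟨P, hP⟩ := exists_eigenmatrix_of_injective hinj hprod
  exact ⟨t, P, hinj, ht, hP⟩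

/-- In an eigenbasis over the closure the operator `ad X` multiplies the entry `(i, j)` by `t i - t
j`. It is thus diagonalizable, and what is killed by a power of it is killed by it. -/
theorem commute_of_iterate_eq_zero (hX : X.charpoly.Separable) {c : ℕ → Matrix (Fin d) (Fin d) K}
    (hc : ∀ k, c (k + 1) = X * c k - c k * X) {k : ℕ} (hk : c k = 0) : X * c 0 = c 0 * X := by
  obtain ⟨t, P, hinj, -, hP⟩ := exists_eigenmatrix_of_separable hX
  have h : ∀ k i j, mulEquivLR P⁻¹ P (geom (c k)) i j =
      (t i - t j) ^ k * mulEquivLR P⁻¹ P (geom (c 0)) i j := by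
    intro k
    induction k with
    | zero => intro i j; rw [pow_zero, one_mul]
    | succ k ih =>
      intro i j
      rw [hc, geom_sub, geom_mul, geom_mul, mulEquivLR_inv_commutator hP, ih, pow_succ']
      ring
  apply geom_injective
  rw [geom_mul, geom_mul, commute_iff_of_eigenmatrix hP]
  intro i j
  have h1 := h k i j
  rw [hk, show geom (0 : Matrix (Fin d) (Fin d) K) = 0 by ext; simp [geom], map_zero,
    Matrix.zero_apply, eq_comm, mul_eq_zero] at h1
  rcases h1 with h1 | h1
  · rw [pow_eq_zero_iff'] at h1
    rw [h1.1, zero_mul]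
  · rw [h1, mul_zero]

theorem commute_of_commute (hX : X.charpoly.Separable) {H H' : Matrix (Fin d) (Fin d) K}
    (h : X * H = H * X) (h' : X * H' = H' * X) : H * H' = H' * H := by
  obtain ⟨t, P, hinj, -, hP⟩ := exists_eigenmatrix_of_separable hX
  have h1 := congrArg geom h
  have h1' := congrArg geom h'
  rw [geom_mul, geom_mul, commute_iff_diagonal hinj hP] at h1 h1'
  obtain ⟨a, ha⟩ := h1
  obtain ⟨b, hb⟩ := h1'
  apply geom_injective
  apply (mulEquivLR P⁻¹ P).injective
  rw [geom_mul, geom_mul, mulEquivLR_inv_mul, mulEquivLR_inv_mul, ha, hb,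
    Matrix.diagonal_mul_diagonal, Matrix.diagonal_mul_diagonal]
  simp only [mul_comm]

variable {A : MatAlg d}

theorem coe_lie (X Y : A.lie K) : (⁅X, Y⁆ : A.lie K).1 = X.1 * Y.1 - Y.1 * X.1 := rfl

/-- By nilpotency of the Cartan subalgebra, `ad X` is nilpotent on it; being diagonalizable, it is
zero there. -/
theorem commute_of_mem_cartan {t : LieSubalgebra K (A.lie K)} (ht : t.IsCartanSubalgebra)
    {X H : A.lie K} (hX : X ∈ t) (hsep : X.1.charpoly.Separable) (hH : H ∈ t) :
    X.1 * H.1 = H.1 * X.1 := by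
  have := ht.nilpotent
  obtain ⟨k, hk⟩ := LieModule.exists_forall_pow_toEnd_eq_zero K t t
  have h0 := congrArg (fun Z : t => (Z : A.lie K).1) (LinearMap.congr_fun (hk ⟨X, hX⟩) ⟨H, hH⟩)
  refine commute_of_iterate_eq_zero hsep
    (c := fun k => (((LieModule.toEnd K t t ⟨X, hX⟩) ^ k) ⟨H, hH⟩ : A.lie K).1) (fun k => ?_) h0
  simp only [pow_succ', Module.End.mul_apply]
  rfl

/-- The centralizer of `X` in the Lie algebra over `K`. -/
def MatAlg.centralizerSubalgebra (A : MatAlg d) (X : A.lie K) :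
    LieSubalgebra K (A.lie K) where
  carrier := {Y | ⁅X, Y⁆ = 0}
  zero_mem' := lie_zero X
  add_mem' := by
    intro a b ha hb
    change ⁅X, a + b⁆ = 0
    rw [lie_add, show ⁅X, a⁆ = 0 from ha, show ⁅X, b⁆ = 0 from hb, add_zero]
  smul_mem' := by
    intro c a ha
    change ⁅X, c • a⁆ = 0
    rw [lie_smul, show ⁅X, a⁆ = 0 from ha, smul_zero]
  lie_mem' := by
    intro a b ha hb
    change ⁅X, ⁅a, b⁆⁆ = 0
    rw [leibniz_lie, show ⁅X, a⁆ = 0 from ha, show ⁅X, b⁆ = 0 from hb, zero_lie, lie_zero,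
      add_zero]

theorem mem_centralizerSubalgebra {X Y : A.lie K} :
    Y ∈ A.centralizerSubalgebra X ↔ X.1 * Y.1 = Y.1 * X.1 := by
  change ⁅X, Y⁆ = 0 ↔ _
  rw [Subtype.ext_iff, coe_lie, ZeroMemClass.coe_zero, sub_eq_zero]

theorem isCartanSubalgebra_centralizerSubalgebra {X : A.lie K} (hX : X.1.charpoly.Separable) :
    (A.centralizerSubalgebra X).IsCartanSubalgebra where
  nilpotent := by
    have : IsLieAbelian (A.centralizerSubalgebra X) := ⟨fun Y Z => by
      apply Subtype.ext
      apply Subtype.ext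
      change Y.1.1 * Z.1.1 - Z.1.1 * Y.1.1 = 0
      rw [sub_eq_zero]
      exact commute_of_commute hX (mem_centralizerSubalgebra.mp Y.2)
        (mem_centralizerSubalgebra.mp Z.2)⟩
    infer_instance
  self_normalizing := by
    refine le_antisymm (fun Y hY => ?_) (LieSubalgebra.le_normalizer _)
    rw [LieSubalgebra.mem_normalizer_iff'] at hY
    -- A normalizing `Y` is tested against `X` itself: `[X, Y]` commutes with `X`, so the square of
    -- `ad X` kills `Y`.
    have h1 := mem_centralizerSubalgebra.mp (hY X (mem_centralizerSubalgebra.mpr rfl))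
    rw [coe_lie, ← sub_eq_zero] at h1
    rw [mem_centralizerSubalgebra]
    exact commute_of_iterate_eq_zero hX (c := fun k => (fun Z => X.1 * Z - Z * X.1)^[k] Y.1)
      (fun k => Function.iterate_succ_apply' _ _ _) (k := 2) h1

/-- A nonzero entry `(i, j)` of the root vector in the eigenbasis gives `α(X) = t i - t j`. If this
were zero, the root vector would commute with `X`, hence be diagonal and commute with the whole
Cartan subalgebra, so that `α = 0`. -/
theorem exists_root_eq_sub {X : A.lie K} (hX : X.1.charpoly.Separable)
    {α : A.centralizerSubalgebra X →ₗ[K] AlgebraicClosure K}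
    (hα : A.IsAbsoluteRoot (A.centralizerSubalgebra X) α)
    (hXt : X ∈ A.centralizerSubalgebra X) :
    ∃ a ∈ eigenvalues X.1, ∃ b ∈ eigenvalues X.1, a ≠ b ∧ α ⟨X, hXt⟩ = a - b := by
  obtain ⟨t, P, hinj, ht, hP⟩ := exists_eigenmatrix_of_separable hX
  obtain ⟨hα0, Y, -, hY0, hY⟩ := hα
  have hne : mulEquivLR P⁻¹ P Y ≠ 0 := fun h => hY0 ((mulEquivLR P⁻¹ P).map_eq_zero_iff.mp h)
  have hmem : ∀ i, t i ∈ eigenvalues X.1 := fun i => by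
    rw [eigenvalues, ht]
    exact Multiset.mem_map_of_mem _ (Finset.mem_univ i)
  have hkey : ∀ i j, (t i - t j) * mulEquivLR P⁻¹ P Y i j =
      α ⟨X, hXt⟩ * mulEquivLR P⁻¹ P Y i j := by
    intro i j
    rw [← mulEquivLR_inv_commutator hP, hY ⟨X, hXt⟩, map_smul]
    rfl
  obtain ⟨i, j, hij⟩ : ∃ i j, mulEquivLR P⁻¹ P Y i j ≠ 0 := by
    by_contra! h
    exact hne (Matrix.ext h)
  have hval := mul_right_cancel₀ hij (hkey i j)
  refine ⟨t i, hmem i, t j, hmem j, fun h => hα0 ?_, hval.symm⟩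
  have hcomm : geom X.1 * Y = Y * geom X.1 := by
    rw [commute_iff_of_eigenmatrix hP]
    intro i' j'
    rw [hkey, ← hval, h, sub_self, zero_mul]
  obtain ⟨b, hb⟩ := (commute_iff_diagonal hinj hP).mp hcomm
  ext H
  have h1 := congrArg geom (mem_centralizerSubalgebra.mp H.2)
  rw [geom_mul, geom_mul, commute_iff_diagonal hinj hP] at h1
  obtain ⟨a, ha⟩ := h1
  have h2 := congrArg (mulEquivLR P⁻¹ P) (hY H)
  rw [map_sub, mulEquivLR_inv_mul, mulEquivLR_inv_mul, ha, hb, Matrix.diagonal_mul_diagonal,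
    Matrix.diagonal_mul_diagonal, map_smul, hb] at h2
  simp only [mul_comm, sub_self] at h2
  rw [eq_comm, smul_eq_zero, ← hb] at h2
  exact h2.resolve_right hne

section Form

variable {ε : Fin d → ℤˣ} {s : ℤˣ} {X : (MatAlg.form ε).lie K}

/-- The root vector is `P S ᵗP J` with `S = E_ij - s E_ji`, the same substitution as in
`finrank_form_centralizer`. The Cartan subalgebra commutes with `X` and so is diagonal in its
eigenbasis; the root adds the diagonal entries `i` and `j`. -/
theorem exists_root_eq_add (hε : ∀ i, ε i.rev = s * ε i)
    {t : LieSubalgebra K ((MatAlg.form ε).lie K)} (ht : t.IsCartanSubalgebra) (hXt : X ∈ t)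
    (hsep : X.1.charpoly.Separable) {u : Fin d → AlgebraicClosure K}
    {P : GL (Fin d) (AlgebraicClosure K)} (hu : Function.Injective u)
    (hP : geom X.1 * P.1 = P.1 * Matrix.diagonal u) {i j : Fin d} (hij : i ≠ j)
    (hne : u i + u j ≠ 0) :
    ∃ α : t →ₗ[K] AlgebraicClosure K,
      (MatAlg.form ε).IsAbsoluteRoot t α ∧ α ⟨X, hXt⟩ = u i + u j := by
  classical
  let α : t →ₗ[K] AlgebraicClosure K :=
    { toFun := fun H => mulEquivLR P⁻¹ P (geom H.1.1) i i + mulEquivLR P⁻¹ P (geom H.1.1) j j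
      map_add' := fun H H' => by
        change mulEquivLR P⁻¹ P (geom (H.1.1 + H'.1.1)) i i +
          mulEquivLR P⁻¹ P (geom (H.1.1 + H'.1.1)) j j = _
        rw [geom_add, map_add, Matrix.add_apply, Matrix.add_apply]
        ring
      map_smul' := fun a H => by
        change mulEquivLR P⁻¹ P (geom (a • H.1.1)) i i +
          mulEquivLR P⁻¹ P (geom (a • H.1.1)) j j = _
        have : geom (a • H.1.1) = algebraMap K (AlgebraicClosure K) a • geom H.1.1 := by
          ext; simp [geom]
        rw [this, map_smul, Matrix.smul_apply, Matrix.smul_apply, smul_eq_mul, smul_eq_mul,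
          ← mul_add]
        exact (Algebra.smul_def _ _).symm }
  have hαX : α ⟨X, hXt⟩ = u i + u j := by
    change mulEquivLR P⁻¹ P (geom X.1) i i + mulEquivLR P⁻¹ P (geom X.1) j j = _
    rw [mulEquivLR_inv_eigenmatrix hP, Matrix.diagonal_apply_eq, Matrix.diagonal_apply_eq]
  set σ : AlgebraicClosure K := ((s : ℤ) : AlgebraicClosure K) with hσ
  have hs2 : σ * σ = 1 := units_cast_mul_self s
  let S : Matrix (Fin d) (Fin d) (AlgebraicClosure K) :=
    Matrix.single i j 1 - σ • Matrix.single j i 1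
  let J := skewDiag ε (AlgebraicClosure K)
  have hJ : Jᵀ = σ • J := skewDiag_transpose hε
  have hS : Sᵀ = -(σ • S) := by
    simp only [S, Matrix.transpose_sub, Matrix.transpose_smul, Matrix.transpose_single, smul_sub,
      smul_smul, hs2, one_smul, neg_sub]
  let e := mulEquivLR P (transposeGL P * skewDiagGL ε (AlgebraicClosure K))
  have he : ∀ S, e S = P.1 * S * (P.1ᵀ * J) := fun S => rfl
  refine ⟨α, ⟨fun h => hne (by rw [← hαX, h]; rfl), e S, ?_, ?_, fun H => ?_⟩, hαX⟩
  · rw [mem_form_lie]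
    change (e S)ᵀ * J = -(J * e S)
    rw [he, Matrix.transpose_mul, Matrix.transpose_mul, Matrix.transpose_mul,
      Matrix.transpose_transpose, hJ, hS]
    simp only [Matrix.smul_mul, Matrix.mul_smul, Matrix.mul_neg, Matrix.neg_mul,
      smul_smul, hs2, one_smul, Matrix.mul_assoc]
  · rw [Ne, e.map_eq_zero_iff]
    intro h0
    have := congrFun (congrFun h0 i) j
    simp [S, hij] at this
  · have hH := commute_of_mem_cartan ht hXt hsep H.2
    have h1 := congrArg geom hH
    rw [geom_mul, geom_mul, commute_iff_diagonal hu hP] at h1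
    obtain ⟨a, ha⟩ := h1
    have hHP : geom H.1.1 * P.1 = P.1 * Matrix.diagonal a := by
      rw [← ha, mulEquivLR_inv_apply, ← Matrix.mul_assoc, ← Matrix.mul_assoc, Units.mul_inv,
        Matrix.one_mul]
    have hPt : P.1ᵀ * (geom H.1.1)ᵀ = Matrix.diagonal a * P.1ᵀ := by
      rw [← Matrix.transpose_mul, hHP, Matrix.transpose_mul, Matrix.diagonal_transpose]
    have hXJ : J * geom H.1.1 = - ((geom H.1.1)ᵀ * J) := by
      rw [mem_form_lie.mp (geom_mem_form_lie H.1.2), neg_neg]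
    have h3 : geom H.1.1 * e S = e (Matrix.diagonal a * S) := by
      rw [he, he, ← Matrix.mul_assoc, ← Matrix.mul_assoc (geom H.1.1), hHP]
      simp only [Matrix.mul_assoc]
    have h4 : e S * geom H.1.1 = -e (S * Matrix.diagonal a) := by
      rw [he, he, Matrix.mul_assoc, Matrix.mul_assoc P.1ᵀ, hXJ, Matrix.mul_neg,
        ← Matrix.mul_assoc P.1ᵀ, hPt]
      simp only [Matrix.mul_assoc, Matrix.mul_neg]
    have hαH : α H = a i + a j := by
      change mulEquivLR P⁻¹ P (geom H.1.1) i i + mulEquivLR P⁻¹ P (geom H.1.1) j j = _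
      rw [ha, Matrix.diagonal_apply_eq, Matrix.diagonal_apply_eq]
    rw [h3, h4, sub_neg_eq_add, ← map_add, hαH, ← map_smul]
    congr 1
    ext x y
    rw [Matrix.add_apply, Matrix.diagonal_mul, Matrix.mul_diagonal, Matrix.smul_apply, smul_eq_mul]
    simp only [S, Matrix.sub_apply, Matrix.smul_apply, Matrix.single_apply, smul_eq_mul]
    split_ifs with h5 h6 h6
    · exact absurd (h5.1.trans h6.1.symm) hij
    · rw [← h5.1, ← h5.2]; ring
    · rw [← h6.1, ← h6.2]; ring
    · ring

end Form

end Cartan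

/-! ### Splitting fields and tame ramification -/

/-- The degree is the order of the Galois group, which acts faithfully on the roots. -/
theorem finrank_splittingField_dvd_factorial {K E : Type*} [Field K] [Field E] [Algebra K E]
    {p : K[X]} [p.IsSplittingField K E] (hp : p.Separable) :
    Module.finrank K E ∣ p.natDegree.factorial := by
  have : Fact (p.map (algebraMap K p.SplittingField)).Splits := ⟨SplittingField.splits p⟩
  have h1 : Module.finrank K E = Nat.card p.Gal := by
    rw [Gal.card_of_separable hp]
    exact (IsSplittingField.algEquiv E p).toLinearEquiv.finrank_eq
  have h2 : Nat.card (Equiv.Perm (p.rootSet p.SplittingField)) = p.natDegree.factorial := by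
    classical
    rw [Nat.card_eq_fintype_card, Fintype.card_perm, card_rootSet_eq_natDegree hp
      (SplittingField.splits p)]
  rw [h1, ← h2]
  exact Subgroup.card_dvd_of_injective _ (Gal.galActionHom_injective p p.SplittingField)

section Ramification

variable {F : Type*} [NontriviallyNormedField F] [IsUltrametricDist F]

theorem absVal_algebraMap (x : F) : absVal (algebraMap F (AlgebraicClosure F) x) = ‖x‖ :=
  spectralNorm_extends x

theorem absVal_nonneg (x : AlgebraicClosure F) : 0 ≤ absVal x := spectralNorm_nonneg x

/-- The spectral norm is a root of the absolute value of the constant term of the minimal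
polynomial, whose degree divides `[E : F]`. -/
theorem exists_absVal_pow_finrank [ProperSpace F]
    (E : IntermediateField F (AlgebraicClosure F)) [FiniteDimensional F E]
    {x : AlgebraicClosure F} (hx : x ∈ E) : ∃ a : F, absVal x ^ Module.finrank F E = ‖a‖ := by
  have : CompleteSpace F := inferInstance
  have hint : IsIntegral F x := Algebra.IsIntegral.isIntegral x
  have hdeg : (minpoly F x).natDegree ∣ Module.finrank F E := by
    have h := minpoly.degree_dvd (K := F) (x := (⟨x, hx⟩ : E)) (Algebra.IsIntegral.isIntegral _)
    rwa [← minpoly.algebraMap_eq (algebraMap E (AlgebraicClosure F)).injective] at h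
  obtain ⟨k, hk⟩ := hdeg
  refine ⟨(minpoly F x).coeff 0 ^ k, ?_⟩
  have hpos := minpoly.natDegree_pos hint
  rw [hk, pow_mul, norm_pow, absVal, spectralNorm.spectralNorm_eq_norm_coeff_zero_rpow, one_div,
    Real.rpow_inv_natCast_pow (norm_nonneg _) hpos.ne']

/-- With `m = [E : F]`, the `m`-th power embeds the value group of `E` in the cyclic value group of
`F`. So the quotient of the value groups is cyclic and killed by `m`, and its order, equal to its
exponent, divides `m`. -/
theorem ramIndex_dvd_finrank [ProperSpace F] {ϖ : 𝒪[F]} (hϖ : Irreducible ϖ)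
    (E : IntermediateField F (AlgebraicClosure F)) [FiniteDimensional F E] :
    ramIndex E ∣ Module.finrank F E := by
  set m := Module.finrank F E with hm
  have hm0 : m ≠ 0 := Module.finrank_pos.ne'
  let π : ℝˣ := Units.mk0 ‖(ϖ : F)‖ (norm_uniformizer_pos hϖ).ne'
  have h0 : valueGroup (⊥ : IntermediateField F (AlgebraicClosure F)) ≤ Subgroup.zpowers π := by
    refine (Subgroup.closure_le _).mpr ?_
    rintro u ⟨x, hx, hu⟩
    obtain ⟨a, rfl⟩ := IntermediateField.mem_bot.mp hx
    rw [absVal_algebraMap] at hu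
    have ha : a ≠ 0 := fun h => u.ne_zero (by rw [← hu, h, norm_zero])
    obtain ⟨i, hi⟩ := exists_norm_eq_zpow hϖ ha
    exact ⟨i, Units.ext (by rw [← hu, hi]; simp [π])⟩
  have hE : ∀ u ∈ valueGroup E, 0 < (u : ℝ) ∧
      u ^ m ∈ valueGroup (⊥ : IntermediateField F (AlgebraicClosure F)) := by
    intro u hu
    refine Subgroup.closure_induction ?_ ?_ ?_ ?_ hu
    · rintro u ⟨x, hx, hu⟩
      refine ⟨lt_of_le_of_ne (hu ▸ absVal_nonneg x) u.ne_zero.symm, ?_⟩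
      obtain ⟨a, ha⟩ := exists_absVal_pow_finrank E hx
      refine Subgroup.subset_closure ⟨algebraMap F _ a, IntermediateField.algebraMap_mem _ a, ?_⟩
      rw [absVal_algebraMap, ← ha, hu, Units.val_pow_eq_pow_val]
    · exact ⟨one_pos, by rw [one_pow]; exact one_mem _⟩
    · rintro u v - - ⟨hu, hu'⟩ ⟨hv, hv'⟩
      exact ⟨by rw [Units.val_mul]; exact mul_pos hu hv, by rw [mul_pow]; exact mul_mem hu' hv'⟩
    · rintro u - ⟨hu, hu'⟩
      exact ⟨by rw [Units.val_inv_eq_inv_val]; exact inv_pos.mpr hu, by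
        rw [inv_pow]; exact inv_mem hu'⟩
  let f : valueGroup E →* Subgroup.zpowers π :=
    ((powMonoidHom m).comp (valueGroup E).subtype).codRestrict _ fun u => h0 (hE u u.2).2
  -- The elements of the value group are positive, so `m`-th powers determine them.
  have hf : Function.Injective f := by
    intro u v huv
    have h1 : (u : ℝˣ) ^ m = (v : ℝˣ) ^ m := congrArg Subtype.val huv
    have h2 := congrArg Units.val h1
    rw [Units.val_pow_eq_pow_val, Units.val_pow_eq_pow_val] at h2
    exact Subtype.ext (Units.ext
      ((pow_left_inj₀ (hE u u.2).1.le (hE v v.2).1.le hm0).mp h2))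
  have hcyc : IsCyclic (valueGroup E) := isCyclic_of_injective f hf
  let V := (valueGroup (⊥ : IntermediateField F (AlgebraicClosure F))).subgroupOf (valueGroup E)
  have hcyc' : IsCyclic (valueGroup E ⧸ V) := isCyclic_of_surjective (QuotientGroup.mk' V)
    (QuotientGroup.mk'_surjective V)
  change Nat.card (valueGroup E ⧸ V) ∣ m
  rw [← IsCyclic.exponent_eq_card]
  refine Monoid.exponent_dvd_of_forall_pow_eq_one fun q => ?_
  obtain ⟨u, rfl⟩ := QuotientGroup.mk'_surjective V q
  rw [← map_pow, QuotientGroup.mk'_apply, QuotientGroup.eq_one_iff]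
  exact (hE u u.2).2

variable {d : ℕ} {A : MatAlg d}

/-- Once the separable characteristic polynomial of `X` splits over `E`, an eigenmatrix of `X`
exists over `E`, and it diagonalizes `Y` over `E` as well. -/
theorem eigenvalues_mem_of_commute {K : Type*} [Field K] {X Y : Matrix (Fin d) (Fin d) K}
    (hX : X.charpoly.Separable) (h : X * Y = Y * X)
    {E : IntermediateField K (AlgebraicClosure K)} (hE : (X.charpoly.map (algebraMap K E)).Splits) :
    ∀ a ∈ eigenvalues Y, a ∈ E := by
  have hch : (X.map (algebraMap K E)).charpoly = X.charpoly.map (algebraMap K E) :=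
    Matrix.charpoly_map X _
  have hcard : (X.map (algebraMap K E)).charpoly.roots.card = d := by
    rw [hch, ← hE.natDegree_eq_card_roots, natDegree_map, Matrix.charpoly_natDegree_eq_dim,
      Fintype.card_fin]
  obtain ⟨t, ht⟩ := exists_enumeration d _ hcard
  have hprod : (X.map (algebraMap K E)).charpoly = ∏ i, (Polynomial.X - C (t i)) := by
    have hs : (X.map (algebraMap K E)).charpoly.Splits := by rw [hch]; exact hE
    rw [hs.eq_prod_roots_of_monic (Matrix.charpoly_monic _), ht, Multiset.map_map]
    rfl
  have hinj : Function.Injective t :=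
    (separable_iff_injective_of_roots (hch.symm.trans hprod)).mp hX
  obtain ⟨P, hP⟩ := exists_eigenmatrix_of_injective hinj hprod
  have hcomm : X.map (algebraMap K E) * Y.map (algebraMap K E) =
      Y.map (algebraMap K E) * X.map (algebraMap K E) := by
    rw [← Matrix.map_mul, ← Matrix.map_mul, h]
  obtain ⟨b, hb⟩ := (commute_iff_diagonal hinj hP).mp hcomm
  have hYP : Y.map (algebraMap K E) * P.1 = P.1 * Matrix.diagonal b := by
    rw [← hb, mulEquivLR_inv_apply, ← Matrix.mul_assoc, ← Matrix.mul_assoc, Units.mul_inv,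
      Matrix.one_mul]
  have hY := charpoly_eq_prod_of_eigenmatrix hYP
  intro a ha
  have h1 : (geom Y).charpoly = ∏ i, (Polynomial.X - C ((b i : AlgebraicClosure K))) := by
    have h2 : geom Y = (Y.map (algebraMap K E)).map (algebraMap E (AlgebraicClosure K)) := by
      ext; simp [geom]
    rw [h2, Matrix.charpoly_map, hY, Polynomial.map_prod]
    simp
  rw [eigenvalues, h1, roots_prod_X_sub_C_univ] at ha
  obtain ⟨i, -, rfl⟩ := Multiset.mem_map.mp ha
  exact (b i).2

theorem isTamelyRamified_centralizerSubalgebra [ProperSpace F] {ϖ : 𝒪[F]} (hϖ : Irreducible ϖ)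
    {X : A.lie F} (hX : X.1.charpoly.Separable)
    (hp : Nat.Coprime d.factorial (ringChar 𝓀[F])) :
    IsTamelyRamified (A.centralizerSubalgebra X) := by
  have hspl : (X.1.charpoly.map (algebraMap F (AlgebraicClosure F))).Splits :=
    IsAlgClosed.splits _
  let E := IntermediateField.adjoin F (X.1.charpoly.rootSet (AlgebraicClosure F))
  have hsf : X.1.charpoly.IsSplittingField F E :=
    IntermediateField.adjoin_rootSet_isSplittingField hspl
  have hfd : FiniteDimensional F E := IsSplittingField.finiteDimensional E X.1.charpoly
  refine ⟨E, hfd, ?_, fun Y hY => ?_⟩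
  · refine Nat.Coprime.coprime_dvd_left ((ramIndex_dvd_finrank hϖ E).trans ?_) hp
    have := finrank_splittingField_dvd_factorial (K := F) (E := E) hX
    rwa [Matrix.charpoly_natDegree_eq_dim, Fintype.card_fin] at this
  · exact eigenvalues_mem_of_commute hX (mem_centralizerSubalgebra.mp hY)
      (IsSplittingField.splits E X.1.charpoly)

end Ramification

/-! ### Restricted elements -/

section Restricted

variable {F : Type*} [NontriviallyNormedField F] [IsUltrametricDist F]
  {T : ClassicalType} {c d : ℕ} {r : ℚ} {ε : Fin d → ℤˣ} {X : (MatAlg.form ε).lie F}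
  {P : F[X]}

/-- All nonzero eigenvalues, and all differences of two of them, have absolute value `ρ`. -/
def HasSlopeRoots (P : F[X]) (ρ : ℝ) : Prop :=
  (∀ a ∈ (P.map (algebraMap F (AlgebraicClosure F))).roots, absVal a = ρ) ∧
    ∀ a ∈ (P.map (algebraMap F (AlgebraicClosure F))).roots,
      ∀ b ∈ (P.map (algebraMap F (AlgebraicClosure F))).roots, a ≠ b → absVal (a - b) = ρ

theorem mem_roots_fullPoly {K L : Type*} [Field K] [Field L] [Algebra K L] {P : K[X]}
    (hP : P.Monic) {a : L} (ha : a ∈ ((T.fullPoly P).map (algebraMap K L)).roots) :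
    (T = .oddOrthogonal ∧ a = 0) ∨ a ∈ (P.map (algebraMap K L)).roots := by
  cases T
  · change a ∈ (map _ (Polynomial.X * P)).roots at ha
    rw [Polynomial.map_mul, map_X, roots_mul (mul_ne_zero X_ne_zero (hP.map _).ne_zero),
      roots_X, Multiset.mem_add, Multiset.mem_singleton] at ha
    exact ha.imp_left fun h => ⟨rfl, h⟩
  · exact Or.inr ha
  · exact Or.inr ha

theorem roots_le_roots_fullPoly {K L : Type*} [Field K] [Field L] [Algebra K L] {P : K[X]}
    (hP : P.Monic) {a : L} (ha : a ∈ (P.map (algebraMap K L)).roots) :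
    a ∈ ((T.fullPoly P).map (algebraMap K L)).roots := by
  cases T
  · change a ∈ (map _ (Polynomial.X * P)).roots
    rw [Polynomial.map_mul, map_X, roots_mul (mul_ne_zero X_ne_zero (hP.map _).ne_zero),
      Multiset.mem_add]
    exact Or.inr ha
  · exact ha
  · exact ha

theorem ne_zero_of_mem_roots {K L : Type*} [Field K] [Field L] [Algebra K L] {P : K[X]}
    (h0 : P.coeff 0 ≠ 0) {a : L} (ha : a ∈ (P.map (algebraMap K L)).roots) : a ≠ 0 := by
  rintro rfl
  have := (mem_roots'.mp ha).2
  rw [IsRoot.def, ← coeff_zero_eq_eval_zero, coeff_map, _root_.map_eq_zero] at this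
  exact h0 this

theorem absVal_neg (a : AlgebraicClosure F) : absVal (-a) = absVal a :=
  spectralNorm_neg (Algebra.IsAlgebraic.isAlgebraic a)

/-- Write `t i - t k` as `t i + t k.rev`. If `i ≠ k.rev`, this is the value of an absolute root. If
`i = k.rev`, it is `2 t i`, which need not be a root, and the condition on the eigenvalues is used
together with the invertibility of `2` in the residue field. -/
theorem hasSlopeRoots_of_isRestricted (hd : d = T.dim c) (hc : 0 < c)
    (hK : (((2 * c + 1).factorial : ℕ) : 𝓀[F]) ≠ 0)
    (hKF : (((2 * c + 1).factorial : ℕ) : F) ≠ 0) (hε : T.IsFormSign ε)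
    (hX : IsRestricted (MatAlg.form ε) r X) :
    X.1.charpoly.Separable ∧ HasSlopeRoots (nonzeroPart X.1.charpoly) (qPow F r) := by
  have h2 := two_ne_zero_of_factorial hc hKF
  have hsep : X.1.charpoly.Separable :=
    separable_of_isRegularSemisimple hd h2 hε X.2 hX.regular fun _ => hX.multiplicity
  obtain ⟨hP, hXP⟩ := isFormPoly_of_separable hd h2 X.2 hsep
  refine ⟨hsep, ?_⟩
  have heig : ∀ a ∈ ((nonzeroPart X.1.charpoly).map (algebraMap F (AlgebraicClosure F))).roots,
      a ∈ (geom X.1).charpoly.roots := by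
    intro a ha
    rw [geom_charpoly, hXP]
    exact roots_le_roots_fullPoly hP.monic ha
  have habs : ∀ a ∈ ((nonzeroPart X.1.charpoly).map (algebraMap F (AlgebraicClosure F))).roots,
      absVal a = qPow F r := fun a ha =>
    hX.eigenvalue a (heig a ha) (ne_zero_of_mem_roots hP.coeff_zero_ne_zero ha)
  refine ⟨habs, fun a ha b hb hab => ?_⟩
  obtain ⟨t, ht, hrev⟩ :=
    exists_symmetric_roots (two_ne_zero_algebraicClosure h2) (geom_mem_form_lie X.2)
  have hprod := geom_charpoly_eq_prod_of_roots ht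
  have hinj := (separable_iff_injective_of_roots ((geom_charpoly X.1).symm.trans hprod)).mp hsep
  obtain ⟨p, hp⟩ := exists_eigenmatrix_of_injective hinj hprod
  have h1 := heig a ha
  have h1' := heig b hb
  rw [ht] at h1 h1'
  obtain ⟨i, -, rfl⟩ := Multiset.mem_map.mp h1
  obtain ⟨k, -, rfl⟩ := Multiset.mem_map.mp h1'
  by_cases hik : i = k.rev
  · have h3 : t i - t k = (2 : F) • t i := by
      have : t k = - t i := by rw [hik, hrev, neg_neg]
      rw [this, Algebra.smul_def, map_ofNat]; ring
    rw [h3, absVal, spectralNorm_smul _ (Algebra.IsAlgebraic.isAlgebraic _)]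
    have h4 : ‖(2 : F)‖ = 1 := by
      have := norm_natCast_eq_one (K := F) (natCast_ne_zero_of_factorial hK two_pos (by omega))
      exact_mod_cast this
    rw [coe_nnnorm, h4, one_mul]
    exact habs _ ha
  · obtain ⟨s, hs, -, hXs, hα⟩ := hX.cartan
    obtain ⟨α, hα1, hα2⟩ := exists_root_eq_add (formSign_rev hd hε) hs hXs hsep hinj hp hik
      (by rw [hrev, ← sub_eq_add_neg]; exact sub_ne_zero.mpr hab)
    rw [sub_eq_add_neg, ← hrev, ← hα2]
    exact hα α hα1

/-- The Cartan subalgebra is the centralizer of `X`. Its roots take differences of eigenvalues as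
values at `X`, and it is tame since it splits over the splitting field of the characteristic
polynomial. -/
theorem isRestricted_of_hasSlopeRoots [ProperSpace F] {ϖ : 𝒪[F]} (hϖ : Irreducible ϖ)
    (hd : d = T.dim c) (hc : 0 < c) (hKF : (((2 * c + 1).factorial : ℕ) : F) ≠ 0)
    (hp : Nat.Coprime d.factorial (ringChar 𝓀[F])) (hε : T.IsFormSign ε)
    (hP : IsFormPoly c P) (hXP : X.1.charpoly = T.fullPoly P)
    (hroots : HasSlopeRoots P (qPow F r)) : IsRestricted (MatAlg.form ε) r X := by
  have h2 := two_ne_zero_of_factorial hc hKF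
  have hsep : X.1.charpoly.Separable := by rw [hXP]; exact separable_fullPoly hP
  have hmem : ∀ a ∈ eigenvalues X.1,
      a = 0 ∨ a ∈ (P.map (algebraMap F (AlgebraicClosure F))).roots := by
    intro a ha
    rw [eigenvalues, geom_charpoly, hXP] at ha
    exact (mem_roots_fullPoly hP.monic ha).imp_left And.right
  refine ⟨isRegularSemisimple_of_separable hd h2 hε X.2 hsep,
    ⟨_, isCartanSubalgebra_centralizerSubalgebra hsep,
      isTamelyRamified_centralizerSubalgebra hϖ hsep hp, mem_centralizerSubalgebra.mpr rfl,
      fun α hα => ?_⟩, fun a ha ha0 => hroots.1 a ((hmem a ha).resolve_left ha0), ?_⟩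
  · obtain ⟨a, ha, b, hb, hab, h⟩ := exists_root_eq_sub hsep hα (mem_centralizerSubalgebra.mpr rfl)
    rw [h]
    rcases hmem a ha with rfl | ha'
    · rw [zero_sub, absVal_neg]
      exact hroots.1 b ((hmem b hb).resolve_left hab.symm)
    · rcases hmem b hb with rfl | hb'
      · rw [sub_zero]
        exact hroots.1 a ha'
      · exact hroots.2 a ha' b hb' hab
  · rw [geom_charpoly]
    exact rootMultiplicity_le_one_of_separable hsep.map 0

end Restricted

/-! ### Transfer to the algebraic closure with its spectral norm -/

section Slope

variable {F : Type*} [NontriviallyNormedField F] [IsUltrametricDist F] [ProperSpace F] {ϖ : 𝒪[F]}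
  {r : ℚ}

theorem qPow_pos : 0 < qPow F r := by
  have := one_lt_resCard (K := F)
  exact Real.rpow_pos_of_pos (by exact_mod_cast (by omega : 0 < resCard F)) _

theorem qPow_natCast_mul (k : ℕ) : qPow F (k * r) = qPow F r ^ k := by
  rw [qPow, qPow, ← Real.rpow_mul_natCast (by positivity)]
  congr 1
  push_cast
  ring

theorem qPow_pow_den (hq : ‖(ϖ : F)‖ = (resCard F : ℝ)⁻¹) :
    qPow F r ^ r.den = ‖(ϖ : F)‖ ^ r.num := by
  rw [← qPow_natCast_mul, hq, inv_zpow', mul_comm, Rat.mul_den_eq_num, qPow]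
  push_cast
  rw [← Int.cast_neg, Real.rpow_intCast]

theorem qPow_pow_mul_den (hq : ‖(ϖ : F)‖ = (resCard F : ℝ)⁻¹) (k : ℕ) :
    qPow F r ^ (r.den * k) = ‖(ϖ : F)‖ ^ (r.num * k) := by
  rw [pow_mul, qPow_pow_den hq, zpow_mul, zpow_natCast]

variable (F) in
theorem exists_den_root (ϖ : 𝒪[F]) (r : ℚ) : ∃ y : AlgebraicClosure F,
    y ^ r.den = algebraMap F (AlgebraicClosure F) ((ϖ : F) ^ r.num) :=
  IsAlgClosed.exists_pow_nat_eq _ r.den_pos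

theorem absVal_den_root (hq : ‖(ϖ : F)‖ = (resCard F : ℝ)⁻¹) {y : AlgebraicClosure F}
    (hy : y ^ r.den = algebraMap F (AlgebraicClosure F) ((ϖ : F) ^ r.num)) :
    absVal y = qPow F r := by
  let : NormedField (AlgebraicClosure F) := spectralNorm.normedField F _
  let : NormedAlgebra F (AlgebraicClosure F) := spectralNorm.normedAlgebra F _
  refine (pow_left_inj₀ (absVal_nonneg y) qPow_pos.le r.den_ne_zero).mp ?_
  rw [qPow_pow_den hq, ← norm_zpow, ← absVal_algebraMap, ← hy]
  exact (norm_pow y r.den).symm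

theorem absVal_isUltrametricDist : @IsUltrametricDist (AlgebraicClosure F)
    (spectralNorm.normedField F (AlgebraicClosure F)).toDist := by
  let : NormedField (AlgebraicClosure F) := spectralNorm.normedField F _
  exact IsUltrametricDist.isUltrametricDist_of_isNonarchimedean_norm isNonarchimedean_spectralNorm

variable {P P' : F[X]} {g : ℕ}

theorem HasSlopeRoots.separable_rReduction (hϖ : Irreducible ϖ)
    (hq : ‖(ϖ : F)‖ = (resCard F : ℝ)⁻¹) (hm : P.Monic) (hP : P.natDegree = r.den * g)
    (hsep : P.Separable) (h : HasSlopeRoots P (qPow F r)) :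
    (rReduction ϖ r P).Separable ∧ (rReduction ϖ r P).coeff 0 ≠ 0 := by
  let : NontriviallyNormedField (AlgebraicClosure F) := spectralNorm.nontriviallyNormedField F _
  let : NormedAlgebra F (AlgebraicClosure F) := spectralNorm.normedAlgebra F _
  have : IsUltrametricDist (AlgebraicClosure F) := absVal_isUltrametricDist
  obtain ⟨y, hy⟩ := exists_den_root F ϖ r
  have hyn : ‖y‖ = qPow F r := absVal_den_root hq hy
  refine ClassicalSlope.separable_rReduction hϖ hy hm hP hsep ?_ ?_
  · rw [hyn]; exact h.1
  · rw [hyn]; exact h.2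

theorem hasSlopeRoots_of_separable (hϖ : Irreducible ϖ)
    (hq : ‖(ϖ : F)‖ = (resCard F : ℝ)⁻¹) (hm : P.Monic) (hP : P.natDegree = r.den * g)
    (hc : ∀ i < P.natDegree, ‖P.coeff i‖ ≤ qPow F r ^ (P.natDegree - i))
    (hn : (r.den : 𝓀[F]) ≠ 0) (hR : (rReduction ϖ r P).Separable)
    (h0 : (rReduction ϖ r P).coeff 0 ≠ 0) : P.Separable ∧ HasSlopeRoots P (qPow F r) := by
  let : NontriviallyNormedField (AlgebraicClosure F) := spectralNorm.nontriviallyNormedField F _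
  let : NormedAlgebra F (AlgebraicClosure F) := spectralNorm.normedAlgebra F _
  have : IsUltrametricDist (AlgebraicClosure F) := absVal_isUltrametricDist
  obtain ⟨y, hy⟩ := exists_den_root F ϖ r
  have hyn : ‖y‖ = qPow F r := absVal_den_root hq hy
  rw [← hyn] at hc
  have h := norm_roots_of_separable hϖ hy hm hP
    (fun a ha => norm_le_of_root (ne_zero_of_pow_eq hϖ hy) hm hc ha) hn hR h0
  rw [hyn] at h
  exact h

theorem HasSlopeRoots.rReduction_eq_iff {T : ClassicalType} (hϖ : Irreducible ϖ)
    (hq : ‖(ϖ : F)‖ = (resCard F : ℝ)⁻¹) (hm : P.Monic) (hP : P.natDegree = r.den * g)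
    (hm' : P'.Monic) (hP' : P'.natDegree = r.den * g)
    (h : HasSlopeRoots P (qPow F r)) (h' : HasSlopeRoots P' (qPow F r)) {d : ℕ}
    (hd : (T.fullPoly P).natDegree = d) (hd' : (T.fullPoly P').natDegree = d) :
    rReduction ϖ r P = rReduction ϖ r P' ↔
      ∃ l l' : Fin d → AlgebraicClosure F,
        ((T.fullPoly P).map (algebraMap F (AlgebraicClosure F))).roots =
          Finset.univ.val.map l ∧
        ((T.fullPoly P').map (algebraMap F (AlgebraicClosure F))).roots =
          Finset.univ.val.map l' ∧
        ∀ i, absVal (l' i - l i) < qPow F r := by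
  let : NontriviallyNormedField (AlgebraicClosure F) := spectralNorm.nontriviallyNormedField F _
  let : NormedAlgebra F (AlgebraicClosure F) := spectralNorm.normedAlgebra F _
  have : IsUltrametricDist (AlgebraicClosure F) := absVal_isUltrametricDist
  obtain ⟨y, hy⟩ := exists_den_root F ϖ r
  have hyn : ‖y‖ = qPow F r := absVal_den_root hq hy
  have key := ClassicalSlope.rReduction_eq_iff (T := T) hϖ hy hm hP hm' hP'
    (fun a ha => (h.1 a ha).trans_le hyn.ge) (fun a ha => (h'.1 a ha).trans_le hyn.ge) hd hd'
  rw [hyn] at key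
  exact key

/-- The constant term is, up to sign, the product of the roots. -/
theorem HasSlopeRoots.norm_coeff_zero (hm : P.Monic) (h : HasSlopeRoots P (qPow F r)) :
    ‖P.coeff 0‖ = qPow F r ^ P.natDegree := by
  let : NormedField (AlgebraicClosure F) := spectralNorm.normedField F _
  have hs := IsAlgClosed.splits (P.map (algebraMap F (AlgebraicClosure F)))
  have h1 := hs.coeff_zero_eq_prod_roots_of_monic (hm.map _)
  rw [coeff_map] at h1
  rw [← absVal_algebraMap, h1]
  change ‖(-1 : AlgebraicClosure F) ^ _ * _‖ = _
  rw [norm_mul, norm_pow, norm_neg, norm_one, one_pow, one_mul]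
  refine (map_multiset_prod (normHom : AlgebraicClosure F →*₀ ℝ) _).trans ?_
  have hrep := Multiset.eq_replicate_of_mem (a := qPow F r)
    (s := (P.map (algebraMap F (AlgebraicClosure F))).roots.map
      (normHom : AlgebraicClosure F →*₀ ℝ)) fun x hx => by
    obtain ⟨a, ha, rfl⟩ := Multiset.mem_map.mp hx
    exact h.1 a ha
  rw [hrep, Multiset.prod_replicate, Multiset.card_map, ← hs.natDegree_eq_card_roots,
    natDegree_map]

theorem den_dvd_of_norm_eq_qPow (hϖ : Irreducible ϖ) (hq : ‖(ϖ : F)‖ = (resCard F : ℝ)⁻¹)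
    {x : F} {k : ℕ} (hx : x ≠ 0) (h : ‖x‖ = qPow F r ^ k) : r.den ∣ k := by
  let : NontriviallyNormedField (AlgebraicClosure F) := spectralNorm.nontriviallyNormedField F _
  let : NormedAlgebra F (AlgebraicClosure F) := spectralNorm.normedAlgebra F _
  have : IsUltrametricDist (AlgebraicClosure F) := absVal_isUltrametricDist
  obtain ⟨y, hy⟩ := exists_den_root F ϖ r
  have hyn : ‖y‖ = qPow F r := absVal_den_root hq hy
  exact den_dvd_of_norm_eq hϖ hy hx (by rw [hyn]; exact h)

end Slope

/-! ### Classification of restricted elements -/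

section Classification

variable {F : Type*} [NontriviallyNormedField F] [IsUltrametricDist F] [ProperSpace F] {ϖ : 𝒪[F]}
  {T : ClassicalType} {c : ℕ} {r : ℚ}

theorem coprime_factorial_ringChar {d : ℕ} (hd : d ≤ 2 * c + 1)
    (hM : Nat.Coprime (resCard F) (2 * c + 1).factorial) :
    Nat.Coprime d.factorial (ringChar 𝓀[F]) :=
  ((hM.coprime_dvd_left ringChar_dvd_resCard).coprime_dvd_right
    (Nat.factorial_dvd_factorial hd)).symm

theorem dim_le (T : ClassicalType) (c : ℕ) : T.dim c ≤ 2 * c + 1 := by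
  cases T
  · exact le_rfl
  · exact Nat.le_succ _
  · exact Nat.le_succ _

theorem natCast_ne_zero_of_residue {n : ℕ} (h : (n : 𝓀[F]) ≠ 0) : (n : F) ≠ 0 := by
  rw [← norm_ne_zero_iff, norm_natCast_eq_one h]
  exact one_ne_zero

theorem mul_redDegree (h : r.den ∣ 2 * c) : 2 * c = r.den * redDegree c r :=
  (Nat.mul_div_cancel' h).symm

variable {ε : Fin (T.dim c) → ℤˣ}

/-- The facts about a restricted element that depend on its characteristic polynomial only. -/
theorem restricted_isFormPoly (hc : 0 < c) (hM : Nat.Coprime (resCard F) (2 * c + 1).factorial)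
    (hε : T.IsFormSign ε) (X : Restricted F (MatAlg.form ε) r) :
    X.mat.charpoly.Separable ∧ IsFormPoly c (nonzeroPart X.mat.charpoly) ∧
      X.mat.charpoly = T.fullPoly (nonzeroPart X.mat.charpoly) ∧
      HasSlopeRoots (nonzeroPart X.mat.charpoly) (qPow F r) := by
  have hK := natCast_residue_ne_zero hM
  have hKF := natCast_ne_zero_of_residue hK
  obtain ⟨h1, h2⟩ := hasSlopeRoots_of_isRestricted rfl hc hK hKF hε X.2
  have h3 := isFormPoly_of_separable rfl (two_ne_zero_of_factorial hc hKF) X.1.2 h1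
  exact ⟨h1, h3.1, h3.2, h2⟩

theorem norm_pfaffian {ε : Fin (ClassicalType.evenOrthogonal.dim c) → ℤˣ} (hc : 0 < c)
    (hM : Nat.Coprime (resCard F) (2 * c + 1).factorial)
    (hε : ClassicalType.evenOrthogonal.IsFormSign ε) (X : Restricted F (MatAlg.form ε) r) :
    pfaffian (skewDiag ε F * X.mat) ^ 2 =
        (-1) ^ c * (nonzeroPart X.mat.charpoly).coeff 0 ∧
      ‖pfaffian (skewDiag ε F * X.mat)‖ = qPow F r ^ c := by
  obtain ⟨h1, h2, h3, h4⟩ := restricted_isFormPoly hc hM hε X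
  have hKF := natCast_ne_zero_of_residue (natCast_residue_ne_zero hM)
  have h5 := pfaffian_sq_eq_coeff_zero (m := c) rfl hc hKF hε X.1.2 h1
  have h3' : X.mat.charpoly = nonzeroPart X.mat.charpoly := h3
  have h5' : pfaffian (skewDiag ε F * X.mat) ^ 2 =
      (-1) ^ c * (nonzeroPart X.mat.charpoly).coeff 0 := by rw [← h3']; exact h5
  refine ⟨h5', (pow_left_inj₀ (norm_nonneg _) (pow_nonneg qPow_pos.le _) two_ne_zero).mp ?_⟩
  rw [← norm_pow, h5', norm_mul, norm_pow, norm_neg, norm_one, one_pow, one_mul,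
    h4.norm_coeff_zero h2.monic, h2.natDegree_eq, ← pow_mul, mul_comm]

/-- The constant term of `P` is an element of `F` of absolute value `q ^ (-2cr)`, so `n ∣ 2c`. In
the even orthogonal case its signed square root, the Pfaffian, also lies in `F`, and this gives the
stronger `n ∣ c`. -/
theorem admissible_of_restricted (hϖ : Irreducible ϖ) (hq : ‖(ϖ : F)‖ = (resCard F : ℝ)⁻¹)
    (hc : 0 < c) (hM : Nat.Coprime (resCard F) (2 * c + 1).factorial) (hε : T.IsFormSign ε)
    (X : Restricted F (MatAlg.form ε) r) : T.Admissible c r := by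
  obtain ⟨h1, h2, h3, h4⟩ := restricted_isFormPoly hc hM hε X
  have h5 : r.den ∣ 2 * c := den_dvd_of_norm_eq_qPow hϖ hq h2.coeff_zero_ne_zero
    (by rw [h4.norm_coeff_zero h2.monic, h2.natDegree_eq])
  cases T
  · exact h5
  · exact h5
  · have h6 := (norm_pfaffian hc hM hε X).2
    refine den_dvd_of_norm_eq_qPow hϖ hq (fun h0 => ?_) h6
    rw [h0, norm_zero] at h6
    exact (pow_pos qPow_pos c).ne h6

section Admissible

variable (hadm : T.Admissible c r)

theorem resAt_zero (hϖ : Irreducible ϖ) (i : ℤ) : resAt ϖ i (0 : F) = 0 := by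
  rw [resAt_eq hϖ (by rw [norm_zero]; exact zpow_nonneg (norm_nonneg _) i), zero_div, res_zero]

theorem coeff_zero_rReduction {P : F[X]} {g : ℕ} (hϖ : Irreducible ϖ)
    (hq : ‖(ϖ : F)‖ = (resCard F : ℝ)⁻¹) (hP : P.natDegree = r.den * g) (hg : 0 < g)
    (h : ‖P.coeff 0‖ = qPow F r ^ (r.den * g)) :
    (rReduction ϖ r P).coeff 0 = res (P.coeff 0 / (ϖ : F) ^ (r.num * g)) := by
  rw [coeff_rReduction hP hg, mul_zero, Nat.sub_zero, resAt_eq hϖ]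
  rw [h, qPow_pow_mul_den hq]

theorem res_neg_one_pow (m : ℕ) : res ((-1 : F) ^ m) = (-1) ^ m := by
  have h1 : res (-1 : F) = -1 := by
    have := res_sub (K := F) (x := 0) (y := 1) (by simp) (by simp)
    rwa [zero_sub, res_zero, res_one, zero_sub] at this
  rw [res_pow (by simp), h1]

theorem ac_pfaffian {ε : Fin (ClassicalType.evenOrthogonal.dim c) → ℤˣ} (hϖ : Irreducible ϖ)
    (hq : ‖(ϖ : F)‖ = (resCard F : ℝ)⁻¹) (hc : 0 < c)
    (hM : Nat.Coprime (resCard F) (2 * c + 1).factorial)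
    (hε : ClassicalType.evenOrthogonal.IsFormSign ε) (X : Restricted F (MatAlg.form ε) r) {m : ℕ}
    (hm : c = r.den * m) :
    ‖pfaffian (skewDiag ε F * X.mat)‖ = ‖(ϖ : F)‖ ^ (r.num * m) ∧
      ac ϖ (pfaffian (skewDiag ε F * X.mat)) =
        res (pfaffian (skewDiag ε F * X.mat) / (ϖ : F) ^ (r.num * m)) := by
  have h := (norm_pfaffian hc hM hε X).2
  have h' : ‖pfaffian (skewDiag ε F * X.mat)‖ = ‖(ϖ : F)‖ ^ (r.num * m) := by
    rw [h, ← qPow_pow_mul_den hq]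
    exact congrArg (fun e => qPow F r ^ e) hm
  exact ⟨h', ac_eq hϖ h'⟩

include hadm in
theorem isParam_of_restricted (hϖ : Irreducible ϖ) (hq : ‖(ϖ : F)‖ = (resCard F : ℝ)⁻¹)
    (hc : 0 < c) (hM : Nat.Coprime (resCard F) (2 * c + 1).factorial) (hε : T.IsFormSign ε)
    (X : Restricted F (MatAlg.form ε) r) :
    IsParam T c r (rReduction ϖ r (nonzeroPart X.mat.charpoly))
      (T.pfaffianInvariant ϖ ε X.mat) := by
  obtain ⟨h1, h2, h3, h4⟩ := restricted_isFormPoly hc hM hε X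
  have hdvd := den_dvd_of_admissible hadm
  have hg := mul_redDegree hdvd
  have hP := h2.natDegree_eq.trans hg
  have hgpos : 0 < redDegree c r := Nat.pos_of_ne_zero fun h => by rw [h] at hg; omega
  have hsep := h4.separable_rReduction hϖ hq h2.monic hP h2.separable
  refine ⟨monic_rReduction hP, natDegree_rReduction hP, hsep.1, hsep.2, fun hn i hi => ?_, ?_⟩
  · rcases lt_trichotomy i (redDegree c r) with h | h | h
    · rw [coeff_rReduction hP h, h2.coeff_eq_zero, resAt_zero hϖ]
      refine hn.mul ?_
      obtain ⟨m, -, -, hm, -⟩ := exists_rank_of_odd hc hadm hn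
      rw [hm] at hi
      obtain ⟨a, ha⟩ := hi
      exact ⟨a - m, by omega⟩
    · rw [h] at hi
      exact absurd hi (Nat.not_odd_iff_even.mpr ⟨_, rfl⟩)
    · exact coeff_rReduction_of_lt hP h
  · cases T
    · rfl
    · rfl
    · obtain ⟨m, hm⟩ := (hadm : r.den ∣ c)
      have hgm : redDegree c r = 2 * m := by
        refine Nat.eq_of_mul_eq_mul_left r.den_pos ?_
        rw [← hg]
        calc 2 * c = 2 * (r.den * m) := congrArg _ hm
          _ = _ := by ring
      obtain ⟨h5, h6⟩ := norm_pfaffian hc hM hε X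
      obtain ⟨h7, h8⟩ := ac_pfaffian hϖ hq hc hM hε X hm
      -- The identity between the squared Pfaffian and `P(0)` is divided by `ϖ ^ (2ℓm)` and reduced.
      -- With `c = n m` and `g = 2m` this power is the normalization on both sides.
      change ac ϖ (pfaffian (skewDiag ε F * X.mat)) ^ 2 = _
      have hn0 : ‖(nonzeroPart X.mat.charpoly).coeff 0‖ = qPow F r ^ (r.den * redDegree c r) := by
        rw [h4.norm_coeff_zero h2.monic, hP]
      have hle : ‖(nonzeroPart X.mat.charpoly).coeff 0 /
          (ϖ : F) ^ (r.num * redDegree c r)‖ ≤ 1 :=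
        norm_div_zpow_le_one hϖ (by rw [hn0, qPow_pow_mul_den hq])
      rw [h8, ← res_pow (norm_div_zpow_le_one hϖ h7.le), div_pow, h5,
        coeff_zero_rReduction hϖ hq hP hgpos hn0, ← res_neg_one_pow (F := F),
        ← res_mul (by simp) hle, ← zpow_natCast ((ϖ : F) ^ (r.num * (m : ℤ))), ← zpow_mul,
        hgm, mul_div_assoc]
      congr 4
      push_cast
      ring

theorem pfaffianClose_iff (hϖ : Irreducible ϖ) (hq : ‖(ϖ : F)‖ = (resCard F : ℝ)⁻¹)
    (hc : 0 < c) (hM : Nat.Coprime (resCard F) (2 * c + 1).factorial) (hε : T.IsFormSign ε)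
    (X X' : Restricted F (MatAlg.form ε) r) :
    T.PfaffianClose c r ε X.mat X'.mat ↔
      T.pfaffianInvariant ϖ ε X.mat = T.pfaffianInvariant ϖ ε X'.mat := by
  have hadm := admissible_of_restricted hϖ hq hc hM hε X
  cases T
  · exact iff_of_true trivial rfl
  · exact iff_of_true trivial rfl
  · obtain ⟨m, hm⟩ := (hadm : r.den ∣ c)
    obtain ⟨h7, h8⟩ := ac_pfaffian hϖ hq hc hM hε X hm
    obtain ⟨h7', h8'⟩ := ac_pfaffian hϖ hq hc hM hε X' hm
    change ‖pfaffian (skewDiag ε F * X.mat) - pfaffian (skewDiag ε F * X'.mat)‖ < qPow F (c * r) ↔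
      ac ϖ (pfaffian (skewDiag ε F * X.mat)) = ac ϖ (pfaffian (skewDiag ε F * X'.mat))
    have h9 : qPow F (c * r) = ‖(ϖ : F)‖ ^ (r.num * m) := by
      rw [qPow_natCast_mul, ← qPow_pow_mul_den hq]
      exact congrArg (fun e => qPow F r ^ e) hm
    rw [h8, h8', res_eq_res_iff (norm_div_zpow_le_one hϖ h7.le) (norm_div_zpow_le_one hϖ h7'.le),
      ← sub_div, norm_div, norm_zpow, div_lt_one (zpow_pos (norm_uniformizer_pos hϖ) _), h9]

/-- Equivalence becomes equality of invariants; this is why it is an equivalence relation and why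
the map to the parameter space is injective on classes. -/
theorem areEquivalent_iff (hϖ : Irreducible ϖ) (hq : ‖(ϖ : F)‖ = (resCard F : ℝ)⁻¹)
    (hc : 0 < c) (hM : Nat.Coprime (resCard F) (2 * c + 1).factorial) (hε : T.IsFormSign ε)
    (X X' : Restricted F (MatAlg.form ε) r) :
    AreEquivalent T c r ε X X' ↔
      rReduction ϖ r (nonzeroPart X.mat.charpoly) = rReduction ϖ r (nonzeroPart X'.mat.charpoly) ∧
        T.pfaffianInvariant ϖ ε X.mat = T.pfaffianInvariant ϖ ε X'.mat := by
  have hadm := admissible_of_restricted hϖ hq hc hM hε X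
  obtain ⟨h1, h2, h3, h4⟩ := restricted_isFormPoly hc hM hε X
  obtain ⟨h1', h2', h3', h4'⟩ := restricted_isFormPoly hc hM hε X'
  have hg := mul_redDegree (den_dvd_of_admissible hadm)
  refine and_congr ?_ (pfaffianClose_iff hϖ hq hc hM hε X X')
  rw [h4.rReduction_eq_iff (T := T) hϖ hq h2.monic (h2.natDegree_eq.trans hg) h2'.monic
    (h2'.natDegree_eq.trans hg) h4' (natDegree_fullPoly h2) (natDegree_fullPoly h2'), ← h3, ← h3',
    ← geom_charpoly, ← geom_charpoly]
  rfl

theorem pfaffianInvariant_eq_of_stablyConj {X X' : Matrix (Fin (T.dim c)) (Fin (T.dim c)) F}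
    (h : (MatAlg.form ε).StablyConj X X') :
    T.pfaffianInvariant ϖ ε X = T.pfaffianInvariant ϖ ε X' := by
  cases T
  · rfl
  · rfl
  · exact congrArg (ac ϖ) (pfaffian_eq_of_stablyConj (m := c) rfl h)

/-- A lift of the parameter `R` to a characteristic polynomial. -/
theorem exists_lift {R : 𝓀[F][X]} {g : ℕ} (hϖ : Irreducible ϖ)
    (hq : ‖(ϖ : F)‖ = (resCard F : ℝ)⁻¹) (hR : R.Monic) (hd : R.natDegree = g) (hsep : R.Separable)
    (h0 : R.coeff 0 ≠ 0) (hn : (r.den : 𝓀[F]) ≠ 0) (hg : 0 < g) {a : F} (ha : ‖a‖ ≤ 1)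
    (ha' : res a = R.coeff 0) :
    ∃ P : F[X], P.Monic ∧ P.natDegree = r.den * g ∧ P.Separable ∧
      HasSlopeRoots P (qPow F r) ∧ rReduction ϖ r P = R ∧
      P.coeff 0 = a * (ϖ : F) ^ (r.num * g) ∧
      (∀ i, ¬ r.den ∣ i → P.coeff i = 0) ∧
      ∀ i, 0 < i → R.coeff i = 0 → P.coeff (r.den * i) = 0 := by
  classical
  have hϖ0 : (ϖ : F) ≠ 0 := norm_pos_iff.mp (norm_uniformizer_pos hϖ)
  -- Zero coefficients are lifted to zero, to keep the polynomial even, and the constant term to the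
  -- prescribed `a`, to keep the Pfaffian equation exact.
  have hex : ∀ i, ∃ b : F, ‖b‖ ≤ 1 ∧ res b = R.coeff i ∧ (i = 0 → b = a) ∧
      (0 < i → R.coeff i = 0 → b = 0) := by
    intro i
    rcases Nat.eq_zero_or_pos i with rfl | hi
    · exact ⟨a, ha, ha', fun _ => rfl, fun h => absurd h (lt_irrefl _)⟩
    · by_cases hz : R.coeff i = 0
      · exact ⟨0, by simp, by rw [hz, res_zero], fun h => absurd h hi.ne', fun _ _ => rfl⟩
      · obtain ⟨b, hb, hb'⟩ := exists_res_eq (R.coeff i)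
        exact ⟨b, hb, hb', fun h => absurd h hi.ne', fun _ h => absurd h hz⟩
  choose b hb1 hb2 hb3 hb4 using hex
  -- The entry `j`, counted from zero, belongs to the coefficient `a_(j+1)` of the statement; hence
  -- the exponent `ℓ (j + 1)`.
  set Q : F[X] := monicOfCoeffs (g := g) fun j =>
    b (g - 1 - j) * (ϖ : F) ^ (r.num * (j + 1 : ℕ)) with hQ
  have hQm : Q.Monic := monic_monicOfCoeffs _
  have hQd : Q.natDegree = g := natDegree_monicOfCoeffs _
  have hQc : ∀ i < g, Q.coeff i = b i * (ϖ : F) ^ (r.num * (g - i : ℕ)) := by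
    intro i hi
    have h1 := coeff_monicOfCoeffs (fun j : Fin g =>
      b (g - 1 - j) * (ϖ : F) ^ (r.num * ((j : ℕ) + 1 : ℕ))) ⟨g - 1 - i, by omega⟩
    simp only [show g - 1 - (g - 1 - i) = i by omega,
      show g - 1 - i + 1 = g - i by omega] at h1
    exact h1
  set P := expand F r.den Q with hP
  have hPm : P.Monic := hQm.expand r.den_pos
  have hPd : P.natDegree = r.den * g := by rw [hP, natDegree_expand, hQd, mul_comm]
  have hPc : ∀ i, P.coeff (r.den * i) = Q.coeff i := fun i => by
    rw [hP, mul_comm, coeff_expand_mul r.den_pos]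
  have hPz : ∀ i, ¬ r.den ∣ i → P.coeff i = 0 := fun i hi => by
    rw [hP, coeff_expand r.den_pos, if_neg hi]
  have hnorm : ∀ i < g, ‖P.coeff (r.den * i)‖ ≤ ‖(ϖ : F)‖ ^ (r.num * (g - i : ℕ)) := by
    intro i hi
    rw [hPc, hQc i hi, norm_mul, norm_zpow]
    exact mul_le_of_le_one_left (zpow_nonneg (norm_nonneg _) _) (hb1 i)
  have hred : rReduction ϖ r P = R := by
    refine rReduction_ext hPd hR hd fun i hi => ?_
    rw [resAt_eq hϖ (hnorm i hi), hPc, hQc i hi, mul_div_cancel_right₀ _ (zpow_ne_zero _ hϖ0), hb2]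
  have hle : ∀ i < P.natDegree, ‖P.coeff i‖ ≤ qPow F r ^ (P.natDegree - i) := by
    intro i hi
    by_cases hdvd : r.den ∣ i
    · obtain ⟨j, rfl⟩ := hdvd
      rw [hPd] at hi ⊢
      rw [← Nat.mul_sub, qPow_pow_mul_den hq]
      exact hnorm j (lt_of_mul_lt_mul_left hi (Nat.zero_le _))
    · rw [hPz i hdvd, norm_zero]
      exact pow_nonneg qPow_pos.le _
  have hs := hasSlopeRoots_of_separable hϖ hq hPm hPd hle hn (by rw [hred]; exact hsep)
    (by rw [hred]; exact h0)
  refine ⟨P, hPm, hPd, hs.1, hs.2, hred, ?_, hPz, fun i hi hz => ?_⟩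
  · have := hPc 0
    rw [mul_zero] at this
    rw [this, hQc 0 hg, hb3 0 rfl, Nat.sub_zero]
  · rw [hPc]
    rcases lt_trichotomy i g with h | h | h
    · rw [hQc i h, hb4 i hi hz, zero_mul]
    · rw [h, ← hd, hR.coeff_natDegree] at hz
      exact absurd hz one_ne_zero
    · exact coeff_eq_zero_of_natDegree_lt (by omega)

include hadm in
theorem exists_restricted (hϖ : Irreducible ϖ) (hq : ‖(ϖ : F)‖ = (resCard F : ℝ)⁻¹)
    (hc : 0 < c) (hM : Nat.Coprime (resCard F) (2 * c + 1).factorial) (hε : T.IsFormSign ε)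
    {R : 𝓀[F][X]} {v : 𝓀[F]} (h : IsParam T c r R v) :
    ∃ X : Restricted F (MatAlg.form ε) r,
      rReduction ϖ r (nonzeroPart X.mat.charpoly) = R ∧ T.pfaffianInvariant ϖ ε X.mat = v := by
  have hK := natCast_residue_ne_zero hM
  have hKF := natCast_ne_zero_of_residue hK
  have hϖ0 : (ϖ : F) ≠ 0 := norm_pos_iff.mp (norm_uniformizer_pos hϖ)
  have hdvd := den_dvd_of_admissible hadm
  have hg := mul_redDegree hdvd
  have hgpos : 0 < redDegree c r := Nat.pos_of_ne_zero fun h => by rw [h] at hg; omega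
  have hn : (r.den : 𝓀[F]) ≠ 0 := natCast_ne_zero_of_factorial hK r.den_pos
    ((Nat.le_of_dvd (by omega) hdvd).trans (Nat.le_succ _))
  -- In the even orthogonal case `v` is lifted first and `a = (-1)^c w^2` is put, so that the square
  -- root needed over `F` is there by construction.
  obtain ⟨w, hw, hw'⟩ := exists_res_eq v
  obtain ⟨a, ha, ha', haw⟩ : ∃ a : F, ‖a‖ ≤ 1 ∧ res a = R.coeff 0 ∧
      (T = .evenOrthogonal → w ^ 2 = (-1) ^ c * a) := by
    by_cases hT : T = .evenOrthogonal
    · have hv : v ^ 2 = (-1) ^ c * R.coeff 0 := by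
        have := h.pfaffian_eq
        rw [hT] at this
        exact this
      have hs : ∀ {k : Type _} [CommRing k], (-1 : k) ^ c * (-1) ^ c = 1 := fun {k} _ => by
        rw [← mul_pow, neg_one_mul, neg_neg, one_pow]
      have hw2 : ‖w ^ 2‖ ≤ 1 := by rw [norm_pow]; exact pow_le_one₀ (norm_nonneg _) hw
      have hs1 : ‖(-1 : F) ^ c‖ ≤ 1 := by simp
      refine ⟨(-1) ^ c * w ^ 2, ?_, ?_, fun _ => ?_⟩
      · rw [norm_mul]
        exact mul_le_one₀ hs1 (norm_nonneg _) hw2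
      · rw [res_mul hs1 hw2, res_neg_one_pow, res_pow hw, hw', hv, ← mul_assoc, hs, one_mul]
      · rw [← mul_assoc, hs, one_mul]
    · obtain ⟨a, ha, ha'⟩ := exists_res_eq (R.coeff 0)
      exact ⟨a, ha, ha', fun h => absurd h hT⟩
  obtain ⟨P, hPm, hPd, hPs, hPr, hPR, hP0, hPz, hPz'⟩ := exists_lift hϖ hq h.monic h.natDegree_eq
    h.separable h.coeff_zero_ne_zero hn hgpos ha ha'
  have ha0 : a ≠ 0 := fun h0 => h.coeff_zero_ne_zero (by rw [← ha', h0, res_zero])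
  have hform : IsFormPoly c P := by
    refine ⟨hPm, hPd.trans hg.symm, hPs, ?_, fun i hi => ?_⟩
    · rw [hP0]
      exact mul_ne_zero ha0 (zpow_ne_zero _ hϖ0)
    · by_cases hdi : r.den ∣ i
      · obtain ⟨j, rfl⟩ := hdi
        obtain ⟨ho, hj⟩ := Nat.odd_mul.mp hi
        refine hPz' j hj.pos (h.coeff_eq_zero ho j ?_)
        obtain ⟨m, -, -, hm, -⟩ := exists_rank_of_odd hc hadm ho
        rw [hm]
        exact Even.add_odd ⟨m, two_mul m⟩ hj
      · exact hPz i hdi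
  -- The valuation of the Pfaffian is half of `ℓ g`, an integer because `g` is even in the even
  -- orthogonal case. In the other cases `e` is a dummy.
  obtain ⟨e, he⟩ : ∃ e : ℤ, T = .evenOrthogonal → r.num * redDegree c r = 2 * e := by
    by_cases hT : T = .evenOrthogonal
    · subst hT
      obtain ⟨k, hk⟩ := even_redDegree hadm
      have hk' : redDegree c r = k + k := hk
      refine ⟨r.num * k, fun _ => ?_⟩
      rw [hk']
      push_cast
      ring
    · exact ⟨0, fun h => absurd h hT⟩
  obtain ⟨X, hX, hXP, hpf⟩ := exists_mem_lie_form (ε := ε) (v := w * (ϖ : F) ^ e) rfl hc hKF hε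
    hform (fun hT => by
      rw [mul_pow, haw hT, hP0, he hT, mul_assoc, ← zpow_natCast ((ϖ : F) ^ e), ← zpow_mul,
        mul_comm e]
      rfl)
  refine ⟨⟨⟨X, hX⟩, isRestricted_of_hasSlopeRoots hϖ rfl hc hKF
    (coprime_factorial_ringChar (dim_le T c) hM) hε hform hXP hPr⟩, ?_, ?_⟩
  · change rReduction ϖ r (nonzeroPart X.charpoly) = R
    rw [hXP, nonzeroPart_fullPoly hform.coeff_zero_ne_zero, hPR]
  · have hv := h.pfaffian_eq
    change T.pfaffianInvariant ϖ ε X = v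
    cases T
    · exact hv.symm
    · exact hv.symm
    · have hv0 : v ≠ 0 := by
        rintro rfl
        rw [zero_pow two_ne_zero] at hv
        exact mul_ne_zero (pow_ne_zero _ (neg_ne_zero.mpr one_ne_zero)) h.coeff_zero_ne_zero hv.symm
      -- As `R(0) ≠ 0`, also `v ≠ 0`; so `w` is a unit, and the angular component of `w ϖ^e` is its
      -- residue `v`.
      have hw1 : ‖w‖ = 1 := (res_ne_zero_iff hw).mp (by rw [hw']; exact hv0)
      change ac ϖ (pfaffian (skewDiag ε F * X)) = v
      rw [hpf rfl, ac_eq hϖ (i := e) (by rw [norm_mul, hw1, one_mul, norm_zpow]),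
        mul_div_cancel_right₀ _ (zpow_ne_zero _ hϖ0), hw']

include hadm in
theorem exists_restricted_classification (hϖ : Irreducible ϖ)
    (hq : ‖(ϖ : F)‖ = (resCard F : ℝ)⁻¹) (hc : 0 < c) {M : ℕ} (hMc : M = (2 * c + 1).factorial)
    (hM : Nat.Coprime (resCard F) M) (hε : T.IsFormSign ε) :
    Equivalence (AreEquivalent (F := F) T c r ε) ∧
    (∀ X X' : Restricted F (MatAlg.form ε) r,
      (MatAlg.form ε).StablyConj X.mat X'.mat → AreEquivalent T c r ε X X') ∧
    ∃ μ : Quot (ClassesEquivalent F T c r ε) → T.ParamPoint c r M 𝓀[F],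
      (∀ X : Restricted F (MatAlg.form ε) r,
        paramPoly (μ (Quot.mk _ (Quotient.mk _ X))) =
            rReduction ϖ r (nonzeroPart X.mat.charpoly) ∧
          paramPfaffian (μ (Quot.mk _ (Quotient.mk _ X))) = T.pfaffianInvariant ϖ ε X.mat) ∧
      Function.Bijective μ := by
  have hK : (M : 𝓀[F]) ≠ 0 := natCast_residue_ne_zero hM
  have hM' := hMc ▸ hM
  have hiff := fun X X' => areEquivalent_iff (r := r) hϖ hq hc hM' hε X X'
  have hstab : ∀ X X' : Restricted F (MatAlg.form ε) r,
      (MatAlg.form ε).StablyConj X.mat X'.mat → AreEquivalent T c r ε X X' := fun X X' h =>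
    (hiff X X').mpr ⟨by rw [charpoly_eq_of_stablyConj h], pfaffianInvariant_eq_of_stablyConj h⟩
  refine ⟨⟨fun X => (hiff X X).mpr ⟨rfl, rfl⟩, fun {X X'} h => ?_, fun {X X' X''} h h' => ?_⟩,
    hstab, ?_⟩
  · have := (hiff X X').mp h
    exact (hiff X' X).mpr ⟨this.1.symm, this.2.symm⟩
  · have h1 := (hiff X X').mp h
    have h2 := (hiff X' X'').mp h'
    exact (hiff X X'').mpr ⟨h1.1.trans h2.1, h1.2.trans h2.2⟩
  choose φ hφ hφ' using fun X : Restricted F (MatAlg.form ε) r =>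
    exists_paramPoint hK (isParam_of_restricted hadm hϖ hq hc hM' hε X)
  have heq : ∀ X X', AreEquivalent T c r ε X X' ↔ φ X = φ X' := by
    intro X X'
    rw [hiff]
    constructor
    · rintro ⟨h, h'⟩
      exact paramPoint_ext (by rw [hφ, hφ, h]) (by rw [hφ', hφ', h'])
    · intro h
      exact ⟨by rw [← hφ, ← hφ, h], by rw [← hφ', ← hφ', h]⟩
  let φ' : StableClass F (MatAlg.form ε) r → T.ParamPoint c r M 𝓀[F] :=
    Quotient.lift φ fun X X' h => (heq X X').mp (hstab X X' h)
  refine ⟨Quot.lift φ' ?_, fun X => ⟨hφ X, hφ' X⟩, ?_, fun s => ?_⟩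
  · rintro _ _ ⟨X, X', rfl, rfl, h⟩
    exact (heq X X').mp h
  · rintro ⟨x⟩ ⟨x'⟩ h
    induction x using Quotient.inductionOn with
    | h X =>
      induction x' using Quotient.inductionOn with
      | h X' => exact Quot.sound ⟨X, X', rfl, rfl, (heq X X').mpr h⟩
  · obtain ⟨X, hX, hX'⟩ := exists_restricted hadm hϖ hq hc hM' hε (isParam_of_paramPoint s)
    exact ⟨Quot.mk _ (Quotient.mk _ X),
      paramPoint_ext ((hφ X).trans hX) ((hφ' X).trans hX')⟩

end Admissible

end Classification

end ClassicalSlope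

end

theorem mainTheorem8 (T : ClassicalType) (c : ℕ) (hc : T.minRank ≤ c) (r : ℚ) :
    ∃ M : ℕ, 0 < M ∧ (2 * c).factorial ∣ M ∧
      -- For the slopes that occur, `S_{𝔤,r}` over `ℤ[1/M]` is the variety of (stable) regular
      -- semisimple conjugacy classes in the `r`-reduced algebra, with the Pfaffian refinement.
      (T.Admissible c r →
        ∀ (k : Type*) [Field k], (M : k) ≠ 0 →
        ∀ η : Fin (T.redDim c r) → ℤˣ, T.IsFormSign η →
          ∃ χ : RedElement T c r η k → T.ParamPoint c r M k,
            (∀ y, paramPoly (χ y) = nonzeroPart y.x.charpoly ∧ paramPfaffian (χ y) = y.v) ∧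
            Function.Surjective χ ∧
            ∀ y y', χ y = χ y' ↔ (T.redAlg c r η).StablyConj y.x y'.x ∧ y.v = y'.v) ∧
      -- All non-archimedean local fields `F` of residual characteristic prime to `M`, with
      -- normalized absolute value and a choice of uniformizer, and all forms `J`.
      ∀ (F : Type*) [NontriviallyNormedField F] [IsUltrametricDist F] [ProperSpace F]
        (ϖ : 𝒪[F]), Irreducible ϖ → ‖(ϖ : F)‖ = (resCard F : ℝ)⁻¹ →
        Nat.Coprime (resCard F) M →
        ∀ ε : Fin (T.dim c) → ℤˣ, T.IsFormSign ε →
          -- The other slopes do not occur.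
          (¬ T.Admissible c r → IsEmpty (Restricted F (MatAlg.form ε) r)) ∧
          (T.Admissible c r →
            Equivalence (AreEquivalent (F := F) T c r ε) ∧
            (∀ X X' : Restricted F (MatAlg.form ε) r,
              (MatAlg.form ε).StablyConj X.mat X'.mat → AreEquivalent T c r ε X X') ∧
            ∃ μ : Quot (ClassesEquivalent F T c r ε) → T.ParamPoint c r M 𝓀[F],
              (∀ X : Restricted F (MatAlg.form ε) r,
                paramPoly (μ (Quot.mk _ (Quotient.mk _ X))) =
                    rReduction ϖ r (nonzeroPart X.mat.charpoly) ∧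
                  paramPfaffian (μ (Quot.mk _ (Quotient.mk _ X))) =
                    T.pfaffianInvariant ϖ ε X.mat) ∧
              Function.Bijective μ) := by
  have hc0 : 0 < c := T.minRank_pos.trans_le hc
  -- The factor `2c + 1` makes `M` a multiple of `d!` also in the odd orthogonal dimension `d = 2c +
  -- 1`, which the tameness argument uses.
  refine ⟨(2 * c + 1).factorial, Nat.factorial_pos _, Nat.factorial_dvd_factorial (Nat.le_succ _),
    fun hadm k _ hk η hη => exists_redElement_classification hc0 hadm rfl hk hη,
    fun F _ _ _ ϖ hϖ hq hM ε hε => ⟨fun hadm => ⟨fun X => hadm ?_⟩, fun hadm =>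
      exists_restricted_classification hadm hϖ hq hc0 rfl hM hε⟩⟩
  exact admissible_of_restricted hϖ hq hc0 hM hε X
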